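/- Theorem 1.4. Let $n \ge 2$, and let $Q_n$ be the $n$-dimensional hypercube: the graph whose vertices are all subsets of $[n]=\{1,\dots,n\}$, two subsets being adjacent if and only if they differ in exactly one element. The direction of an edge $uv$ of $Q_n$ is the unique element $i\in[n]$ in which $u$ and $v$ differ. Let $M$ be a matching of $Q_n$ (a set of pairwise disjoint edges of $Q_n$, not necessarily perfect and possibly empty) whose edges lie in at most $5$ distinct directions. Then $M$ can be extended to a Hamilton cycle of $Q_n$, i.e. there is a Hamilton cycle of $Q_n$ that contains every edge of $M$. -/

import Mathlib

/-- The `n`-dimensional hypercube: the vertices are the subsets of an `n`-element set, and two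
subsets are adjacent when they differ in exactly one element. -/
def hypercube (n : ℕ) : SimpleGraph (Finset (Fin n)) where
  Adj u v := (symmDiff u v).card = 1
  symm := ⟨fun u v h => by rwa [symmDiff_comm]⟩
  loopless := ⟨fun u h => by simp at h⟩

/-- The directions spanned by a subgraph `M` of the hypercube: those positions `i` for which some
edge `uv` of `M` has endpoints differing exactly in the element `i`. -/
def spannedDirections {n : ℕ} (M : (hypercube n).Subgraph) : Set (Fin n) :=
  {i | ∃ u v : Finset (Fin n), M.Adj u v ∧ symmDiff u v = {i}}

/-!
Enlarge the matching to a relation `R` that is a maximal matching among those with directions in a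
set `D`, where `D` contains the directions of `M` and has five elements (or consists of all
directions if `n < 5`). A path through all vertices of a subcube is called closable if its ends are
adjacent, in direction `j` say; it then becomes a Hamilton cycle by adding one edge. Such a path
that contains `R` exists for the subcube at `u` spanned by `D` for many `j`: at least three of the
five directions (`IsMaximalMatching.exists_hasClosablePath`). This is the heart of the proof.

For larger cubes, note that any two sets of three out of five directions intersect. So two adjacent
five-dimensional subcubes, related by a direction `j ∉ D`, have closable paths which start at
neighbours `u`, `u'` and whose ends differ from `u`, `u'` by the same direction; following the first
path to its end, crossing over in direction `j` and following the second one backwards yields a path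
from `u` to `u'` (`HasClosablePath.insert`). No edge of `R` is lost since none has direction `j`.
This path is closable in direction `j`, and since `j` can be any direction outside `D`, the argument
repeats until all directions are used (`hasClosablePath_union`).

In dimension five, a counting argument finds a direction `i ∈ D` along which the cube can be split
into two 4-cubes such that at most three edges of `R` cross from one half to the other, and if there
are three, then their ends in one half are not all of the same parity
(`IsMaximalMatching.exists_few_crossings`). Up to symmetry the crossing edges are at one of nine
nonempty sets of vertices of the 4-cube (`exists_normal_form`), or there are none. In each half, `R`
restricts to a matching that is maximal among those avoiding these vertices. A Hamilton cycle of the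
5-cube is put together from path systems of the two halves, with two or four ends in each half,
which are copies of each other; all crossing edges have to be at these ends (`Closable`).

It remains to find enough path systems in the 4-cube. For each of the ten sets of crossings a family
of path systems is given, and a search through all maximal matchings avoiding the crossings confirms
that the family contains suitable members for each of them; nothing else about the families is used.
What is checked concerns one matching at a time, so that pairs of matchings of the two halves never
have to be enumerated: in their role as the back half all matchings provide the same links
(`PortGroup.back`, and for an empty set of crossings a family of pairwise intersecting sets of ends,
`freeLeafCheck`), and in their role as the front half each matching has three directions at each
vertex for which its members close up with these links.

The search is written with numbers whose binary digits encode sets, and with the operations on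
natural numbers that the kernel computes natively. A vertex of the 4-cube is the number whose digits
are its coordinates, an edge is given by an end and a direction, and a set of members of a family is
the number with a digit for each member.
-/

namespace HypercubeMatching

/-! ### Consecutive vertices of lists, paths and closed tours -/

section Lists

variable {α β : Type*}

/-- `x` and `y` occur next to each other, in either order, in the list `l`. -/
def Consecutive (l : List α) (x y : α) : Prop :=
  [x, y] <:+: l ∨ [y, x] <:+: l

theorem Consecutive.symm {l : List α} {x y : α} (h : Consecutive l x y) : Consecutive l y x :=
  Or.symm h

theorem Consecutive.mono {l l' : List α} {x y : α} (h : Consecutive l x y) (hl : l <:+: l') :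
    Consecutive l' x y :=
  h.imp (·.trans hl) (·.trans hl)

theorem Consecutive.reverse {l : List α} {x y : α} (h : Consecutive l x y) :
    Consecutive l.reverse x y := by
  rcases h with h | h
  · exact .inr (by simpa using List.reverse_infix.2 h)
  · exact .inl (by simpa using List.reverse_infix.2 h)

theorem Consecutive.map {l : List α} {x y : α} (h : Consecutive l x y) (f : α → β) :
    Consecutive (l.map f) (f x) (f y) :=
  h.imp (fun h => by simpa using h.map f) (fun h => by simpa using h.map f)

theorem consecutive_append_boundary {l l' : List α} {x y : α} (h : l.getLast? = some x)
    (h' : l'.head? = some y) : Consecutive (l ++ l') x y := by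
  obtain ⟨a, rfl⟩ := List.getLast?_eq_some_iff.1 h
  obtain ⟨b, rfl⟩ := List.head?_eq_some_iff.1 h'
  exact .inl ⟨a, b, by simp⟩

theorem pair_infix_append {a b : List α} {x y : α} (h : [x, y] <:+: a ++ b) :
    [x, y] <:+: a ∨ [x, y] <:+: b ∨ (a.getLast? = some x ∧ b.head? = some y) := by
  induction a with
  | nil => exact .inr (.inl (by simpa using h))
  | cons c a ih =>
    rw [List.cons_append, List.infix_cons_iff] at h
    rcases h with h | h
    · rw [List.cons_prefix_cons] at h
      obtain ⟨rfl, h⟩ := h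
      cases a with
      | nil =>
        obtain ⟨t, rfl⟩ := h
        exact .inr (.inr (by simp))
      | cons d a =>
        rw [List.cons_append, List.cons_prefix_cons] at h
        obtain ⟨rfl, -⟩ := h
        exact .inl ⟨[], a, rfl⟩
    · rcases ih h with h | h | ⟨h₁, h₂⟩
      · exact .inl (h.trans (List.suffix_cons c a).isInfix)
      · exact .inr (.inl h)
      · refine .inr (.inr ⟨?_, h₂⟩)
        cases a with
        | nil => simp at h₁
        | cons d a => simpa using h₁

/-- `x` and `y` are neighbours in the closed tour through the vertices of `l`: they are
consecutive in `l`, or they are its first and its last element. -/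
def CyclicallyConsecutive (l : List α) (x y : α) : Prop :=
  Consecutive l x y ∨ (l.head? = some x ∧ l.getLast? = some y) ∨
    (l.head? = some y ∧ l.getLast? = some x)

theorem CyclicallyConsecutive.symm {l : List α} {x y : α} (h : CyclicallyConsecutive l x y) :
    CyclicallyConsecutive l y x :=
  h.imp Consecutive.symm Or.symm

theorem CyclicallyConsecutive.rotate {a b : List α} {x y : α}
    (h : CyclicallyConsecutive (a ++ b) x y) : CyclicallyConsecutive (b ++ a) x y := by
  rcases eq_or_ne a [] with rfl | ha
  · simpa using h
  rcases eq_or_ne b [] with rfl | hb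
  · simpa using h
  have key : ∀ {x y : α}, [x, y] <:+: a ++ b → CyclicallyConsecutive (b ++ a) x y := by
    intro x y h
    rcases pair_infix_append h with h | h | ⟨h₁, h₂⟩
    · exact .inl (.inl (h.trans List.infix_append_right))
    · exact .inl (.inl (h.trans List.infix_append_left))
    · exact .inr (.inr (by simp [h₁, h₂]))
  have ends : ∀ {x y : α}, (a ++ b).head? = some x → (a ++ b).getLast? = some y →
      Consecutive (b ++ a) y x := by
    intro x y h h'
    apply consecutive_append_boundary
    · simpa [List.getLast?_append, List.getLast?_eq_some_getLast hb] using h'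
    · simpa [List.head?_append, List.head?_eq_some_head ha] using h
  rcases h with (h | h) | ⟨h, h'⟩ | ⟨h, h'⟩
  · exact key h
  · exact (key h).symm
  · exact .inl (ends h h').symm
  · exact .inl (ends h h')

end Lists

section Paths

variable {V : Type*} {G : SimpleGraph V} {s : Set V} {R : V → V → Prop}

/-- The list `l` is a path of `G` from `u` to `w` which visits every vertex of `s` exactly once and
no other vertex, and in which the two ends of every `R`-edge inside `s` are consecutive. -/
structure IsSpanningPath (G : SimpleGraph V) (s : Set V) (R : V → V → Prop) (l : List V)
    (u w : V) : Prop where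
  head : l.head? = some u
  last : l.getLast? = some w
  chain : l.IsChain G.Adj
  nodup : l.Nodup
  mem : ∀ v, v ∈ l ↔ v ∈ s
  covers : ∀ x ∈ s, ∀ y ∈ s, R x y → Consecutive l x y

/-- The list `l`, closed up by the edge from its last to its first element, is a cycle of `G`
through every vertex of `s` and no other vertex, which contains every `R`-edge inside `s`. -/
structure IsSpanningTour (G : SimpleGraph V) (s : Set V) (R : V → V → Prop) (l : List V) :
    Prop where
  chain : l.IsChain G.Adj
  closes : ∀ x ∈ l.getLast?, ∀ y ∈ l.head?, G.Adj x y
  nodup : l.Nodup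
  mem : ∀ v, v ∈ l ↔ v ∈ s
  covers : ∀ x ∈ s, ∀ y ∈ s, R x y → CyclicallyConsecutive l x y

theorem isChain_adj_reverse {l : List V} (h : l.IsChain G.Adj) : l.reverse.IsChain G.Adj :=
  List.isChain_reverse.2 (h.imp fun _ _ => G.symm.symm _ _)

theorem IsSpanningPath.reverse {l : List V} {u w : V} (h : IsSpanningPath G s R l u w) :
    IsSpanningPath G s R l.reverse w u where
  head := by simpa using h.last
  last := by simpa using h.head
  chain := isChain_adj_reverse h.chain
  nodup := by simpa using h.nodup
  mem := by simpa using h.mem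
  covers x hx y hy hxy := (h.covers x hx y hy hxy).reverse

theorem IsSpanningTour.rotate {a b : List V} (h : IsSpanningTour G s R (a ++ b)) :
    IsSpanningTour G s R (b ++ a) := by
  rcases eq_or_ne a [] with rfl | ha
  · simpa using h
  rcases eq_or_ne b [] with rfl | hb
  · simpa using h
  have hc := List.isChain_append.1 h.chain
  refine ⟨List.isChain_append.2 ⟨hc.2.1, hc.1, fun x hx y hy => h.closes x ?_ y ?_⟩, ?_, ?_, ?_, ?_⟩
  · simp only [Option.mem_def] at hx ⊢
    simp [List.getLast?_append, hx]
  · simp only [Option.mem_def] at hy ⊢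
    simp [List.head?_append, hy]
  · intro x hx y hy
    refine hc.2.2 x ?_ y ?_
    · simpa [List.getLast?_append, List.getLast?_eq_some_getLast ha] using hx
    · simpa [List.head?_append, List.head?_eq_some_head hb] using hy
  · exact (List.perm_append_comm.nodup_iff).1 h.nodup
  · intro v
    rw [← h.mem v, List.mem_append, List.mem_append, or_comm]
  · exact fun x hx y hy hxy => (h.covers x hx y hy hxy).rotate

/-- A tour may be cut open at any of its edges that is not an `R`-edge. -/
theorem IsSpanningTour.exists_path {l : List V} (h : IsSpanningTour G s R l) {u w : V}
    (huw : CyclicallyConsecutive l u w) (hR : ¬ R u w) (hR' : ¬ R w u) :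
    ∃ l', IsSpanningPath G s R l' u w := by
  have closed : ∀ {l : List V} {u w : V}, IsSpanningTour G s R l → ¬ R u w → ¬ R w u →
      l.head? = some u → l.getLast? = some w → IsSpanningPath G s R l u w := by
    intro l u w h hR hR' hu hw
    refine ⟨hu, hw, h.chain, h.nodup, h.mem, fun x hx y hy hxy => ?_⟩
    rcases h.covers x hx y hy hxy with h | ⟨h, h'⟩ | ⟨h, h'⟩
    · exact h
    · rw [hu, Option.some.injEq] at h
      rw [hw, Option.some.injEq] at h'
      subst h h'
      exact absurd hxy hR
    · rw [hu, Option.some.injEq] at h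
      rw [hw, Option.some.injEq] at h'
      subst h h'
      exact absurd hxy hR'
  have inner : ∀ {u w : V}, [u, w] <:+: l → ¬ R u w → ¬ R w u →
      ∃ l', IsSpanningPath G s R l' w u := by
    rintro u w ⟨a, b, rfl⟩ hR hR'
    have h' : IsSpanningTour G s R ((a ++ [u]) ++ (w :: b)) := by simpa using h
    exact ⟨_, closed h'.rotate hR' hR (by simp)
      (by rw [← List.append_assoc, List.getLast?_append]; simp)⟩
  rcases huw with (h' | h') | ⟨h₁, h₂⟩ | ⟨h₁, h₂⟩
  · obtain ⟨l', hl'⟩ := inner h' hR hR'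
    exact ⟨_, hl'.reverse⟩
  · exact inner h' hR' hR
  · exact ⟨l, closed h hR hR' h₁ h₂⟩
  · exact ⟨_, (closed h hR' hR h₁ h₂).reverse⟩

end Paths

/-! ### Codes of vertices and the executable search -/

/-- The neighbour of the vertex with code `v` in direction `j`. A vertex of the `d`-cube is coded by
a natural number below `2 ^ d`, whose binary digits are the coordinates. -/
def flipBit (v j : ℕ) : ℕ := Nat.xor v (Nat.shiftLeft 1 j)

/-- The `i`-th binary digit of `m`. This is `Nat.testBit`, written with the operations that the
kernel evaluates natively. -/
def hasBit (m i : ℕ) : Bool := Nat.beq (Nat.land (Nat.shiftRight m i) 1) 1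

def setBit (m i : ℕ) : ℕ := Nat.lor m (Nat.shiftLeft 1 i)

/-- Whether the sets of binary digits of `a` and `b` have a common element. -/
def meets (a b : ℕ) : Bool := not (Nat.beq (Nat.land a b) 0)

def anyBelow (d : ℕ) (f : ℕ → Bool) : Bool := Nat.rec false (fun j ih => or (f j) ih) d

def allBelow (d : ℕ) (f : ℕ → Bool) : Bool := Nat.rec true (fun j ih => and (f j) ih) d

def countBelow (d : ℕ) (f : ℕ → Bool) : ℕ :=
  Nat.rec 0 (fun j ih => cond (f j) (Nat.succ ih) ih) d

/-- A number for the edge of the `d`-cube at `v` in direction `j`; both ends give the same one. -/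
def edgeIndex (d v j : ℕ) : ℕ := Nat.add (Nat.mul j (Nat.pow 2 d)) (Nat.land v (flipBit v j))

/-- A family of sets of edges is stored as the list of its columns: digit `i` of the column of an
edge tells whether member `i` of the family contains that edge. -/
def column (d : ℕ) (cols : List ℕ) (v j : ℕ) : ℕ := cols.getD (edgeIndex d v j) 0

/-- Member `i` of a family of edge sets, as a number with one binary digit per edge. -/
def edgesOf (cols : List ℕ) (i : ℕ) : ℕ :=
  List.rec 0 (fun c _ ih => Nat.add (Nat.land (Nat.shiftRight c i) 1) (Nat.mul 2 ih)) cols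

/-- Checks that the edge set `em` consists of disjoint paths through the vertices outside `vis`:
one from `v` (which is in `vis`) to `t`, and one from `e.1` to `e.2` for each `e` in `rest`. -/
def walkCheck (d : ℕ) (fuel : ℕ) : ℕ → ℕ → List (ℕ × ℕ) → ℕ → ℕ → Bool :=
  Nat.rec (motive := fun _ => ℕ → ℕ → List (ℕ × ℕ) → ℕ → ℕ → Bool)
    (fun _ _ _ _ _ => false)
    (fun _ ih v t rest vis em =>
      cond (Nat.beq v t)
        (List.rec (and (Nat.beq em 0) (Nat.beq vis (Nat.sub (Nat.pow 2 (Nat.pow 2 d)) 1)))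
          (fun e rest' _ => and (not (hasBit vis e.1)) (ih e.1 e.2 rest' (setBit vis e.1) em)) rest)
        (anyBelow d fun j =>
          and (and (hasBit em (edgeIndex d v j)) (not (hasBit vis (flipBit v j))))
            (ih (flipBit v j) t rest (setBit vis (flipBit v j))
              (Nat.xor em (Nat.shiftLeft 1 (edgeIndex d v j)))))) fuel

/-- Checks that every member of the family whose number is a digit of `m` is a system of disjoint
paths through all vertices of the `d`-cube, from `a` to `b` and from `e.1` to `e.2` for each `e` in
`rest`; the family has `F` members. -/
def validMembers (d : ℕ) (cols : List ℕ) (F a b : ℕ) (rest : List (ℕ × ℕ)) (m : ℕ) : Bool :=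
  and (Nat.blt m (Nat.pow 2 F))
    (allBelow F fun i => or (not (hasBit m i))
      (walkCheck d (Nat.pow 2 d) a b rest (Nat.shiftLeft 1 a) (edgesOf cols i)))

/-- Runs through the maximal matchings of the `d`-cube which avoid a set `W` of vertices, treating
the vertices below `k` in descending order. Here `cov` holds `W` and the vertices covered so far,
`left` those left uncovered, and `S` the members of the family that contain all edges chosen so
far. At the end of every branch `leaf left S` has to hold. -/
def runMatchings (C : ℕ → ℕ → ℕ) (d : ℕ) (leaf : ℕ → ℕ → Bool) (k : ℕ) : ℕ → ℕ → ℕ → Bool :=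
  Nat.rec (motive := fun _ => ℕ → ℕ → ℕ → Bool) (fun _ left S => leaf left S)
    (fun v ih cov left S =>
      cond (hasBit cov v) (ih cov left S)
        (and (or (anyBelow d fun j => hasBit left (flipBit v j)) (ih cov (setBit left v) S))
          (allBelow d fun j =>
            or (or (not (hasBit v j)) (hasBit cov (flipBit v j)))
              (ih (setBit (setBit cov v) (flipBit v j)) left (Nat.land S (C v j)))))) k

/-! ### Correctness of the search -/

theorem hasBit_eq (m i : ℕ) : hasBit m i = m.testBit i := by
  have h : Nat.land (Nat.shiftRight m i) 1 = (m >>> i) &&& 1 := rfl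
  rw [hasBit, h, Nat.testBit, Nat.and_comm]
  rcases Nat.mod_two_eq_zero_or_one (m >>> i) with h | h
  · simp [h]
    rfl
  · simp [h]

theorem flipBit_eq (v j : ℕ) : flipBit v j = v ^^^ 2 ^ j := by
  rw [← Nat.one_shiftLeft]; rfl

theorem testBit_flipBit (v j i : ℕ) : (flipBit v j).testBit i = (v.testBit i ^^ decide (j = i)) := by
  rw [flipBit_eq, Nat.testBit_xor, Nat.testBit_two_pow]

theorem testBit_setBit (m i k : ℕ) : (setBit m i).testBit k = (m.testBit k || decide (i = k)) := by
  have : setBit m i = m ||| 2 ^ i := by rw [← Nat.one_shiftLeft]; rfl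
  rw [this, Nat.testBit_or, Nat.testBit_two_pow]

@[simp] theorem flipBit_flipBit (v j : ℕ) : flipBit (flipBit v j) j = v := by
  simp [flipBit_eq]

theorem flipBit_lt {d v j : ℕ} (hv : v < 2 ^ d) (hj : j < d) : flipBit v j < 2 ^ d := by
  rw [flipBit_eq]
  exact Nat.xor_lt_two_pow hv (Nat.pow_lt_pow_right (by norm_num) hj)

theorem meets_iff {a b : ℕ} : meets a b = true ↔ ∃ i, a.testBit i ∧ b.testBit i := by
  have h : meets a b = true ↔ a &&& b ≠ 0 := by
    have : meets a b = !(Nat.beq (a &&& b) 0) := rfl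
    rw [this, Bool.not_eq_true', ← Bool.not_eq_true, Nat.beq_eq]
  rw [h]
  constructor
  · intro h
    by_contra! hc
    refine h (Nat.eq_of_testBit_eq fun i => ?_)
    rw [Nat.testBit_and, Nat.zero_testBit]
    have := hc i
    simpa using this
  · rintro ⟨i, h₁, h₂⟩ h0
    have := congrArg (fun x => x.testBit i) h0
    simp [h₁, h₂] at this

theorem anyBelow_iff {d : ℕ} {f : ℕ → Bool} : anyBelow d f = true ↔ ∃ j < d, f j = true := by
  induction d with
  | zero => simp [anyBelow]
  | succ d ih =>
    have : anyBelow (d + 1) f = (f d || anyBelow d f) := rfl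
    rw [this, Bool.or_eq_true, ih]
    constructor
    · rintro (h | ⟨j, hj, h⟩)
      · exact ⟨d, by omega, h⟩
      · exact ⟨j, by omega, h⟩
    · rintro ⟨j, hj, h⟩
      rcases Nat.lt_succ_iff_lt_or_eq.1 hj with hj | rfl
      · exact .inr ⟨j, hj, h⟩
      · exact .inl h

theorem allBelow_iff {d : ℕ} {f : ℕ → Bool} : allBelow d f = true ↔ ∀ j < d, f j = true := by
  induction d with
  | zero => simp [allBelow]
  | succ d ih =>
    have : allBelow (d + 1) f = (f d && allBelow d f) := rfl
    rw [this, Bool.and_eq_true, ih]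
    constructor
    · rintro ⟨h, h'⟩ j hj
      rcases Nat.lt_succ_iff_lt_or_eq.1 hj with hj | rfl
      · exact h' j hj
      · exact h
    · exact fun h => ⟨h d (by omega), fun j hj => h j (by omega)⟩

theorem countBelow_eq (d : ℕ) (f : ℕ → Bool) :
    countBelow d f = ((Finset.range d).filter fun j => f j = true).card := by
  induction d with
  | zero => rfl
  | succ d ih =>
    have : countBelow (d + 1) f = cond (f d) (countBelow d f + 1) (countBelow d f) := rfl
    rw [this, Finset.range_add_one, Finset.filter_insert, ih]
    cases h : f d
    · simp
    · rw [if_pos rfl, Finset.card_insert_of_notMem (by simp)]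
      rfl

theorem edgeIndex_flipBit (d v j : ℕ) : edgeIndex d (flipBit v j) j = edgeIndex d v j := by
  have : Nat.land (flipBit v j) v = Nat.land v (flipBit v j) := Nat.and_comm _ _
  rw [edgeIndex, edgeIndex, flipBit_flipBit, this]

theorem edgeIndex_eq_iff {d v j x k : ℕ} (hv : v < 2 ^ d) (hx : x < 2 ^ d)
    (h : edgeIndex d x k = edgeIndex d v j) : k = j ∧ (x = v ∨ x = flipBit v j) := by
  have e : ∀ y i, edgeIndex d y i = i * 2 ^ d + (y &&& flipBit y i) := fun _ _ => rfl
  rw [e, e] at h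
  have h₁ : x &&& flipBit x k < 2 ^ d := lt_of_le_of_lt Nat.and_le_left hx
  have h₂ : v &&& flipBit v j < 2 ^ d := lt_of_le_of_lt Nat.and_le_left hv
  have hp : 0 < 2 ^ d := by positivity
  have hk : k = j := by
    have := congrArg (· / 2 ^ d) h
    simpa [Nat.add_comm (_ * 2 ^ d), Nat.add_mul_div_right _ _ hp, Nat.div_eq_of_lt h₁,
      Nat.div_eq_of_lt h₂] using this
  subst hk
  refine ⟨rfl, ?_⟩
  have hxv : x &&& flipBit x k = v &&& flipBit v k := by omega
  have hb : ∀ i, k ≠ i → x.testBit i = v.testBit i := by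
    intro i hi
    have := congrArg (fun y => y.testBit i) hxv
    simpa [testBit_flipBit, hi] using this
  by_cases hc : x.testBit k = v.testBit k
  · left
    refine Nat.eq_of_testBit_eq fun i => ?_
    rcases eq_or_ne k i with rfl | hi
    · exact hc
    · exact hb i hi
  · right
    refine Nat.eq_of_testBit_eq fun i => ?_
    rw [testBit_flipBit]
    rcases eq_or_ne k i with rfl | hi
    · revert hc
      cases x.testBit k <;> cases v.testBit k <;> simp
    · simp [hi, hb i hi]

theorem column_flipBit (d : ℕ) (cols : List ℕ) (v j : ℕ) :
    column d cols (flipBit v j) j = column d cols v j := by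
  rw [column, column, edgeIndex_flipBit]

theorem testBit_edgesOf (cols : List ℕ) (i e : ℕ) :
    (edgesOf cols i).testBit e = (cols.getD e 0).testBit i := by
  induction cols generalizing e with
  | nil => simp [edgesOf]
  | cons c cols ih =>
    have h : edgesOf (c :: cols) i = ((c >>> i) &&& 1) + 2 * edgesOf cols i := rfl
    have hc : ((c >>> i) &&& 1) = (c.testBit i).toNat := by
      rw [Nat.testBit_eq_decide_div_mod_eq, Nat.and_one_is_mod, Nat.shiftRight_eq_div_pow]
      rcases Nat.mod_two_eq_zero_or_one (c / 2 ^ i) with h | h <;> simp [h]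
    rw [h, hc]
    cases e with
    | zero =>
      rw [Nat.testBit_zero]
      cases h : c.testBit i <;> simp [h]
    | succ e =>
      rw [Nat.testBit_add_one]
      have : ((c.testBit i).toNat + 2 * edgesOf cols i) / 2 = edgesOf cols i := by
        cases c.testBit i
        · simp
        · simp
          omega
      rw [this, ih]
      rfl

/-- `ps` is a system of vertex-disjoint paths through all vertices of the `d`-cube, the ends of the
paths being listed in `ends`. -/
structure IsPathSystem (d : ℕ) (ends : List (ℕ × ℕ)) (ps : List (List ℕ)) : Prop where
  ends : List.Forall₂ (fun e p => p.head? = some e.1 ∧ p.getLast? = some e.2) ends ps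
  chain : ∀ p ∈ ps, p.IsChain fun v w => ∃ j < d, w = flipBit v j
  nodup : ps.flatten.Nodup
  mem : ∀ v, v ∈ ps.flatten ↔ v < 2 ^ d

/-- Some spanning path system of the `d`-cube with the given ends contains every edge in `E`,
where `E v j` refers to the edge at `v` in direction `j`. -/
def Linkable (d : ℕ) (ends : List (ℕ × ℕ)) (E : ℕ → ℕ → Prop) : Prop :=
  ∃ ps, IsPathSystem d ends ps ∧
    ∀ v < 2 ^ d, ∀ j < d, E v j → ∃ p ∈ ps, Consecutive p v (flipBit v j)

theorem Linkable.mono {d : ℕ} {ends : List (ℕ × ℕ)} {E E' : ℕ → ℕ → Prop}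
    (h : Linkable d ends E) (hE : ∀ v < 2 ^ d, ∀ j < d, E' v j → E v j) : Linkable d ends E' := by
  obtain ⟨ps, hps, h⟩ := h
  exact ⟨ps, hps, fun v hv j hj hvj => h v hv j hj (hE v hv j hj hvj)⟩

/-- A successful check yields a path `p` from `v` to `t` and paths `ps` with the ends in `rest`. They
are disjoint, visit exactly `v` and the vertices outside `vis`, and contain all edges in `em`. -/
theorem walkCheck_sound {d fuel v t : ℕ} {rest : List (ℕ × ℕ)} {vis em : ℕ}
    (h : walkCheck d fuel v t rest vis em = true) (hvis : vis.testBit v = true) :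
    ∃ p ps, p.head? = some v ∧
      List.Forall₂ (fun e p => p.head? = some e.1 ∧ p.getLast? = some e.2) ((v, t) :: rest)
        (p :: ps) ∧
      (∀ q ∈ p :: ps, q.IsChain fun v w => ∃ j < d, w = flipBit v j) ∧
      (p :: ps).flatten.Nodup ∧
      (∀ x ∈ (p :: ps).flatten, x = v ∨ vis.testBit x = false) ∧
      (∀ x, x < 2 ^ d ↔ vis.testBit x = true ∨ x ∈ (p :: ps).flatten) ∧
      ∀ x < 2 ^ d, ∀ j < d, em.testBit (edgeIndex d x j) = true →
        ∃ q ∈ p :: ps, Consecutive q x (flipBit x j) := by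
  induction fuel generalizing v t rest vis em with
  | zero => exact absurd h Bool.false_ne_true
  | succ fuel ih =>
    by_cases hvt : v = t
    · subst hvt
      cases rest with
      | nil =>
        have h' : (cond (Nat.beq v v) (and (Nat.beq em 0) (Nat.beq vis (2 ^ 2 ^ d - 1)))
          (anyBelow d fun j =>
            and (and (hasBit em (edgeIndex d v j)) (not (hasBit vis (flipBit v j))))
              (walkCheck d fuel (flipBit v j) v [] (setBit vis (flipBit v j))
                (Nat.xor em (Nat.shiftLeft 1 (edgeIndex d v j)))))) = true := h
        rw [Nat.beq_refl, cond_true, Bool.and_eq_true, Nat.beq_eq, Nat.beq_eq] at h'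
        obtain ⟨rfl, rfl⟩ := h'
        refine ⟨[v], [], by simp, by simp, by simp, by simp, by simp, fun x => ?_, by simp⟩
        rw [Nat.testBit_two_pow_sub_one, decide_eq_true_eq] at hvis ⊢
        simp only [List.flatten_cons, List.flatten_nil, List.append_nil, List.mem_singleton]
        constructor
        · exact .inl
        · rintro (h | rfl)
          · exact h
          · exact hvis
      | cons e rest =>
        have h' : (cond (Nat.beq v v) (and (not (hasBit vis e.1))
          (walkCheck d fuel e.1 e.2 rest (setBit vis e.1) em)) (anyBelow d fun j =>
            and (and (hasBit em (edgeIndex d v j)) (not (hasBit vis (flipBit v j))))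
              (walkCheck d fuel (flipBit v j) v (e :: rest) (setBit vis (flipBit v j))
                (Nat.xor em (Nat.shiftLeft 1 (edgeIndex d v j)))))) = true := h
        rw [Nat.beq_refl, cond_true, Bool.and_eq_true, Bool.not_eq_true', hasBit_eq] at h'
        obtain ⟨hs, h'⟩ := h'
        obtain ⟨p, ps, -, h₂, h₃, h₄, h₅, h₆, h₇⟩ := ih h' (by simp [testBit_setBit])
        have hnew : ∀ x ∈ (p :: ps).flatten, vis.testBit x = false := by
          intro x hx
          rcases h₅ x hx with rfl | h
          · exact hs
          · rw [testBit_setBit, Bool.or_eq_false_iff] at h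
            exact h.1
        refine ⟨[v], p :: ps, rfl, .cons (by simp) h₂, ?_, ?_, ?_, fun x => ?_, ?_⟩
        · intro q hq
          rcases List.mem_cons.1 hq with rfl | hq
          · simp
          · exact h₃ q hq
        · rw [List.flatten_cons, List.singleton_append, List.nodup_cons]
          exact ⟨fun hv => by simp [hnew v hv] at hvis, h₄⟩
        · intro x hx
          rw [List.flatten_cons, List.singleton_append, List.mem_cons] at hx
          exact hx.imp_right (hnew x)
        · rw [h₆, testBit_setBit, List.flatten_cons (l := [v]), List.singleton_append,
            List.mem_cons, Bool.or_eq_true, decide_eq_true_eq]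
          have he : e.1 ∈ (p :: ps).flatten := by
            cases h₂ with
            | cons h _ => exact List.mem_flatten.2 ⟨p, by simp, List.mem_of_head? h.1⟩
          constructor
          · rintro ((h | rfl) | h)
            · exact .inl h
            · exact .inr (.inr he)
            · exact .inr (.inr h)
          · rintro (h | rfl | h)
            · exact .inl (.inl h)
            · exact .inl (.inl hvis)
            · exact .inr h
        · intro x hx j hj hxj
          obtain ⟨q, hq, h⟩ := h₇ x hx j hj hxj
          exact ⟨q, List.mem_cons_of_mem _ hq, h⟩
    · have h' : (cond (Nat.beq v t)
        (List.rec (and (Nat.beq em 0) (Nat.beq vis (Nat.sub (Nat.pow 2 (Nat.pow 2 d)) 1)))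
          (fun e rest' _ => and (not (hasBit vis e.1))
            (walkCheck d fuel e.1 e.2 rest' (setBit vis e.1) em)) rest)
        (anyBelow d fun j =>
          and (and (hasBit em (edgeIndex d v j)) (not (hasBit vis (flipBit v j))))
            (walkCheck d fuel (flipBit v j) t rest (setBit vis (flipBit v j))
              (Nat.xor em (Nat.shiftLeft 1 (edgeIndex d v j)))))) = true := h
      have hbeq : Nat.beq v t = false := by
        rw [← Bool.not_eq_true, Nat.beq_eq]
        exact hvt
      rw [hbeq, cond_false, anyBelow_iff] at h'
      obtain ⟨j, hj, h'⟩ := h'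
      rw [Bool.and_eq_true, Bool.and_eq_true, Bool.not_eq_true', hasBit_eq, hasBit_eq] at h'
      obtain ⟨⟨-, hs⟩, h'⟩ := h'
      obtain ⟨p, ps, h₁, h₂, h₃, h₄, h₅, h₆, h₇⟩ := ih h' (by simp [testBit_setBit])
      have hv : v < 2 ^ d := (h₆ v).2 (.inl (by simp [testBit_setBit, hvis]))
      have hnew : ∀ x ∈ (p :: ps).flatten, vis.testBit x = false := by
        intro x hx
        rcases h₅ x hx with rfl | h
        · exact hs
        · rw [testBit_setBit, Bool.or_eq_false_iff] at h
          exact h.1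
      have hw : flipBit v j ∈ (p :: ps).flatten :=
        List.mem_flatten.2 ⟨p, by simp, List.mem_of_head? h₁⟩
      have hfl : ((v :: p) :: ps).flatten = v :: (p :: ps).flatten := by simp
      obtain ⟨p', rfl⟩ := List.head?_eq_some_iff.1 h₁
      refine ⟨v :: flipBit v j :: p', ps, rfl, ?_, ?_, ?_, ?_, fun x => ?_, ?_⟩
      · cases h₂ with
        | cons h₂ h₂' => exact .cons ⟨rfl, by simpa using h₂.2⟩ h₂'
      · intro q hq
        rcases List.mem_cons.1 hq with rfl | hq
        · rw [List.isChain_cons_cons]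
          exact ⟨⟨j, hj, rfl⟩, h₃ _ (by simp)⟩
        · exact h₃ q (List.mem_cons_of_mem _ hq)
      · rw [hfl, List.nodup_cons]
        exact ⟨fun hv => by simp [hnew v hv] at hvis, h₄⟩
      · intro x hx
        rw [hfl, List.mem_cons] at hx
        exact hx.imp_right (hnew x)
      · rw [h₆, testBit_setBit, hfl, List.mem_cons, Bool.or_eq_true, decide_eq_true_eq]
        constructor
        · rintro ((h | rfl) | h)
          · exact .inl h
          · exact .inr (.inr hw)
          · exact .inr (.inr h)
        · rintro (h | rfl | h)
          · exact .inl (.inl h)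
          · exact .inl (.inl hvis)
          · exact .inr h
      · intro x hx k hk hxk
        by_cases he : edgeIndex d x k = edgeIndex d v j
        · obtain ⟨rfl, hxv⟩ := edgeIndex_eq_iff hv hx he
          refine ⟨_, List.mem_cons_self, ?_⟩
          rcases hxv with rfl | rfl
          · exact .inl ⟨[], p', by simp⟩
          · exact .inr ⟨[], p', by simp⟩
        · have hem : (Nat.xor em (Nat.shiftLeft 1 (edgeIndex d v j))).testBit (edgeIndex d x k) =
              true := by
            have : (flipBit em (edgeIndex d v j)).testBit (edgeIndex d x k) = true := by
              rw [testBit_flipBit, hxk, decide_eq_false (Ne.symm he)]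
              rfl
            exact this
          obtain ⟨q, hq, h⟩ := h₇ x hx k hk hem
          rcases List.mem_cons.1 hq with rfl | hq
          · exact ⟨_, List.mem_cons_self, h.mono (List.suffix_cons _ _).isInfix⟩
          · exact ⟨q, List.mem_cons_of_mem _ hq, h⟩

/-- Every member that passes the check links its ends and contains its edges. -/
theorem validMembers_sound {d : ℕ} {cols : List ℕ} {F a b : ℕ} {rest : List (ℕ × ℕ)} {m : ℕ}
    (h : validMembers d cols F a b rest m = true) {i : ℕ} (hi : m.testBit i = true) :
    Linkable d ((a, b) :: rest) fun v j => (column d cols v j).testBit i = true := by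
  rw [validMembers, Bool.and_eq_true, allBelow_iff] at h
  have hm : m < 2 ^ F := by
    have := h.1
    rwa [Nat.blt, Nat.ble_eq] at this
  have hiF : i < F := by
    by_contra hc
    have : m.testBit i = false :=
      Nat.testBit_lt_two_pow (lt_of_lt_of_le hm (Nat.pow_le_pow_right (by norm_num) (by omega)))
    simp [this] at hi
  have hw := h.2 i hiF
  rw [hasBit_eq, hi, Bool.not_true, Bool.false_or] at hw
  have ha : (Nat.shiftLeft 1 a) = 2 ^ a := Nat.one_shiftLeft a
  rw [ha] at hw
  obtain ⟨p, ps, h₁, h₂, h₃, h₄, h₅, h₆, h₇⟩ := walkCheck_sound hw (by simp)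
  refine ⟨p :: ps, ⟨h₂, h₃, h₄, fun x => ?_⟩, fun v hv j hj hvj => h₇ v hv j hj ?_⟩
  · rw [h₆, Nat.testBit_two_pow, decide_eq_true_eq]
    refine ⟨.inr, ?_⟩
    rintro (rfl | h)
    · exact List.mem_flatten.2 ⟨p, by simp, List.mem_of_head? h₁⟩
    · exact h
  · rw [testBit_edgesOf]
    exact hvj

/-- `A` describes a maximal matching among the matchings of the `d`-cube which avoid the vertices
in the set `W` of binary digits: `A v j` says that the edge at `v` in direction `j` belongs to it. -/
structure IsCodeMatching (d W : ℕ) (A : ℕ → ℕ → Prop) : Prop where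
  flip : ∀ v < 2 ^ d, ∀ j < d, A v j → A (flipBit v j) j
  unique : ∀ v < 2 ^ d, ∀ j < d, ∀ k < d, A v j → A v k → j = k
  avoids : ∀ v < 2 ^ d, ∀ j < d, A v j → W.testBit v = false
  maximal : ∀ v < 2 ^ d, ∀ j < d, W.testBit v = false → W.testBit (flipBit v j) = false →
    (∃ k < d, A v k) ∨ ∃ k < d, A (flipBit v j) k

/-- A neighbour with a smaller code lacks a digit. Hence `runMatchings` at `k` may restrict itself to
the directions in the digits of `k`. -/
theorem testBit_of_flipBit_le {k j : ℕ} (h : flipBit k j ≤ k) : k.testBit j = true := by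
  by_contra hk
  rw [Bool.not_eq_true] at hk
  refine absurd (Nat.lt_of_testBit j hk (by simp [testBit_flipBit, hk]) fun i hi => ?_)
    (not_lt.2 h)
  rw [testBit_flipBit, decide_eq_false (by omega), Bool.xor_false]

namespace IsCodeMatching

variable {d W : ℕ} {A : ℕ → ℕ → Prop}

/-- The search reaches every maximal matching avoiding `W`: if it succeeds, then the check at the
leaf holds for the set of uncovered vertices and for a set of family members containing `A`. -/
theorem exists_leaf (hA : IsCodeMatching d W A) {C : ℕ → ℕ → ℕ}
    (hC : ∀ v < 2 ^ d, ∀ j < d, C (flipBit v j) j = C v j) {leaf : ℕ → ℕ → Bool} {S₀ : ℕ}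
    (h : runMatchings C d leaf (2 ^ d) W 0 S₀ = true) :
    ∃ left S, leaf left S = true ∧
      (∀ v < 2 ^ d, left.testBit v = true ↔ W.testBit v = false ∧ ∀ j < d, ¬ A v j) ∧
      ∀ i, S.testBit i = true → ∀ v < 2 ^ d, ∀ j < d, A v j → (C v j).testBit i = true := by
  suffices H : ∀ k ≤ 2 ^ d, ∀ cov left S, runMatchings C d leaf k cov left S = true →
      (∀ v < 2 ^ d, cov.testBit v = true ↔
        W.testBit v = true ∨ ∃ j < d, A v j ∧ (k ≤ v ∨ k ≤ flipBit v j)) →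
      (∀ v < 2 ^ d, left.testBit v = true ↔
        k ≤ v ∧ W.testBit v = false ∧ ∀ j < d, ¬ A v j) →
      (∀ i, S.testBit i = true → ∀ v < 2 ^ d, ∀ j < d, A v j → k ≤ v ∨ k ≤ flipBit v j →
        (C v j).testBit i = true) →
      ∃ left S, leaf left S = true ∧
        (∀ v < 2 ^ d, left.testBit v = true ↔ W.testBit v = false ∧ ∀ j < d, ¬ A v j) ∧
        ∀ i, S.testBit i = true → ∀ v < 2 ^ d, ∀ j < d, A v j → (C v j).testBit i = true by
    refine H _ le_rfl W 0 S₀ h (fun v hv => ?_) (fun v hv => ?_) fun i _ v hv j hj _ hk => ?_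
    · refine ⟨.inl, ?_⟩
      rintro (h | ⟨j, hj, -, h⟩)
      · exact h
      · have := flipBit_lt hv hj
        omega
    · simp only [Nat.zero_testBit, Bool.false_eq_true, false_iff]
      omega
    · have := flipBit_lt hv hj
      omega
  intro k
  induction k with
  | zero =>
    intro _ cov left S h _ h₂ h₃
    refine ⟨left, S, h, fun v hv => ?_, fun i hi v hv j hj hvj => ?_⟩
    · simpa using h₂ v hv
    · exact h₃ i hi v hv j hj hvj (.inl (Nat.zero_le _))
  | succ k ih =>
    intro hk cov left S h h₁ h₂ h₃
    have hkd : k < 2 ^ d := hk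
    have h' : (cond (hasBit cov k) (runMatchings C d leaf k cov left S)
        (and (or (anyBelow d fun j => hasBit left (flipBit k j))
            (runMatchings C d leaf k cov (setBit left k) S))
          (allBelow d fun j =>
            or (or (not (hasBit k j)) (hasBit cov (flipBit k j)))
              (runMatchings C d leaf k (setBit (setBit cov k) (flipBit k j)) left
                (Nat.land S (C k j)))))) = true := h
    cases hc : hasBit cov k with
    | true =>
      rw [hc, cond_true] at h'
      rw [hasBit_eq] at hc
      have hck := (h₁ k hkd).1 hc
      -- An edge at `k` was chosen before `k` is reached, so nothing changes.
      have hP : ∀ v < 2 ^ d, ∀ j < d, A v j → (k ≤ v ∨ k ≤ flipBit v j) →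
          (k + 1 ≤ v ∨ k + 1 ≤ flipBit v j) := by
        have hkk : ∀ j < d, A k j → k + 1 ≤ flipBit k j := by
          intro j hj hkj
          rcases hck with h | ⟨i, hi, hki, h⟩
          · rw [hA.avoids k hkd j hj hkj] at h
            exact absurd h Bool.false_ne_true
          · rw [hA.unique k hkd j hj i hi hkj hki]
            omega
        intro v hv j hj hvj h
        by_cases hvk : v = k
        · subst hvk
          exact .inr (hkk j hj hvj)
        · by_cases hwk : flipBit v j = k
          · have := hkk j hj (hwk ▸ hA.flip v hv j hj hvj)
            rw [← hwk, flipBit_flipBit] at this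
            exact .inl (by omega)
          · omega
      refine ih (by omega) cov left S h' (fun v hv => ?_) (fun v hv => ?_)
        fun i hi v hv j hj hvj hkv => h₃ i hi v hv j hj hvj (hP v hv j hj hvj hkv)
      · rw [h₁ v hv]
        refine or_congr_right ⟨?_, ?_⟩
        · rintro ⟨j, hj, hvj, h⟩
          exact ⟨j, hj, hvj, by omega⟩
        · rintro ⟨j, hj, hvj, h⟩
          exact ⟨j, hj, hvj, hP v hv j hj hvj h⟩
      · rw [h₂ v hv]
        refine ⟨fun h => ⟨by omega, h.2⟩, fun h => ⟨?_, h.2⟩⟩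
        by_contra hlt
        obtain rfl : v = k := by omega
        rcases hck with hW | ⟨j, hj, hvj, -⟩
        · simp [h.2.1] at hW
        · exact h.2.2 j hj hvj
    | false =>
      rw [hc, cond_false, Bool.and_eq_true, Bool.or_eq_true, anyBelow_iff, allBelow_iff] at h'
      rw [hasBit_eq] at hc
      have hck : ¬ (W.testBit k = true ∨ ∃ j < d, A k j ∧ (k + 1 ≤ k ∨ k + 1 ≤ flipBit k j)) := by
        rw [← h₁ k hkd, hc]
        exact Bool.false_ne_true
      rw [not_or, Bool.not_eq_true] at hck
      by_cases hm : ∃ j < d, A k j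
      · obtain ⟨j, hj, hkj⟩ := hm
        have hwk : flipBit k j ≤ k := by
          by_contra hlt
          exact hck.2 ⟨j, hj, hkj, .inr (by omega)⟩
        have hw : flipBit k j < 2 ^ d := flipBit_lt hkd hj
        have hwj : A (flipBit k j) j := hA.flip k hkd j hj hkj
        have hcw : cov.testBit (flipBit k j) = false := by
          rw [← Bool.not_eq_true, h₁ _ hw]
          rintro (h | ⟨i, hi, hwi, h⟩)
          · rw [hA.avoids _ hw j hj hwj] at h
            exact Bool.false_ne_true h
          · rw [hA.unique _ hw i hi j hj hwi hwj, flipBit_flipBit] at h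
            omega
        have h'' := h'.2 j hj
        rw [hasBit_eq, hasBit_eq, testBit_of_flipBit_le hwk, hcw, Bool.not_true, Bool.false_or,
          Bool.false_or] at h''
        -- An edge with one end equal to `k` is the edge in direction `j`.
        have hedge : ∀ v < 2 ^ d, ∀ i < d, A v i → flipBit v i = k → i = j ∧ v = flipBit k j := by
          intro v hv i hi hvi h
          have hki : A k i := h ▸ hA.flip v hv i hi hvi
          obtain rfl := hA.unique k hkd i hi j hj hki hkj
          exact ⟨rfl, by rw [← h, flipBit_flipBit]⟩
        refine ih (by omega) _ _ _ h'' (fun v hv => ?_) (fun v hv => ?_)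
          fun i hi v hv l hl hvl hkv => ?_
        · rw [testBit_setBit, testBit_setBit, Bool.or_eq_true, Bool.or_eq_true, decide_eq_true_eq,
            decide_eq_true_eq, h₁ v hv]
          constructor
          · rintro (((h | ⟨i, hi, hvi, h⟩) | rfl) | rfl)
            · exact .inl h
            · exact .inr ⟨i, hi, hvi, by omega⟩
            · exact .inr ⟨j, hj, hkj, .inl le_rfl⟩
            · exact .inr ⟨j, hj, hwj, .inr (by rw [flipBit_flipBit])⟩
          · rintro (h | ⟨i, hi, hvi, h⟩)
            · exact .inl (.inl (.inl h))
            · by_cases hvk : k = v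
              · exact .inl (.inr hvk)
              · by_cases hik : flipBit v i = k
                · exact .inr (hedge v hv i hi hvi hik).2.symm
                · exact .inl (.inl (.inr ⟨i, hi, hvi, by omega⟩))
        · rw [h₂ v hv]
          refine ⟨fun h => ⟨by omega, h.2⟩, fun h => ⟨?_, h.2⟩⟩
          by_contra hlt
          obtain rfl : v = k := by omega
          exact h.2.2 j hj hkj
        · have hi' : (S &&& C k j).testBit i = true := hi
          rw [Nat.testBit_and, Bool.and_eq_true] at hi'
          by_cases hvk : v = k
          · subst hvk
            rw [hA.unique v hkd l hl j hj hvl hkj]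
            exact hi'.2
          · by_cases hlk : flipBit v l = k
            · obtain ⟨rfl, rfl⟩ := hedge v hv l hl hvl hlk
              rw [hC k hkd l hl]
              exact hi'.2
            · exact h₃ i hi'.1 v hv l hl hvl (by omega)
      · push Not at hm
        have hP : ∀ v < 2 ^ d, ∀ j < d, A v j → (k ≤ v ∨ k ≤ flipBit v j) →
            (k + 1 ≤ v ∨ k + 1 ≤ flipBit v j) := by
          intro v hv j hj hvj h
          have h₁ : v ≠ k := by
            rintro rfl
            exact hm j hj hvj
          have h₂ : flipBit v j ≠ k := fun h => hm j hj (h ▸ hA.flip v hv j hj hvj)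
          omega
        rcases h'.1 with ⟨j, hj, h⟩ | h
        · exfalso
          rw [hasBit_eq, h₂ _ (flipBit_lt hkd hj)] at h
          rcases hA.maximal k hkd j hj hck.1 h.2.1 with ⟨i, hi, hki⟩ | ⟨i, hi, hwi⟩
          · exact hm i hi hki
          · exact h.2.2 i hi hwi
        · refine ih (by omega) _ _ _ h (fun v hv => ?_) (fun v hv => ?_)
            fun i hi v hv j hj hvj hkv => h₃ i hi v hv j hj hvj (hP v hv j hj hvj hkv)
          · rw [h₁ v hv]
            refine or_congr_right ⟨?_, ?_⟩
            · rintro ⟨j, hj, hvj, h⟩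
              exact ⟨j, hj, hvj, by omega⟩
            · rintro ⟨j, hj, hvj, h⟩
              exact ⟨j, hj, hvj, hP v hv j hj hvj h⟩
          · rw [testBit_setBit, Bool.or_eq_true, decide_eq_true_eq, h₂ v hv]
            constructor
            · rintro (h | rfl)
              · exact ⟨by omega, h.2⟩
              · exact ⟨le_rfl, hck.1, hm⟩
            · rintro ⟨h, h'⟩
              by_cases hkv : k = v
              · exact .inr hkv
              · exact .inl ⟨by omega, h'⟩

end IsCodeMatching

/-! ### Joining path systems of the two halves -/

/-- A set of possible ports through which a cycle may pass between the two halves of the 5-cube,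
with the members of a path family that use exactly these ports. For `pair a b m` the members in `m`
are Hamilton paths from `a` to `b`. For `quad strong a b c e m₁ m₂ m₃` the members in `m₁`, `m₂`,
`m₃` consist of two paths, which link `a` with `b`, with `c` and with `e`, respectively.

Two path systems with four ports, one in each half, close up to a single cycle when they link the
ports differently. Hence it is enough if one half offers two ways of linking the ports and the other
half one way; `strong` tells that the back half, which holds no additional edge, offers two. -/
inductive PortGroup
  | pair (a b m : ℕ)
  | quad (strong : Bool) (a b c e m₁ m₂ m₃ : ℕ)

/-- At least two of three conditions hold. -/
def majority (x y z : Bool) : Bool := or (and x y) (and z (or x y))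

def anyGroup (f : PortGroup → Bool) (gs : List PortGroup) : Bool :=
  List.rec false (fun g _ ih => or (f g) ih) gs

def allGroup (f : PortGroup → Bool) (gs : List PortGroup) : Bool :=
  List.rec true (fun g _ ih => and (f g) ih) gs

namespace PortGroup

/-- The members in `S` link the ports in the way required of the back half. -/
def back (S : ℕ) : PortGroup → Bool
  | pair _ _ m => meets S m
  | quad strong _ _ _ _ m₁ m₂ m₃ =>
    cond strong (majority (meets S m₁) (meets S m₂) (meets S m₃))
      (or (meets S m₁) (or (meets S m₂) (meets S m₃)))

/-- The members in `S` link the ports in the way required of the front half. -/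
def front (S : ℕ) : PortGroup → Bool
  | pair _ _ m => meets S m
  | quad strong _ _ _ _ m₁ m₂ m₃ =>
    cond strong (or (meets S m₁) (or (meets S m₂) (meets S m₃)))
      (majority (meets S m₁) (meets S m₂) (meets S m₃))

def isPort (v : ℕ) : PortGroup → Bool
  | pair a b _ => or (Nat.beq v a) (Nat.beq v b)
  | quad _ a b c e _ _ _ => or (or (Nat.beq v a) (Nat.beq v b)) (or (Nat.beq v c) (Nat.beq v e))

/-- The members which on their own satisfy `front`. -/
def strongMembers : PortGroup → ℕ
  | pair _ _ m => m
  | quad strong _ _ _ _ m₁ m₂ m₃ => cond strong (Nat.lor m₁ (Nat.lor m₂ m₃)) 0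

def weakFront (S : ℕ) : PortGroup → Bool
  | pair _ _ _ => false
  | quad strong _ _ _ _ m₁ m₂ m₃ =>
    cond strong false (majority (meets S m₁) (meets S m₂) (meets S m₃))

/-- The members of the group are as described, and all vertices in `W` are ports. -/
def valid (d W : ℕ) (cols : List ℕ) (F : ℕ) (g : PortGroup) : Bool :=
  and (allBelow (Nat.pow 2 d) fun v => or (not (hasBit W v)) (g.isPort v))
    (match g with
      | pair a b m => validMembers d cols F a b [] m
      | quad _ a b c e m₁ m₂ m₃ => and (validMembers d cols F a b [(c, e)] m₁)
          (and (validMembers d cols F a c [(b, e)] m₂) (validMembers d cols F a e [(b, c)] m₃)))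

end PortGroup

def allStrongMembers (gs : List PortGroup) : ℕ :=
  List.rec 0 (fun g _ ih => Nat.lor g.strongMembers ih) gs

/-- Some group of `gs` satisfies `PortGroup.front`; the groups which need a single member are
treated together. -/
def anyFront (gs : List PortGroup) (S : ℕ) : Bool :=
  or (meets S (allStrongMembers gs)) (anyGroup (fun g => g.weakFront S) gs)

/-- The check for a maximal matching `A` avoiding `W` which leaves the vertices in `left` uncovered
and is contained in the members in `S`. As a matching of the back half, `A` must satisfy
`PortGroup.back` for all groups. As a matching of the front half, at every vertex `u` there must be
three directions for an additional edge at `u`: directions of the 4-cube for which `S` has members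
that contain `A` and the edge, and possibly the direction leading to the back half. At a vertex
covered by `A` the count includes the edge of `A` itself, whence the bound 4. -/
def leafCheck (W : ℕ) (C : ℕ → ℕ → ℕ) (gs : List PortGroup) (left S : ℕ) : Bool :=
  and (allGroup (fun g => g.back S) gs)
    (allBelow 16 fun u =>
      (fun t c => or (Nat.ble t c) (and (Nat.ble t (Nat.succ c))
        (and (not (hasBit W u)) (anyGroup (fun g => and (g.isPort u) (g.front S)) gs))))
      (cond (or (hasBit left u) (hasBit W u)) 3 4)
      (countBelow 4 fun j => anyFront gs (Nat.land S (C u j))))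

/-- Path systems containing the edges `E` in one half and `E'` in the other half of a cube can be
chosen so that together with the edges between the halves at their ends they form a Hamilton cycle;
all vertices in `U` are among these ends. -/
def Closable (d : ℕ) (U : ℕ → Prop) (E E' : ℕ → ℕ → Prop) : Prop :=
  (∃ a b, (∀ v < 2 ^ d, U v → v = a ∨ v = b) ∧ Linkable d [(a, b)] E ∧ Linkable d [(a, b)] E') ∨
    ∃ a b c e, (∀ v < 2 ^ d, U v → v = a ∨ v = b ∨ v = c ∨ v = e) ∧
      Linkable d [(a, b), (c, e)] E ∧ Linkable d [(b, c), (e, a)] E'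

theorem Linkable.swap {d : ℕ} {x y : ℕ × ℕ} {E : ℕ → ℕ → Prop} (h : Linkable d [x, y] E) :
    Linkable d [y, x] E := by
  obtain ⟨ps, ⟨h₁, h₂, h₃, h₄⟩, h₅⟩ := h
  cases h₁ with
  | cons hp h₁ =>
    cases h₁ with
    | cons hq h₁ =>
      cases h₁
      rename_i p q
      refine ⟨[q, p], ⟨.cons hq (.cons hp .nil), fun r hr => h₂ r ?_, ?_, fun v => ?_⟩,
        fun v hv j hj hvj => ?_⟩
      · simpa [or_comm] using hr
      · simp only [List.flatten_cons, List.flatten_nil, List.append_nil] at h₃ ⊢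
        exact List.perm_append_comm.nodup_iff.1 h₃
      · rw [← h₄ v]
        simp [or_comm]
      · obtain ⟨r, hr, h⟩ := h₅ v hv j hj hvj
        exact ⟨r, by simpa [or_comm] using hr, h⟩

theorem Linkable.reverse {d a b : ℕ} {l : List (ℕ × ℕ)} {E : ℕ → ℕ → Prop}
    (h : Linkable d ((a, b) :: l) E) : Linkable d ((b, a) :: l) E := by
  obtain ⟨ps, ⟨h₁, h₂, h₃, h₄⟩, h₅⟩ := h
  cases h₁ with
  | cons hp h₁ =>
    rename_i p ps
    refine ⟨p.reverse :: ps, ⟨.cons ?_ h₁, fun r hr => ?_, ?_, fun v => ?_⟩,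
      fun v hv j hj hvj => ?_⟩
    · simpa using hp.symm
    · rcases List.mem_cons.1 hr with rfl | hr
      · refine List.isChain_reverse.2 ((h₂ p List.mem_cons_self).imp ?_)
        rintro v w ⟨j, hj, rfl⟩
        exact ⟨j, hj, (flipBit_flipBit v j).symm⟩
      · exact h₂ r (List.mem_cons_of_mem _ hr)
    · rw [List.flatten_cons] at h₃ ⊢
      exact ((List.reverse_perm p).append_right _).nodup_iff.2 h₃
    · rw [← h₄ v]
      simp
    · obtain ⟨r, hr, h⟩ := h₅ v hv j hj hvj
      rcases List.mem_cons.1 hr with rfl | hr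
      · exact ⟨_, List.mem_cons_self, h.reverse⟩
      · exact ⟨r, List.mem_cons_of_mem _ hr, h⟩

theorem Linkable.reverse_second {d a b : ℕ} {x : ℕ × ℕ} {E : ℕ → ℕ → Prop}
    (h : Linkable d [x, (a, b)] E) : Linkable d [x, (b, a)] E :=
  h.swap.reverse.swap

section Groups

variable {C : ℕ → ℕ → ℕ} {d W : ℕ} {E E' : ℕ → ℕ → Prop}

theorem anyGroup_iff {f : PortGroup → Bool} {gs : List PortGroup} :
    anyGroup f gs = true ↔ ∃ g ∈ gs, f g = true := by
  induction gs with
  | nil => simp [anyGroup]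
  | cons g gs ih =>
    have : anyGroup f (g :: gs) = (f g || anyGroup f gs) := rfl
    rw [this, Bool.or_eq_true, ih]
    simp

theorem allGroup_iff {f : PortGroup → Bool} {gs : List PortGroup} :
    allGroup f gs = true ↔ ∀ g ∈ gs, f g = true := by
  induction gs with
  | nil => simp [allGroup]
  | cons g gs ih =>
    have : allGroup f (g :: gs) = (f g && allGroup f gs) := rfl
    rw [this, Bool.and_eq_true, ih]
    simp

theorem majority_iff {x y z : Bool} :
    majority x y z = true ↔
      (x = true ∧ y = true) ∨ (x = true ∧ z = true) ∨ (y = true ∧ z = true) := by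
  cases x <;> cases y <;> cases z <;> simp [majority]

/-- Every member in `S` contains all edges in `E`. -/
def Carries (d : ℕ) (C : ℕ → ℕ → ℕ) (S : ℕ) (E : ℕ → ℕ → Prop) : Prop :=
  ∀ i, S.testBit i = true → ∀ v < 2 ^ d, ∀ j < d, E v j → (C v j).testBit i = true

theorem Carries.linkable {S m : ℕ} {ends : List (ℕ × ℕ)} (hS : Carries d C S E)
    (hm : ∀ i, m.testBit i = true → Linkable d ends fun v j => (C v j).testBit i = true)
    (h : meets S m = true) : Linkable d ends E := by
  obtain ⟨i, h₁, h₂⟩ := meets_iff.1 h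
  exact (hm i h₂).mono (hS i h₁)

/-- If both halves offer a way to link four ports, and one of them offers two ways, then one can
choose different ways, and these close up to one cycle. -/
theorem closable_of_linkable {U : ℕ → Prop} {a b c e : ℕ}
    (hU : ∀ v < 2 ^ d, U v → v = a ∨ v = b ∨ v = c ∨ v = e)
    (h : ((Linkable d [(a, b), (c, e)] E ∨ Linkable d [(a, c), (b, e)] E) ∧
        Linkable d [(a, e), (b, c)] E') ∨
      ((Linkable d [(a, b), (c, e)] E ∨ Linkable d [(a, e), (b, c)] E) ∧
        Linkable d [(a, c), (b, e)] E') ∨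
      ((Linkable d [(a, c), (b, e)] E ∨ Linkable d [(a, e), (b, c)] E) ∧
        Linkable d [(a, b), (c, e)] E')) : Closable d U E E' := by
  rcases h with ⟨h | h, h'⟩ | ⟨h | h, h'⟩ | ⟨h | h, h'⟩
  · exact .inr ⟨a, b, c, e, hU, h, h'.swap.reverse_second⟩
  · exact .inr ⟨a, c, b, e, fun v hv hu => by have := hU v hv hu; tauto, h,
      h'.swap.reverse.reverse_second⟩
  · exact .inr ⟨b, a, c, e, fun v hv hu => by have := hU v hv hu; tauto, h.reverse,
      h'.reverse_second⟩
  · exact .inr ⟨a, e, b, c, fun v hv hu => by have := hU v hv hu; tauto, h,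
      h'.swap.reverse.reverse_second⟩
  · exact .inr ⟨c, a, b, e, fun v hv hu => by have := hU v hv hu; tauto, h.reverse,
      h'.reverse_second⟩
  · exact .inr ⟨a, e, c, b, fun v hv hu => by have := hU v hv hu; tauto, h.reverse_second,
      h'.swap.reverse.reverse_second⟩

theorem differently_of_majority {p q r p' q' r' : Prop}
    (h : (((p ∧ q) ∨ (p ∧ r) ∨ (q ∧ r)) ∧ (p' ∨ q' ∨ r')) ∨
      ((p ∨ q ∨ r) ∧ ((p' ∧ q') ∨ (p' ∧ r') ∨ (q' ∧ r')))) :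
    ((p ∨ q) ∧ r') ∨ ((p ∨ r) ∧ q') ∨ ((q ∨ r) ∧ p') := by
  tauto

theorem closable_of_group {cols : List ℕ} {F : ℕ} {g : PortGroup}
    (hg : g.valid d W cols F = true) {S S' : ℕ} (hS : Carries d (column d cols) S E)
    (hS' : Carries d (column d cols) S' E') (hf : g.front S = true) (hb : g.back S' = true) :
    Closable d (fun v => W.testBit v = true ∨ g.isPort v = true) E E' := by
  unfold PortGroup.valid at hg
  rw [Bool.and_eq_true, allBelow_iff] at hg
  obtain ⟨hW, hg⟩ := hg
  have hp : ∀ v < 2 ^ d, W.testBit v = true ∨ g.isPort v = true → g.isPort v = true := by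
    rintro v hv (h | h)
    · have := hW v hv
      rwa [hasBit_eq, h, Bool.not_true, Bool.false_or] at this
    · exact h
  cases g with
  | pair a b m =>
    refine .inl ⟨a, b, fun v hv h => ?_, hS.linkable (fun i hi => validMembers_sound hg hi) hf,
      hS'.linkable (fun i hi => validMembers_sound hg hi) hb⟩
    have := hp v hv h
    rwa [PortGroup.isPort, Bool.or_eq_true, Nat.beq_eq, Nat.beq_eq] at this
  | quad strong a b c e m₁ m₂ m₃ =>
    simp only [Bool.and_eq_true] at hg
    obtain ⟨h₁, h₂, h₃⟩ := hg
    have L₁ := fun h => hS.linkable (fun i hi => validMembers_sound h₁ hi) h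
    have L₂ := fun h => hS.linkable (fun i hi => validMembers_sound h₂ hi) h
    have L₃ := fun h => hS.linkable (fun i hi => validMembers_sound h₃ hi) h
    have L₁' := fun h => hS'.linkable (fun i hi => validMembers_sound h₁ hi) h
    have L₂' := fun h => hS'.linkable (fun i hi => validMembers_sound h₂ hi) h
    have L₃' := fun h => hS'.linkable (fun i hi => validMembers_sound h₃ hi) h
    refine closable_of_linkable (a := a) (b := b) (c := c) (e := e) (fun v hv h => ?_) ?_
    · have := hp v hv h
      simpa only [PortGroup.isPort, Bool.or_eq_true, Nat.beq_eq, or_assoc] using this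
    · cases strong
      · simp only [PortGroup.front, PortGroup.back, cond_false, majority_iff,
          Bool.or_eq_true] at hf hb
        exact differently_of_majority
          (.inl ⟨hf.imp (.imp L₁ L₂) (.imp (.imp L₁ L₃) (.imp L₂ L₃)), hb.imp L₁' (.imp L₂' L₃')⟩)
      · simp only [PortGroup.front, PortGroup.back, cond_true, majority_iff,
          Bool.or_eq_true] at hf hb
        exact differently_of_majority
          (.inr ⟨hf.imp L₁ (.imp L₂ L₃), hb.imp (.imp L₁' L₂') (.imp (.imp L₁' L₃') (.imp L₂' L₃'))⟩)

theorem testBit_lor (a b i : ℕ) : (Nat.lor a b).testBit i = (a.testBit i || b.testBit i) :=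
  Nat.testBit_or a b i

theorem exists_front_of_anyFront {gs : List PortGroup} {S : ℕ} (h : anyFront gs S = true) :
    ∃ g ∈ gs, g.front S = true := by
  rw [anyFront, Bool.or_eq_true] at h
  rcases h with h | h
  · obtain ⟨i, hi, h⟩ := meets_iff.1 h
    induction gs with
    | nil => simp [allStrongMembers] at h
    | cons g gs ih =>
      have hl : allStrongMembers (g :: gs) = Nat.lor g.strongMembers (allStrongMembers gs) := rfl
      rw [hl, testBit_lor, Bool.or_eq_true] at h
      rcases h with h | h
      · refine ⟨g, List.mem_cons_self, ?_⟩
        cases g with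
        | pair a b m => exact meets_iff.2 ⟨i, hi, h⟩
        | quad strong a b c e m₁ m₂ m₃ =>
          cases strong
          · simp [PortGroup.strongMembers] at h
          · simp only [PortGroup.strongMembers, cond_true, testBit_lor, Bool.or_eq_true] at h
            simp only [PortGroup.front, cond_true, Bool.or_eq_true, meets_iff]
            exact h.imp (fun h => ⟨i, hi, h⟩)
              (·.imp (fun h => ⟨i, hi, h⟩) (fun h => ⟨i, hi, h⟩))
      · obtain ⟨g, hg, h⟩ := ih (meets_iff.2 ⟨i, hi, h⟩) h
        exact ⟨g, List.mem_cons_of_mem _ hg, h⟩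
  · obtain ⟨g, hg, h⟩ := anyGroup_iff.1 h
    refine ⟨g, hg, ?_⟩
    cases g with
    | pair a b m => exact absurd h Bool.false_ne_true
    | quad strong a b c e m₁ m₂ m₃ =>
      cases strong
      · exact h
      · exact absurd h Bool.false_ne_true

/-- The edges in `A` and the edge at `u` in direction `j`. -/
def withEdge (A : ℕ → ℕ → Prop) (u j : ℕ) : ℕ → ℕ → Prop :=
  fun v i => A v i ∨ (i = j ∧ (v = u ∨ v = flipBit u j))

theorem Carries.withEdge {cols : List ℕ} {S u j : ℕ} (hS : Carries d (column d cols) S E) :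
    Carries d (column d cols) (Nat.land S (column d cols u j)) (withEdge E u j) := by
  intro i hi v hv k hk h
  have hi' : (S &&& column d cols u j).testBit i = true := hi
  rw [Nat.testBit_and, Bool.and_eq_true] at hi'
  rcases h with h | ⟨rfl, rfl | rfl⟩
  · exact hS i hi'.1 v hv k hk h
  · exact hi'.2
  · rw [column_flipBit]
    exact hi'.2

theorem IsCodeMatching.exists_carries {A : ℕ → ℕ → Prop} (hA : IsCodeMatching d W A)
    {cols : List ℕ} {leaf : ℕ → ℕ → Bool} {S₀ : ℕ}
    (h : runMatchings (column d cols) d leaf (2 ^ d) W 0 S₀ = true) :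
    ∃ left S, leaf left S = true ∧
      (∀ v < 2 ^ d, left.testBit v = true ↔ W.testBit v = false ∧ ∀ j < d, ¬ A v j) ∧
      Carries d (column d cols) S A :=
  hA.exists_leaf (fun v _ j _ => column_flipBit d cols v j) h

/-- For every matching `A` of the front half and every matching `B` of the back half, both maximal
among those avoiding `W`, and every vertex `u` of the front half, three of the five directions at
`u` can be added: the resulting set of edges lies on a Hamilton cycle of the 5-cube which contains
the edges between the halves at `W`. Direction `4` leads to the back half. -/
def HasThreeDirections (W : ℕ) : Prop :=
  ∀ A B : ℕ → ℕ → Prop, IsCodeMatching 4 W A → IsCodeMatching 4 W B → ∀ u < 16,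
    ∃ J : Finset ℕ, 3 ≤ J.card ∧ ∀ j ∈ J,
      (j < 4 ∧ ¬ A u j ∧ Closable 4 (fun v => W.testBit v = true) (withEdge A u j) B) ∨
      (j = 4 ∧ W.testBit u = false ∧ Closable 4 (fun v => W.testBit v = true ∨ v = u) A B)

theorem Closable.mono {U U' : ℕ → Prop} (h : Closable d U E E') (hU : ∀ v, U' v → U v) :
    Closable d U' E E' := by
  rcases h with ⟨a, b, h, h'⟩ | ⟨a, b, c, e, h, h'⟩
  · exact .inl ⟨a, b, fun v hv hu => h v hv (hU v hu), h'⟩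
  · exact .inr ⟨a, b, c, e, fun v hv hu => h v hv (hU v hu), h'⟩

/-- Turning the count of `leafCheck` into a set of directions: at a covered vertex the edge of the
matching itself is removed. -/
theorem exists_directions {A : ℕ → ℕ → Prop} (hA : IsCodeMatching 4 W A) {u left t : ℕ}
    (hu : u < 16)
    (hleft : left.testBit u = true ↔ W.testBit u = false ∧ ∀ j < 4, ¬ A u j) {f : ℕ → Bool}
    (h : cond (or (hasBit left u) (hasBit W u)) t (t + 1) ≤ countBelow 4 f) :
    ∃ J : Finset ℕ, t ≤ J.card ∧ ∀ j ∈ J, j < 4 ∧ ¬ A u j ∧ f j = true := by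
  classical
  rw [countBelow_eq] at h
  by_cases hm : ∃ j < 4, A u j
  · obtain ⟨k, hk, huk⟩ := hm
    have hW := hA.avoids u hu k hk huk
    have hl : left.testBit u = false := by
      rw [← Bool.not_eq_true, hleft]
      exact fun h => h.2 k hk huk
    rw [hasBit_eq, hasBit_eq, hW, hl, Bool.or_false, cond_false] at h
    refine ⟨((Finset.range 4).filter fun j => f j = true).erase k, ?_, fun j hj => ?_⟩
    · have := Finset.pred_card_le_card_erase (a := k)
        (s := (Finset.range 4).filter fun j => f j = true)
      omega
    · rw [Finset.mem_erase, Finset.mem_filter, Finset.mem_range] at hj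
      exact ⟨hj.2.1, fun hc => hj.1 (hA.unique u hu j hj.2.1 k hk hc huk), hj.2.2⟩
  · push Not at hm
    have hl : or (hasBit left u) (hasBit W u) = true := by
      rw [hasBit_eq, hasBit_eq, Bool.or_eq_true, hleft]
      cases W.testBit u
      · exact .inl ⟨rfl, hm⟩
      · exact .inr rfl
    rw [hl, cond_true] at h
    refine ⟨_, h, fun j hj => ?_⟩
    rw [Finset.mem_filter, Finset.mem_range] at hj
    exact ⟨hj.1, hm j hj.1, hj.2⟩

theorem hasThreeDirections_of_check {cols : List ℕ} {gs : List PortGroup} {F S₀ : ℕ}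
    (hvalid : allGroup (PortGroup.valid 4 W cols F) gs = true)
    (hrun : runMatchings (column 4 cols) 4 (leafCheck W (column 4 cols) gs) 16 W 0 S₀ = true) :
    HasThreeDirections W := by
  intro A B hA hB u hu
  rw [allGroup_iff] at hvalid
  obtain ⟨leftA, S, hS, hleft, hSA⟩ := hA.exists_carries hrun
  obtain ⟨leftB, S', hS', -, hSB⟩ := hB.exists_carries hrun
  rw [leafCheck, Bool.and_eq_true, allGroup_iff, allBelow_iff] at hS hS'
  have hback := hS'.1
  have hcount := hS.2 u hu
  have hgood : ∀ j, anyFront gs (Nat.land S (column 4 cols u j)) = true →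
      Closable 4 (fun v => W.testBit v = true) (withEdge A u j) B := by
    intro j hj
    obtain ⟨g, hg, hf⟩ := exists_front_of_anyFront hj
    exact (closable_of_group (hvalid g hg) hSA.withEdge hSB hf (hback g hg)).mono fun _ => .inl
  simp only [Bool.or_eq_true, Bool.and_eq_true, Nat.ble_eq, Bool.not_eq_true', anyGroup_iff]
    at hcount
  rcases hcount with h | ⟨h, hW, g, hg, hgu, hgf⟩
  · obtain ⟨J, hJ, h⟩ := exists_directions (t := 3) hA hu (hleft u hu) h
    exact ⟨J, hJ, fun j hj => .inl ⟨(h j hj).1, (h j hj).2.1, hgood j (h j hj).2.2⟩⟩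
  · have h' : cond (or (hasBit leftA u) (hasBit W u)) 2 3 ≤ countBelow 4 fun j =>
        anyFront gs (Nat.land S (column 4 cols u j)) := by
      revert h
      cases or (hasBit leftA u) (hasBit W u)
      · exact Nat.succ_le_succ_iff.1
      · exact Nat.succ_le_succ_iff.1
    obtain ⟨J, hJ, h⟩ := exists_directions (t := 2) hA hu (hleft u hu) h'
    refine ⟨insert 4 J, ?_, fun j hj => ?_⟩
    · rw [Finset.card_insert_of_notMem fun h4 => absurd (h 4 h4).1 (by norm_num)]
      omega
    · rcases Finset.mem_insert.1 hj with rfl | hj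
      · refine .inr ⟨rfl, by rwa [hasBit_eq] at hW, ?_⟩
        refine (closable_of_group (hvalid g hg) hSA hSB hgf (hback g hg)).mono ?_
        rintro v (h | rfl)
        · exact .inl h
        · exact .inr hgu
      · exact .inl ⟨(h j hj).1, (h j hj).2.1, hgood j (h j hj).2.2⟩

end Groups

/-! ### The case without edges between the halves -/

/-- The vertices `p.1` for those `p` in `ps` such that `p.2` has a member in `S`. -/
def reach (S : ℕ) (ps : List (ℕ × ℕ)) : ℕ :=
  List.rec 0 (fun p _ ih => cond (meets S p.2) (setBit ih p.1) ih) ps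

/-- The check for a maximal matching `A` which leaves the vertices in `left` uncovered and is
contained in the members in `S`; each `p` in `ps` consists of a vertex `p.1` and the Hamilton paths
from `0` to `p.1`. Those containing `A` lead from `0` to all vertices of some set in `ts`, and for
two directions `j` (three, if `A` covers the vertex `15`) those containing `A` and the edge at `15`
in direction `j` lead to a vertex of every set in `ts`. -/
def freeLeafCheck (C : ℕ → ℕ → ℕ) (ps : List (ℕ × ℕ)) (ts : List ℕ) (left S : ℕ) : Bool :=
  and (ts.any fun t => Nat.beq (Nat.land (reach S ps) t) t)
    (Nat.ble (cond (hasBit left 15) 2 3)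
      (countBelow 4 fun j => ts.all fun t => meets (reach (Nat.land S (C 15 j)) ps) t))

/-- For all maximal matchings `A` and `B` of the two halves of the 5-cube, `0` can be joined to its
copy in the other half, two directions can be added at the vertex `15` antipodal to `0`, and `A`
lies on a Hamilton cycle of its half. -/
structure HasFreeDirections : Prop where
  across : ∀ A B : ℕ → ℕ → Prop, IsCodeMatching 4 0 A → IsCodeMatching 4 0 B →
    Closable 4 (fun v => v = 0) A B
  within : ∀ A B : ℕ → ℕ → Prop, IsCodeMatching 4 0 A → IsCodeMatching 4 0 B →
    ∃ J : Finset ℕ, 2 ≤ J.card ∧ ∀ j ∈ J, j < 4 ∧ ¬ A 15 j ∧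
      Closable 4 (fun _ => False) (withEdge A 15 j) B
  cycle : ∀ A : ℕ → ℕ → Prop, IsCodeMatching 4 0 A → ∃ j < 4, Linkable 4 [(0, flipBit 0 j)] A

theorem testBit_reach {S v : ℕ} {ps : List (ℕ × ℕ)} (h : (reach S ps).testBit v = true) :
    ∃ p ∈ ps, p.1 = v ∧ meets S p.2 = true := by
  induction ps with
  | nil => simp [reach] at h
  | cons p ps ih =>
    have hr : reach S (p :: ps) = cond (meets S p.2) (setBit (reach S ps) p.1) (reach S ps) := rfl
    rw [hr] at h
    have tail : (reach S ps).testBit v = true → ∃ q ∈ p :: ps, q.1 = v ∧ meets S q.2 = true :=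
      fun h => (ih h).imp fun q hq => ⟨List.mem_cons_of_mem _ hq.1, hq.2⟩
    cases hm : meets S p.2 with
    | false =>
      rw [hm] at h
      exact tail h
    | true =>
      rw [hm, cond_true, testBit_setBit, Bool.or_eq_true, decide_eq_true_eq] at h
      rcases h with h | h
      · exact tail h
      · exact ⟨p, List.mem_cons_self, h, hm⟩

theorem Carries.linkable_of_reach {d F S v : ℕ} {cols : List ℕ} {ps : List (ℕ × ℕ)}
    {E : ℕ → ℕ → Prop} (hS : Carries d (column d cols) S E)
    (hvalid : (ps.all fun p => validMembers d cols F 0 p.1 [] p.2) = true)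
    (h : (reach S ps).testBit v = true) : Linkable d [(0, v)] E := by
  obtain ⟨p, hp, rfl, hm⟩ := testBit_reach h
  exact hS.linkable (fun i hi => validMembers_sound (List.all_eq_true.1 hvalid p hp) hi) hm

theorem hasFreeDirections_of_check {cols ts : List ℕ} {ps : List (ℕ × ℕ)} {F S₀ : ℕ}
    (hvalid : (ps.all fun p => validMembers 4 cols F 0 p.1 [] p.2) = true)
    (hts : (ts.all fun t => and (meets t 0x116) (ts.all (meets t))) = true)
    (hrun : runMatchings (column 4 cols) 4 (freeLeafCheck (column 4 cols) ps ts) 16 0 0 S₀ =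
      true) : HasFreeDirections := by
  have hts' : ∀ t ∈ ts, meets t 0x116 = true ∧ ∀ t' ∈ ts, meets t t' = true := by
    intro t ht
    have := List.all_eq_true.1 hts t ht
    rwa [Bool.and_eq_true, List.all_eq_true] at this
  have key : ∀ A : ℕ → ℕ → Prop, IsCodeMatching 4 0 A →
      (∃ t ∈ ts, ∀ v, t.testBit v = true → Linkable 4 [(0, v)] A) ∧
      ∃ J : Finset ℕ, 2 ≤ J.card ∧ ∀ j ∈ J, j < 4 ∧ ¬ A 15 j ∧
        ∀ t ∈ ts, ∃ v, t.testBit v = true ∧ Linkable 4 [(0, v)] (withEdge A 15 j) := by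
    intro A hA
    obtain ⟨left, S, hS, hleft, hSA⟩ := hA.exists_carries hrun
    rw [freeLeafCheck, Bool.and_eq_true, List.any_eq_true, Nat.ble_eq] at hS
    obtain ⟨⟨t, ht, h⟩, hcount⟩ := hS
    refine ⟨⟨t, ht, fun v hv => hSA.linkable_of_reach hvalid (v := v) ?_⟩, ?_⟩
    · have h' : reach S ps &&& t = t := Nat.eq_of_beq_eq_true h
      rw [← h', Nat.testBit_and, Bool.and_eq_true] at hv
      exact hv.1
    · have h0 : hasBit 0 15 = false := by simp [hasBit_eq]
      have hcount' : cond (or (hasBit left 15) (hasBit 0 15)) 2 (2 + 1) ≤ countBelow 4 fun j =>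
          ts.all fun t => meets (reach (Nat.land S (column 4 cols 15 j)) ps) t := by
        rwa [h0, Bool.or_false]
      obtain ⟨J, hJ, hj⟩ := exists_directions hA (by norm_num) (hleft 15 (by norm_num)) hcount'
      refine ⟨J, hJ, fun j hjJ => ⟨(hj j hjJ).1, (hj j hjJ).2.1, fun t ht => ?_⟩⟩
      obtain ⟨v, hv, hv'⟩ := meets_iff.1 (List.all_eq_true.1 (hj j hjJ).2.2 t ht)
      exact ⟨v, hv', hSA.withEdge.linkable_of_reach hvalid hv⟩
  refine ⟨fun A B hA hB => ?_, fun A B hA hB => ?_, fun A hA => ?_⟩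
  · obtain ⟨⟨t, ht, h⟩, -⟩ := key A hA
    obtain ⟨⟨t', ht', h'⟩, -⟩ := key B hB
    obtain ⟨v, hv, hv'⟩ := meets_iff.1 ((hts' t ht).2 t' ht')
    exact .inl ⟨0, v, fun _ _ => .inl, h v hv, h' v hv'⟩
  · obtain ⟨-, J, hJ, h⟩ := key A hA
    obtain ⟨⟨t, ht, h'⟩, -⟩ := key B hB
    refine ⟨J, hJ, fun j hj => ⟨(h j hj).1, (h j hj).2.1, ?_⟩⟩
    obtain ⟨v, hv, hvA⟩ := (h j hj).2.2 t ht
    exact .inl ⟨0, v, fun _ _ => False.elim, hvA, h' v hv⟩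
  · obtain ⟨⟨t, ht, h⟩, -⟩ := key A hA
    obtain ⟨v, hv, hv'⟩ := meets_iff.1 (hts' t ht).1
    have : ∃ j < 4, v = flipBit 0 j := by
      have hlt : v < 16 := by
        by_contra hge
        have : (0x116 : ℕ) < 2 ^ v :=
          lt_of_lt_of_le (by norm_num) (Nat.pow_le_pow_right (by norm_num) (not_lt.1 hge))
        rw [Nat.testBit_lt_two_pow this] at hv'
        exact Bool.false_ne_true hv'
      revert hv'
      clear hv h
      revert v
      decide
    obtain ⟨j, hj, rfl⟩ := this
    exact ⟨j, hj, h _ hv⟩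

theorem exists_linkable_of_check {d F S₀ : ℕ} {cols : List ℕ} {ps : List (ℕ × ℕ)}
    (hvalid : (ps.all fun p => and (validMembers d cols F 0 p.1 [] p.2)
      (anyBelow d fun j => Nat.beq p.1 (flipBit 0 j))) = true)
    (hrun : runMatchings (column d cols) d (fun _ S => ps.any fun p => meets S p.2) (2 ^ d) 0 0 S₀ =
      true) (A : ℕ → ℕ → Prop) (hA : IsCodeMatching d 0 A) :
    ∃ j < d, Linkable d [(0, flipBit 0 j)] A := by
  obtain ⟨left, S, hS, -, hSA⟩ := hA.exists_carries hrun
  obtain ⟨p, hp, h⟩ := List.any_eq_true.1 hS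
  have hv := List.all_eq_true.1 hvalid p hp
  rw [Bool.and_eq_true, anyBelow_iff] at hv
  obtain ⟨hv, j, hj, hpj⟩ := hv
  rw [Nat.beq_eq] at hpj
  exact ⟨j, hj, hpj ▸ hSA.linkable (fun i hi => validMembers_sound hv hi) h⟩

/-! ### Path families for the 4-cube -/

theorem exists_linkable_two (A : ℕ → ℕ → Prop) (hA : IsCodeMatching 2 0 A) :
    ∃ j < 2, Linkable 2 [(0, flipBit 0 j)] A :=
  exists_linkable_of_check (F := 2) (S₀ := 2 ^ 2 - 1)
    (cols := [0x1, 0, 0x3, 0, 0x2, 0x3])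
    (ps := [(1, 0x2), (2, 0x1)])
    (by decide +kernel) (by decide +kernel) A hA

theorem exists_linkable_three (A : ℕ → ℕ → Prop) (hA : IsCodeMatching 3 0 A) :
    ∃ j < 3, Linkable 3 [(0, flipBit 0 j)] A :=
  exists_linkable_of_check (F := 12) (S₀ := 2 ^ 12 - 1)
    (cols := [0xf, 0, 0xd3d, 0, 0x3e7, 0, 0x775, 0, 0xf0, 0x7d3, 0, 0, 0xcbe, 0xd9b, 0, 0, 0xf00, 0xe7c,
      0xbcb, 0xaee])
    (ps := [(1, 0x9a0), (2, 0x606), (4, 0x59)])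
    (by decide +kernel) (by decide +kernel) A hA

/-- The columns of a family of Hamilton paths from `0`. -/
def columnsEmpty : List ℕ := [0xffffffffffffffffffffffffffffffffffffffffffffffffffffffffffffffffffffffffffffffffffffffffffffffffffffffffffffffffff,
  0,
  0x3fffffff81fffffffff8ff8000000001ffff00007fffffff8007f80ffffffffe0000000003fffffffe0001ffffffc00ff1ffffffc001fff8000ffffffff8fffffffffc03f800000003ffffc03fffffe0003fe07fffff8000000000ffffffffc0003ffffffe0001fe03ffffffffc01ffffc0000000007fffffffffffff80000000000000000000000ffffffe001ffffe000000000000000000000000000fffffffffc00ffffc0000000000000003ffffffffc3fffffffff07ffff80000003ffffffffffc07fffffffffc7fff0000000000000000001fffffffff00007ffffffffffc0000,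
  0,
  0x83c1cf4bc19e383201c7db618fe1edffee04f33eff9fffc7e7bc78f8f3f3fbfe3e1818fe1ffc0021ff060e0e00ffe0f7f01e3c7f43fdfe7df80030001e007b0001e0000c7c003ff83ffc001fc1401fffe3efc0e78e9fe38007f800ff0000000fc008000000fe03860000000000001fc03c3c07e00fe3f801cc08033fff880fe01fff1fffcff1ffe7ff0ffff87fbeff7fe00078f0c1fbc1807f81c7ffdfff00007f7f01f30f1fcf1ff1ffcff3fffbc1f339fffccfc7bf7fdf7bf1ff800fe380027c006ffc0783e0400e3f881e33ffffffff81ffe7ffbe00ff1ff07feff80fffffe7ffdff1f,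
  0,
  0x21dff7dcf9d63fc2000000f1846e0c40007fcf7ce60f83d807b803e00fc34370000e6006601dc7feffcf7e7e001ff0f38cf5fd674011c0f990c01fbbff8e7fc1c0e0000107213c7800f3c0ffe75e0f1fe78327e35efc607c73f9c00ffffc1fffff3ec7c0007fbfb9f883fc18ce0018dcfcf0666e07ec3e1fff3bc3c1ff887f061c1c0f87c0e00600007fdf81f731fc709c01ff3bcffc1f803fcec007e0007f0fffffe133ff3e1e1de1cc0000e0000ffc39cf8c09c807000007819c0001e801bffc0e707cd683f98000000efe61f00f801b803e00000e07ffefc7ff89c007c01fe80618800,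
  0,
  0x2f0365210483a0a440340868000b7b24828890444220300ecc14090000000000001eead33e34cd9f60d41f6b73d236458b366d4a105c4f2b8ab9d0618cb9b04e26725b02b8d371eaa66454c993b2a92014d91c1bd982cb5ff7f2edf37fd6eafdb7f575f7ed3b5dddbd8f76dfbf6f6fb7fddf5ea77c3d61bced151404c1b35bfdea0274d231e683ccbf0220aa3a3b85481bdfdbf69f7fdeedfdf7770df47339db3af9e675ff76e7feefefdd6b04b04d0b45490c5d41c890823111684ffff6ddfdddfbdfef5f6bfefbfe745ffeeedf77dbdfdff5eebeef6db57f77fbabfd9b27767e8fa7fb7f,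
  0,
  0x2d6000031d91c3af553faffcd8893876abe894e99fb5fffedffedfab8800a369dba2087b3b16851f62462a52d7fbff75dbb7000322fc0b333f80d6000010db052e76bfd6f6d9a8312fa0844d9932fbe6db73fd3ec002eb7a0032403b1a123a4ed440174aee7fe5193f2000023b4bd921256e4a2d1f4d3d2f651d97bfebfb688d0e5a76e1869c37e7eff77bcffe12a69dfe188a20802a4e8054035733e4f77a532eebdcd4e92bcc0c89a95976009048000049175da3acb7d7b59beeec01404400000b922d04026c22d87dff143404460001403c0ea2726621a953d201253a0fbe595ccf3256,
  0,
  0x18eefec76eba0d5e855fffb681b1f2196b81b7060ea03577c9d61c5850b498a607c93c389ffcb90b7f7cde8675602ddaf3ae5cfd51ec161c291a923d7e93ddbb7be5eefcbefa06ed675c5b0bd989dbf369d4cdf0ba97fd800c6a047f4a0dc35381c309155f9ec6c61c7425dd11464d27893d82a30366fdcadef58c3f5ff9077a22ef80299f74008b7380477aea841603e43c1855c019e7c88b1280ea93fb0cf11b4f749125474322203ac090072bd017d002d8c6d7bd0fa7005217846b238c007f20ed9d038824d0b427cbacb0033095a0840020c2f0180720309024a8800420e2fb4550b,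
  0,
  0x31ccaa0a5f8540dd094186594fdfbc77b93c1ce99ce68975108ff0a07dc8e16b583a9771eb5f8d7ca2668fd6c5708b11b88ad4976783b971315fbd025608fd593e8e2cfe5268bc675e1d851cb979d2b173716075a72f67c2ce17fa70d2aa553e085a3e085041ef6b031fcb41d9d0d1cb6c2e3f2cb75ecf67e52b39a91ed86e213e6fce60de9c7021a53501408df672852d6bb8a1f0ea47f6ca31eaa2ea9402f0f822dc1bfb0b412f9ab9eb14eff6f8e0c84079bdafbc70560cc8a1e57f7beec28203b609c5be8b0c1908a7be14ef537d032cfbd3a536f6e3aa9858510e6e080bdb604314c2,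
  0,
  0x3fffffffffffffffffffffffffffffffffffffffffffffffffffffffffffffffffffffffffffffffffffffffffffffffffffffffffffffffffff000000000000000000000000000000000000000000000000000000000000000000000000000000000000000000000000000000000000000000,
  0x7ffffffffffffffffffffffffffffff80000000001fffffffffffffffffffffffffffffffff00000003ffffff800000000000000000000000007ffffffffffffffffffffffffffe00000007ffffffffffffffffffffffffffffffffffe00000000003ffffffc000000000000000000000007ffffffffffffffffffffffffffffe00000001ffffffffffffffffffffffffffffffffffffc0000003ffffffffff000000000000000000000000000000000000000000000000000000000000000000ffffffffffffffffffffffffffffffffffffffffffffffff,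
  0,
  0,
  0x31c3e0fb3fe6fc03dfe07e5bff001f23ff1f8fccf1fe00007f847bf3f7c7cfc0fc3e01f001fc3ffc1fff9fff1ff0003087ff3cf9fbcce0f860807c07fe07f84003e001ff003f8c003c0003fe01e81e00000001f0831000c0008003f0000fffff00ff1c003ff0000003e3c1fff01c1c023c003f9fff00387fe0ff7fc3ffff7f3ffe3ffe0000f0e0007f0f03fff8fcf0f8fffff80ff3e03fe7f800138001ff0ffff807ffefcf3e1f7e3fe03f07c03fc3e03c63ff3f007c081e09cfe7ffff003fffc7fff8ffff9fc007ff03ff7e3dc00007fe07e0007ffc1ff001fff81f7fff0000007f8207e7,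
  0x10c0e30800620c1cc7e18040e73fef600f7ff3fd301e07ffbf8dfcf5fbdbc3cffcce1e40000003fce0038f000ff000f0003e1c0809c3e379e7839c087e001803fde03e3f080efc3ffc00fffe7ffbfe0fffc70ff78f763fc83f80000003f03fff010f0003dff007c00464ce3873fce27ffc7cc1801300001fe30f03c000077f4ffe003e07ff31e01f831f1c07fe0c7338063ff83070000003f803e0000000000ff80001c04300031e01e3ff18c1c7dfe1fce007377fbff9e2f8c7e038070043c7c83018000081c07b3f0c011e00c0fff8fe7fe01f81fc1ff0fe03f96703ff03ffffbf9e7fe8,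
  0,
  0,
  0x10049a40e0281d58abc3f2936934800910112300000707f13003b45c916950ff6d41150480c01220910100000c24498a344892048da28000257701bd70cf24fbfb9dfc7b5fafd60c40596b3060cdcebde7afe7fd2fff7df07ac5ba04e5e8c500281eeabf51cc7eeeeaf5db28cfb5f6da52b5b110a7fecefedfeefbfb7e3d924091250b1fff7bfaffd5fcd737cdc57bf7eea334dc7441213feffdaaeefb9cd7bcdf3e7b8b97dd7d03527feebd7b4635b3eb96c8a3ffffefffdeeebff18cb90242a110251060fddbfd3fcba2ffdb39b91d1a2982514105908646880dd682e7f87bbff77dfdb9,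
  0x8984ee36c104038c297012000000b7533291015cf495110a832f53482fd903675373ccfdb7fe6bf7fe1bdacfddbfefddbf7bfffb7b5dcfdc42096030641908181a4cd412400005893a932640d56dc200062e4223910a5d8cd3efda46fdd3f6a3effbd17d5ba67d3ffa977d496b4daffbbe01080028040102069492644800015ed880000006c110069c55401c400036065754f6bc7b77e221888f61bade6edc596bfea10df38b7f61427dd514ea0d43a36f1800411083d4a009392d48bba8a366e6bfbfeb4038dc79beca35f7a986fe8a3fbb3df3fb7dfd7be3f54feedf98987fbf885eb,
  0,
  0,
  0x3f751071adb8fd2ae3a27a921924fbcffbc1a7c4c33534a8ff729f1a936516f5ed036dd436f4d42f59dd326318a07d2e17453a40b8ecceaa2da45715a8c7e2e40a70015314935f99adeb4a6f40e46e60ce2ab538f9d2c87373ff8fbf715febcbf4f7cc2e2bfe7098aaa1d1aaae2d1fbe17c50017e50818a0405484106a390318c0115219247aa2e65dc003bb5851a0d0ca801a5eb46029a9754c170054df51100a0b7a8785300d405f6c5c27520d44220387da4310ccaa0f918a0ec1890c1748e1d021366c495cb37401ba44201d0c17bff9a46473dde03405fdff9eb5b33c3030d7edab35,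
  0x3e79fd5f817ff7ae76fe9564b00c62486f63e115171958dc86289eb53a92b795b6c72e1c260044ee60102321a8b97e6659177f0a38f507088dafd6dc2f3243b6ed73bf15fdd6119ba882f80b76376244dc423e26f8729a2dffe90c1923502bdf4727c5058f1613d1942cac3236eea03c854843f7dbefb1ab7f15a77c2be789cc45c030817420afdf0a437c0c135fa71b42147f7e29179409344ad4111421600166d020f671f3a894c504555855cfccdd32bd97551481b9a5fb93da9a95cedb8bfc684b6f0ee176bbe63d498766528ceaecf3a0ae83f82011d5063364b581219ce69988ab68,
  0,
  0,
  0x7fffffffffffffffffffffffffffffffffffffffffffffffffffffffffffffffffffffffffffffffffffffffffffffffffffffffffffffffffc0000000000000000000000000000000000000000000000000000000000000000000000000000000000000000000000000000000000000000000000000000000000000000000000000000000000000000000000000000000000000000000000000000000000000000000000000000000000000,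
  0x3ffffffffffffffffffffffff800000000000000000000000000000000000000001ffffffffffffffffffffffffffffffffffffffffc0000007fffffffffffffffffffffffff800000000000000000000000000000000007fffffffffffffffffffffffffffffffffffffffffffffc0000003fffffffffffffffffffffff80000000000000000000000000000000000001fffffffffffffffffffffffffffffffffffffffffffc000000000000000000000000000000000000000007ffffffffffffffffffffffffffffffffff000000000000000000000000000000000000000000000000,
  0x3ffc000000001ffffffffff007ffffffffe000000007ffffffffff807f00007fffffffffffffc000000000001fffffffff00e0000fffffe03fffff000000000fffffffffffc07fffffffc0000003fffffffffc01f807fffffffffffff0000000000003ffffffffffe01fc0000ffffffe003fc0000fffff800000000000000000000007fffffffffffff000000007e0000000000000000007fffffffffffff00000000000f000000000fffffffffffc0000000003ffffffffff800007ffffffc0000000000007ffffffffff8000ffffffffffffffffffe00000000000007fffffffffffffff,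
  0x3ffc0003ffffe0001ffffff1f800003fffe000001ff8000000003f807f00ff801fe0003fffffc0000000001fe0000000ff00e03ff3fc3fe0007fff00001ffff00001ffffffc180007fffc000000c00000001fc01f81801f800007ffff000000000007c0000000007e01fc007f003fc0200003fffffffff8000007fffffff80001ffff8000000fffffff0000001ffe00ffe00000003fffff8000003fffffff0000000003ff00ffc0fff0003fffffffc00007ffffc00000fffff80ffffffffffc0000ffffffff80000ffffff801f0000000007ffffffffe00000000001ff80000000000000ff,
  0,
  0,
  0,
  0,
  0xf8009e1b5442031408050496c004d26d664cbbbdd8c80003e842a36e96af0092a00028410b20400e2ae09480098030408100b1620130d4504a7ece7f36df3041cfa1bce77c8ff73b9eb3dfff7f13dff976fbe6f67db6ac8c3953f88a0f37fecfeb9f40be078333577aadf770da996daf6ae7dddac1b70312bba32f9fc6ecaf7dffade4428d1d116af7fbccf7fefebff53c242beb9e77d20202dcf103e0ee20e4478dfe68ab9afdbd9033d6adbffadcbefbf7fc82377515efffd7be3041efb71e2dd0efbf96210680bfc50135e2c0e6e5f61b99fff2fe4b89fef67d7f44c38dc1785a06c6,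
  0x10f4029018104f1b87096096dff484d0084446aba81086a02343c40acb7d026fc98bddeff1efb279dfabfed6df2fedbb76ed9af5efebfaf777020f0870400e21580c003006088e150108020408400003cb268100044424022f3fd30edbb937c2ddcb8a4afaeee7ba6e70dfa86bf9db6d0264814803c01e0302ca82b2180824020010032dce19102240941a01c4007ab485baaeb9f4b86993dfeffffbefdedf36ff6f599fefa9df4919fbfab6aa01122080800222ba26674084ee04252b7d6777eb95b414a1dffd7639efb35db1a5efb4377c0e5d61d0da6aa8c9c4ff0376defff9745f7e94,
  0x29b65bc02463ef7fefc5d6fb642478044064816604af80feffd6bf766960c16b6fce280442968c00cb8d5ad3bdfb6ffefff6df85f5d74ccda8828428f20000ed5eb43ada97601c2900610820603355b3cdc1ac21005968d850805c0000500b103a101f5bfb39bf7d5ca24d504fe2c04881bc4c248b3f3d1baf36c4495c68532608085fe79e7cd183a0bacf8322fdd6a114441030b949047bbfefddd1f6badeff1d5a7607ef6b2f024d6b7cb8429824c142020025c5358286b75511a7206b9bd5ee448c29b07b7dfe7b65debefc200e2e49641a01c88095810242028585df7c5e6abb2cfef,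
  0x29747b1fefa2c108fad6883fb72c7ac56dff7f66a7a26abeb512d5ec37d5e860dc0c082d4adfa91ddb9d40f72060488266c087cd1487eefc2000929b8fdbee05000522b0803c6c4f57f7ef6cecead1bae8d9fdb1ddc05d801009586fdf586e1bd8168f6e0a80086ecc0568de0216e07dad584c260b042908ac25ed6d53f9752fb97f91e2943c1fedf9ebebbfe29596e9e80009017fde9f8098421cdff4a9d3e997d03010604f74b7f4282ab8a011723c5feeee258424feaf0647d782a3401754995fd96f94800503fe610488b812190161f477d58cdc9fe7e6dedabdb97d6673c863448bd,
  0,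
  0,
  0,
  0,
  0x3fffffffffffffffffffffffffffffffffffffffffffffffffffffffffffffffffffffffffffffffffffffffffffffffffffffffffffffffff80000000000000000000000000000000000000000000000000000000000000000000000000000000000000000000000000000000000000000000000000000000000000000000000000000000000000000000000000000000000000000000000000000000000000000000000000000000000000000000000000000000000000000000000000000000000000000000000000000000000000000000000000000000000000000000000000000000,
  0x3fffffffffffffffffffffffffffffffffffffffffffffffffffffffffffffffffe000000000000000000000000000000000000000000000007ffffffffffffffffffffffffffffffffffffffffffffffffffffffffffff800000000000000000000000000000000000000000000000000003ffffffffffffffffffffffffffffffffffffffffffffffffffffffffffffe000000000000000000000000000000000000000000000000000000fffffffffffffffffffffffffffffff80000000000000000000000000000000000000000000000000000000000000000000000000000000000,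
  0x3fffffffffffe0000000000007fffffffffffffffff80000000000007fffff80001fffffffffffffffffffffe00000000000fffff003ffffc07ffffffffffff00000000000007ffffffffffffffc000000000001fff80007fffffffffffffffffffffc0000000000001ffffff00003ffffc03ffff00000000000000000007ffffffff800000000000000000001f8000001fffffffffffff800000000000000000000003f000003ffff000000fffffffffffffffc0000000000000007fffffffffffffffffff800000000000000ffffffffffffffffffffffffffffffff8000000000000000,
  0x3ffffffc0007ffffe000007e07ffffc00000000fe00000000007c0007fff007fe01fffc00000000000001fe0000000030000ffc00c03c000007fffffffe0007ffffe00003ffe7fff8000000003f0000001fe0001ffe7fe07ffff80000000000003ff800000001ff8001ffff80ffc03fc00003fffffffffffffff800000007fffe00007ffffff00000000000001fffff001fffffffc000007fffffc00000000000000003ffff003f000fffc00ffffffffff80003ffffff0000fff0007fffffffffff0000003ffffff000003ffe0fffffffff8000000000000000000fe00000000000003ff00,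
  0x3e03ff03c0071ffc1fff806de7ffe03c001ff00f1e07ffff8007bc7c78f8f07f1fdffe3ffe003fffe0001f1fffffffc3f8fedf3e0ff33f1fbf7f80f80018000ffc01fe003800700040003c000203e00001c1020104060107ff007c000ff00000030063ffc0001fc79c1c3e000fe3e201c03c3fe00fffc07fff007ffc00007fc01fc007ffff00ffff800ffc0001071f0f01fffff003ffc007ffffe3fffe000ffffff80030ffcfe38fc0ffc3f8ffc003ffc07c0033ff800fe00e70f807ffffc03ff80fff0003e7fff8fffc03ffdefffff80007ffff80001ffffe0000e1807fffffff8003f8f8,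
  0x27030003438410601802020907c1f1bff19fbccedfe7f803c1f63b7a74e4fc701f3060301e003c01000c101f1000010080c0003002003c9e387c60f7801fe04c0201c1c030317fc07fff3fff83effff001f9f3f9f79fc1f7c0007ff00c0fc00002f07ffc200018079b9b31c78c031f83ffbf3e01ec01c06000307c0c00007fb1ffffcff803ceffe1fcefe3f879f79ccff9c0004083e043e40004038002000ff000080e208c0e03effefc03e7fe3863fecf7ff8fb83c40e1f0f78ffc7f8018438100fe1003f060180c01006601cff00070187ffe1fe07ffff0ffcfe99fc7ffc0001c06380f7,
  0xc221f86f07b8000001f81a4e0b9001800f8733b3f9907c20000044d883bfb8803c1180f98022383f0036818e00e00c04030832f80320317c67382fc41ff1fb3e011fe00ef8de03843f0fff1ff9e010e0187cf8f4ef839383840600f0ff03e00ff0cf383c00804047c743e3e7303e271f3f0f9f91081041e1f0cc3ffe007f8cf9ffe390783011f9f80f8fe07e7880f3ff63fe7fc4f1ffe180403007f8000f80f07f801fc00cdfe9fe10300f831c03f1fffff07fc630387e1f637fe3800e14024383f1ff832f0006000fc0011db20ff0000401c1f80031f8fff0387e7e38083fe01001c7018,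
  0xd2210e420009b63f0127bbe04a1199380800a0ae185f7027df6434b84270878e33d79ef19f233031fcf78f81fcff1ffc7f1a3e18e3ec0967ef062f7c1c7000f83fdc1c0a7bd6b3803e003e101801dee01bec1884281f83730fe63ef0c0ff800f2fc93fb3ffffc3c7bf331fe0f1f1ff033b3f8190c013c5c10fcc003e00070bf803807ff83ff1e0070e8c3f760808cf0f1ffc74fce003a07f7ff1f7e01ffffcf078fffec8cfc1ef020ff3ce73038231e3f03000ae37f8619073f0607c081343c37fe00f03217fde7c0d3fe71f93cfe07f9c01c007e031f0c01f3869e6078fff0017ffff717]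

/-- The ends of the paths in the family, with the members ending there. -/
def pathsEmpty : List (ℕ × ℕ) := [(1, 0x7fffffffffe000000000000000000000000000000000ffffffffffffff800000000000000000000000000000000000000000000000000001fffffff800000000000000000000000000000000001fffffffffffffffffc00000000000000000000000000000000000000000000000000001fffffffe0000000000000000000000000000000000003fffffffffffffffff000000000000000000000000000000000000000000000000000000000000000000000000000000000000000000000000000000000000000000),
  (2, 0x7e0000000007ff80000000000000ffff800000007ffff80000000000000000000000000001fffe0000003ffff0000000000000000000000000070000000003fff80000000000003fc000001fffffe00000000000000000000000003fffc0000001fffffe0000000000000000000000000000000000000000000000000000000000000000000000000000000000000000000000000000000000000000000000000000000000000000000000000003c000000000ffffff8000000000000000003f80000000003ffff0000000000000000000000000000ffff800000000003ffff),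
  (4, 0x7fc030c43f8007ce00383800001e1c001e030f00000000381f800000000000000007e401e03c001e00fe000000001fc0000000000000000000000000000000000000000000000000000000000000000000000000000000000000000000000000000000000000000000000000000000000000001f001c780033f800c00078001e0000800030f000180f000007e00000000000070fc0043f80007ec000200f00000080fc0000000000000000000007c00cf8000c00387f003f00000000001c7c0183001003c0001fb001c04000000000001f800018007e0000e00ff000000000001807c0000),
  (7, 0x20030c9210001483080c040003d8160870180500000308c0420000000000000000138190800c2c8010300000103e0e000000000000000000000000040020000062120000400004c000100010800203100000000000000000c8418010000006000c000384e0080000000000000000000000000000008000220c000000000008000006010000c001800c002208800000000000208c010004040c00108180000830007000000000000000000000000000000000000100400004000000003860082000010008000602040020000000e301070600000000000083010c00000007800e0040000000),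
  (8, 0x4af1283404b859c2006c500002811dda38c260c0074420a00000000000003010e040f103118035000000802f0a00000000000000000000000086a0102184120404cd02048251206d8d2298c10642200090c51000000000040cb0100a08800100801120c0f0047018010000000000000000000d2498264102433023c000a6800000000430e300862c62a10800004004100380000040e2020006c2600180378b001000000381c800000800000),
  (11, 0x1000200000000000025050000404001188044a00000090042400000000000000000800052060006800800000090020000000000000000000003b0040440b240a000949308000110a024c538930010021540000000000000026006b404388619000000001190240000000000000000000000011000000000000002020188000200020000050209a08300000200000000001020000001010018060020800100180720060000000000000000000242000080001080000000000000000010000000080000440000190002000000000000000000480c0258018000080000000402050e221000000),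
  (13, 0x8001020ac00080001a00800002208060000000000042528180000000000000000000000401001060840000000c090000000000000000000004010000884900000c0200a0000402000000040400000082000000000000000101000a000460028a00000220001000000000000000000000000249404180014d0000101c610420818010456200000140100818200000000002d1002024e20026310006450c000088803800000000000000000000184000200424000401800000000000000000004000010a2400008001480800000085050800011101000040400300000000003211002000000),
  (14, 0xc041000003001400200000000020060380000000421000000000000000000004002a0180121007000000060140000000000000000000000040a93010000001049000000002042000200000008884800000000000000400a01000ac00804400000050040400000000000000000000000002000a64200800801202012010c4010020800000004042065004000000000090040000010000008000002120060004040000000000000000000008120191201884008020059000000006849000130508c005000060008a4340000010a088580302084a60000040420000000040000c1c000000)]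

/-- Pairwise intersecting sets of vertices. For each maximal matching, the Hamilton paths from `0`
containing it reach all vertices of one of these sets. -/
def targetsEmpty : List ℕ :=
  [0x96, 0x906, 0x2112, 0x2994, 0x4114, 0x4992, 0x6186, 0x6816, 0x6886, 0x6892, 0x6894, 0x6982, 0x6984, 0x6990]

set_option maxRecDepth 100000 in
theorem hasFreeDirections : HasFreeDirections :=
  hasFreeDirections_of_check (cols := columnsEmpty) (ts := targetsEmpty) (ps := pathsEmpty)
    (F := 1830) (S₀ := 2 ^ 1830 - 1) (by decide +kernel) (by decide +kernel) (by decide +kernel)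

/-- The columns of the path family for crossings at `{0}`. -/
def columnsPoint : List ℕ := [0xfffffffffffffffffffffffffffffffffffffffffff,
  0,
  0xfffffffff80000001ffffff80000fffff803ffffffffff0001ffffff0000000fffffff000003ffffe0000000003ffc0000000001ffff007fffffffffff003ffffffffffe000007fffffffff,
  0,
  0xff03f03dc0f8fffeffe07fbff9f3ff03e0380c038801e007079e3f00ff01e007f000e0031f81fc0c3fe3fbfdf9ffc7fc01f8f039fe003f7f9ff3e7fffcff07c78fffc7f03e7e1ff81ffe0ffff,
  0,
  0x206ff625c00038f00603dc1700e0e067e01907d3ab00e0002389ff306761e181fc67e783d1807bbca3ef638880e01fe1c7dbc010f9e7ff001b0241e1c000008fcc1fc7e0000410003de0047e0,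
  0,
  0x205a510604c41113b1308c040074b63f8e14f57716d4d0c1bffb0dc5329fe7bfeffeb7ff3c4d69df58467c89f8a7cea33fffffdf7fbb9f19d8b7e39affca2fdd7f5cfef7fd7adedfbf6efd6bef,
  0,
  0x82000068fe719518d348eb7c734b63ceb9cc1000648f4ef70310dc77ff0818244a2054770444acdf5ec0089342befbfe0050911195318b8400062ba6ecb74000150f241a5e000891824f1739e,
  0,
  0x60d9771fe59c9016b01f84481ad5277f8e2722d25885de53f8db6551fbd02e032319ba8194c821d351de1d8143819c054302470ea2a8935188370900e7c2e0c4280e1c9309208043842b4408a7,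
  0,
  0x722042766f307b9d907e14c0523f4e5e41ad3b984a28ac734a9f54535b622ad21783784157dac3cb048982d92569090c7f24253d8bce789bef1065ae6ef15faeadc37ecbacbcbfe3cebe1755a6,
  0,
  0xffffffffffffffffffffffffffffffffffffff0000000000000000000000000000000000000000000,
  0x7fffffffffffffffffffffff8000000000000ffffffffffffffffffffffff00000000001fffffffffffffffffffffffffff0000000000000000000000000001fffffffffffffff,
  0,
  0,
  0x71ffcffde3f3f000f01ffbfc0fe1c1ffc7fc0f03c701e01f81820400f001e007803ff000ceffe07f7dffcfc7e7e0ff8fffe3f3fce07ffc787e7fdf8003f1ff879f3fff81fc383e3ffe3fff001f,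
  0x1001c01c2030707f7007fc3cf7e00001c07c030cc10fe0278f8e7c3ff1f1e00000c1f007c200e0070401d1c063e13f91c3e000fc0001fc09be0fc381fc720783830001800c19fec7fec1ff3fff,
  0,
  0,
  0x568526383118a62402893002f889084010eb2a9ae9ff7f7edc46f23fdf6a38613149dbbbcfb3bffbffbbf7760fff355dc76a74eee7fcfff7afd91dfdfdbffbfaa8a70dff7f8fe760c4930fdcf3,
  0x42852ae8a3390000048b704bb94b4beeffff0880412103184004a232c8225eebb2dffa9cd1020020209800720050104c492ad764e0eee5e4270818010014d1e6c5af353852bfab3bc7ffce9c75,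
  0,
  0,
  0x17f60f201043a721e3b83bb6eda998f016d88d03a7d0700c956282a4162bf025fd6ed73a68310848482266068ca6640b846bb0c045700c3078d9169819893b181835ec65740a663c8016a9405b,
  0x1ff7f9aa9c6500534482681ba16212a0ea1cd56575d7738df428aaa600b3d628dac4860c0b377eadee3e50f2f8f77cb2c8ef9bf40da3adacb38fa2133c4615fdc755b13c56c3ea8d0244e01f79,
  0,
  0,
  0x7ffffffffffffffffffffffffffffffffffff000000000000000000000000000000000000000000000000000000000000000000000000000000000,
  0x7fffffffffff800000000000007ffffffffffffffffffffff0000000000ffffffffffffffffffffffffe0000000000003ffffffffffffff00000000000000fffffffffffffe000000000000000,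
  0x7ff000003ffffffffffe0007fffffff001ffffc0007fffffffffe00fffffffffff0001fff007ffc0000000003ffffc00000000ffffe0000ff80001fffffffffc000003ffffffffff80001fffff,
  0x7ff000ffc3ff80001ffe00000000fff000007fc0078001fff007e000000001ffff0000000fffffc03ffe007fc07ffc0000007f007fe0000ff800fe00003ffffc07fffc00ffe01fff8000000000,
  0,
  0,
  0,
  0,
  0x92088c1ca2348c84c4643f90702418061005fedff2bafbf63bdfffaedf5dfdedeb76c44f3fed624a7fd8bfff758fbfef8958b31984760ee776efe670275d427d7fbf30882f539bf7bfdf2b71c,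
  0x1d2084115802eeec4a4403b046bffdd171eb8208a80a2c2600005008054db9545d214d63e2b096008721830407082110b6d528bb9f557af20040046400210e3bbaf3cbcfafc575e4789133f79a,
  0x215ad9c17effc08a7042414d3fc241830577946510378b91a3880008a095461c8a1420fcb00ff5360a560800fbd4dae2189082fffeafe7401026814793748005560803beda70181623481eaf6d,
  0x1a945d409a84ae3bedff247c80fd131443a65e8f9200e6b7c6fd7db45c217dad78ffbbac29a5121b77ff2dc20eb7d384d07c0a7614564318f3de44913ea21032aacc0639405556bddb2baac0,
  0,
  0,
  0,
  0,
  0x7fffffffffffffffffffffffffffffffffff8000000000000000000000000000000000000000000000000000000000000000000000000000000000000000000000000000000000000000000000,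
  0x7fffffffffffffffffffffffff80000000007ffffffffffffffffffffff00000000000000fffffffffffffffffffffffc00000000000000ffffffffffffff00000000000000000000000000000,
  0x7fffffffc0007ffffffffff8007ffffffe007fffff8000000ffffff0000ffffffffffe000ff800000001ffffc00000003fffff000000000ffffffe0000000ffffffffc00001fffffffffe00000,
  0x7fffff003c007fffe0000000007f000000007ffff87ffe000ff80000000ffe00000000000fffffffc001ff803f8000003fff80ff8000000fffff01ffffc00ffff80003ff001fe0000000000000,
  0x7e0ff0fe3ffc7fff1fe1fc07f07efe0ff9fff03c007e01e00e04180f000e01f800c001ff0f07ffbfbe01f078387f03f03ffc7cff7f9fff8f8780e1fffc3e0ffbe7c003feffdfdfc07fc01fffe0,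
  0x600e00e003c07f809ff9fbc70800c00e01807c33067001d80ff79fcffe0e01ff803e01f80c0700383801ee7fbc7ec3ee3c007000601e000e47f0fdfe03bdf80004000200f01e1f387f3e1fc000,
  0xc09309f800c0c700f81c63a80103009b80260befdce11e07c457bfc098801e060f98f8703e01804b7c139ff50110271e39e4f021001838787cffa61e00e007363fe000003c780c07de1e0b800,
  0x6dcd2f81b3cfff60ef1183ff8fdda1edbff248a3b06ddf1809710388ef8ddd87603f01f6f0c41874f1c02d061f90c26d331bc2c3f0798374446c19f9c389e843583c03f1c33f00387121dce01f]

/-- The sets of ports of the path family for crossings at `{0}`. -/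
def groupsPoint : List PortGroup := [.pair 0 7 0x3a10000c000c90808842020833501a018fa4124c5230c074c00044180a226080388f890023000800010a8134000002ec86013e8006008203d3006623c410342002020f30c6a0000c3e239800,
  .pair 0 11 0x354041b35044e200525201d8028000c10020102130840911880b5288038100145b050060029010000e020056c9f54820120022800fa9ab108004a500002108090e550880ce001ee4620014452b,
  .pair 0 13 0x2000a44223b012921201424f50808001450098c83288020030400300020408024c270167148c94600c020080000024901388441504044017c085289d818030251a864600038001281c0882044,
  .pair 0 14 0x4885a408818010460c05a8010044a724ea0042400001460e0030ad03e4549d0b000000008c0426b1f13cd520020ab594004158002010106c002008100402e4c080009110010141091001400290]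

set_option maxRecDepth 100000 in
theorem hasThreeDirections_point : HasThreeDirections 0x1 :=
  hasThreeDirections_of_check (cols := columnsPoint) (gs := groupsPoint) (F := 615)
    (S₀ := 2 ^ 615 - 1) (by decide +kernel) (by decide +kernel)

/-- The columns of the path family for crossings at `{0, 1}`. -/
def columnsEdge : List ℕ := [0xfffffffffffffffffffffffffffffffffffffffffffffffffffffffffffff,
  0,
  0x3fffe3ffe7e000fffffffffff800001ff0ffff18001fff7ffffffc1f807fffffffff80000000ffffc01ffffe01f800000001fffffffff80000000007ffffffffffff00000000000000000fff000000000000000fffffffffffffffffe001fffffffffffffffff8003ffff,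
  0,
  0x3e431fefafaa21e40280fcb03fe3f877e3f31f7b203c60f783fc03fceb800006007001807e00ff0001c42001fe8e00ff9ff1fe3f187ffd383dc01f8978007cfa07f0cf1ffdc3f99efe7efff0fb03ff9ffcf9ff9ff007fc7fd801fffcc3e03e1ff8df000ff8fcf9f80fc0c3f,
  0,
  0x101e5f7ec00620e8e7dd0cb00000c0006bdf1383183153f79b1c000e7b827967ee7001be46407fe7f7ffa791e6e1e0861d6000fe787901fa3ec407a967effffee7f0ffffc1c7819e04160013fb00f88000c19c0403e7fffc7871f41cdfc6261ff91f0000000001e003efcf8,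
  0,
  0x400034401604336faf1654607c5b9dedcf618189e7dd02f706084730ffcfbb3f9367ded2dab5fbbfa9a3f66fb3c69f6ff288617f912dd6ef5eff7febd73f3966a9f5bfdedfafaf3ebf686d3ffc1be84f5ebceb74b8bd9c61f773fdedeefeeebbfb2770df2d5abb7df7759,
  0,
  0x14082aa4d7f631000055efefdfe69fcbd81efefe8450006ab4b1b74f3b0013719d7ffc0400c3012b1003bedfc17a89a47caa773feffbff8010e345fc8442c686dbbffa25413258d7a3df57fdfa002480010004a6000000000817b00a8a0109ea3d3ae5ed7aadcda4c94273,
  0,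
  0xcc129e5b6bae4273baef7c1aff83a07e4f365b9118eed23f7ff2cfd3d858eda86b067803a0284292ae0e006ff8ad22fae115e0d7b827d184670592a78931fff7bfdd506dec85e209e082fec37500329d86a25813408f03fe00203ed41e84aa0a8ed0021c8757a38155151d,
  0,
  0x5d98ebca94187e6cb01c4c828904efc43c81c7a857cd0321ba5b240071140970cc80947f67657603b272f585c440a3ae844967d262e2000b42e7552a408f00e4e91010e6c03e0474090ca53300fce3e990e305442368422060fa100c189f42b0a9058af000120446d7dd0f0,
  0,
  0x7ffffffffffffffffffffffffffffffffffffffffffffffffffffffffffff0000000000000000000000000000000000000000000000000000000000000,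
  0x7fffffffffffff800000000000000000000000000007ffffffffffffffffffffff80000000000000000000000000000000000000000ffffffffffffffffffff0000000000000000000000000000000000000000000000000000000000000,
  0,
  0,
  0x43fbe7d031ffde07fcfeff4fdffc3f879c6ce07cd8408f0804003c00140d86f981801c01803f001ffe38c00e01003f7fe701ffc3e787fecfc1ffe0069fff80fdf87f33e0fe3c7e60f980ffef1cfc001fff0603e0fff8007fe7fe0fff3cffdfe000e0fff000ff061ff03f7c7,
  0x4fbda0a1f67002021c020143c00fff3b9cb8efff9f4fbf687cff79fd001d1e189f80e27bbe3e00ffee585f7e1911d901680e77dde600fad1c031e016001f8304180710ee3e787665fb8107ce47f00663fb3e7fe37fd9f383ae0e03033d21c1e1e7e7fcf3c7033e78f01f000,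
  0,
  0,
  0x2c8c3943b688e848101020238381040200009618378a37f97ef7e7bfdfc1fa48feeddaad3fa1c64c08f7dd3f9feefb60b8bd7f9eabe6ce7b4ab3dbaa77fbdbffdb465f142becc272cfca8eb8f147d53390afef9596cec66adc3a8466575b4bf5de6dd9b929d7af6fb7fbdbe,
  0x34915f80ba81fc6ffbfbfbcfbbb987477277dfff720022840021a6b80547a5dde42ebd093d37deedebf7f403d3ec7860100512040022522f12f508a03db9c197bb5faa40a3fadef005e0bbd686136c34b9ebc7bdbb4352a7be18acab5ffb0800442c5d876277f7f59248def,
  0,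
  0,
  0x224e1752618e085844d13e3653fd5d9fe94c925fa87017de0f041b26d2e9e22f39f1188ddebfff5efdbd813f0fa6285261a0b802a8058e420992a28803608038000243302fc4a3826e92d8f019251c163f9c8a80d0c2044cd830ed76c4421e46527b1d1001af880b20a2402,
  0x36115ebcfa1723e24e83187ff0abc133800f0b43aa6532dc8024c3ffe3df151d3f46e90a941813c48f1d227213b54dd159f6ba750431fef7b9d5ae952d5de9180663aa893053e88e70a60240ca825c92ed18deab72919c820c1d36b80d23bc4dd0c265d2720c10f1facec6b,
  0,
  0,
  0x7fffffffffffffffffffffffffffffffffffffffffffffffffff80000000000000000000000000000000000000000000000000000000000000000000000000000000000000000000000000000000000000000000000000,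
  0x1ffffffffffffff80000000000000000000000000000007fffffffffff800000000000000000000000000000000000000007ffffffffffffffffffffff000000000000000000000000000000000000000000000000000000000000000000000000000000000,
  0x7fc00003fff81fff0000003fffffffffe000ffffe7ffe0007fffffffe07f80007fffffffffffff0000001ffffffe000000fffe00000000000003fffff8000000000000000000007ffffffff000fffffffffffffff000000000000000000001ffffffffffffffffffffc0000,
  0x7ec0ffdc1f99fffd003fff8ffff807ffe007000067fc200f8003ffe3e7fc81fe000ffc0001ffff000003e000007e07ffe3fffe0007ffff07fffffff8f8000001ffffc000003fff8001fffff000fffffffff8007ff000000007ffffffc01ffe000000fffffffff807ffc03ff,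
  0,
  0,
  0,
  0,
  0x5333c688096113848040c9881c02a06012300866467deafd80f8f7d8ef1e15f5c14e9d73e57d7b97d75e7ec9f05d3dfdd74fe7f3d47ff3adb1ed04559c0c60c6847faac9f1337dddf165f713ce8ae0dfe7f1537eeb350bf33fcd1e9bbab5b5190596e2ce36daf5d4ca0cae7,
  0x4b2ea04b05681bdc9450edb25f47fcf81fb89e7efc18007908d85100ca387a26d9f992f7efe56b12545e5dfd0c5fb9008008659a804c8001fdabf7dfd22ef6e69d965f7f2d243157eb5fd5b3692da7c736b57b56c97f6f41dbeed956b215f7737f179affbd9aad4eefbfab6,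
  0x52334415fbf794a7efea811d7e789201427e79f7d830c80055bcfccb2c0e0480673a2512805209a1460806d263f954050077d8ed55197184b441eff5bfbff797b6fda0498000187fb5f77bc72e1828846f40102009313995234400990004a56b7dbe77e7fe7d73b5fb6ffcd,
  0x4aeeb57507e08081043ea5014640163bcbfe30101d3afd6b549679cf0e88daea820942b002faedff44cbcf18287bd0052b204488075de9d0ec08c300f2021201d6e4551c082df30081d34e887140900342043877d484a1580767c757f744e7010000f0298dc12b28212339c,
  0,
  0,
  0,
  0,
  0x7ffffffffffffffffffffffffffffffffffffffff800000000000000000000000000000000000000000000000000000000000000000000000000000000000000000000000000000000000000000000000000000000000000000000000000000000000000000000000000000,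
  0x7fffffffffffe00000000000000000000000000007ffffffffffffffff800000000000000000000000000000000007fffffffffffffffff80000000000000000000000000000000000000000000000000000000000000000000000000000000000000000000000000000000,
  0x7ffffffc00001fffffffffc00007ffffffff000007ffffff80000000007fffff8000007fffffffffffffe000000007ffff00000000000007fffc000000000000000000ffffffff800000000000fffffffffffffffffffffffffffffffffffe0000000000000000000000000,
  0x7f3f001fe01e1ffeffc000300007f8000008000087ffdff0fffc0003f87f7e007ff0007ffe000000003c0000018007fffcfff9fff8000007fff3ffff07fffffe000000ffffc0007ffe00000000ffffffffffff800ffffffff8000000001fffffffff000000000007ffffc00,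
  0x7dbcf83fde55fffbff3f007fe007c7f81f8fff80ff8310007803c003007279007e0fe27e01c000e000031ff00071c78018fe01fc07f800f7fe0ffff7e7ffff01ff803cff003f807f01ff000fe0ffffe00007fc7f0fffff8007fff0003f1fe1ffff00ffffff0007e7ffffbf8,
  0x71fed71249c5dc19e17d020c001407cc7b44f08447f3df867f03be021462e1e1600f1c7d41fffcfff1a39f89e06026fe77ef81e2ffff03ee020e006087e00001e00820f0c3bf87f905f1f81f94fff87c03c7807c8fe603fc37f1ec03fede019e0738ff0c07e3c78700203c0,
  0x2c25b8ad0e01e1101b23f3c02003007817b30c00278e3cffe0e3c3f18ff07f9e100fe240398080f809c77860181fdff9fa9e013d9ffeff35ff38185000107f031f8fcc1f3ffbff810269000ce70307600038601b0c1fff839f8ffbe3e339f8000600000fff00f8000c10b3f,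
  0x2163000329efdd17fbe0f27c3ff738c41760fc7ce082cc9067e086109c63e68171ff1fc5f981801819a418efff8e3e78969189239986042c010a18479ff07cfb00082f11ff80087bfe68f82dbc0f011c0407e3988c3e0c7fd18008e022f819fe1ef8030c38fcc79f0c30f07]

/-- The sets of ports of the path family for crossings at `{0, 1}`. -/
def groupsEdge : List PortGroup := [.pair 0 1 0x7e3b9783af801c64febafc167b65df551be0df78076c1fe076f623c0005c4fb87d8b94597630f4db81c01501480000fd00e1e1f30677e807e9c3df00039f70b18600001ca83aa07429e0e800000000000000000000000000000000000000000000000000000000000000000,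
  .quad false 0 1 3 14 0x400020002000000000000000000000000000000001400000000010000000018000038000000000000000000000000008000000000000000000000598000000000000000000000000000000000000000007fffff0000000000000003fe0000000000000000007f80000000 0x180000000400003000000400000000000000000000220000000000c000380000000000000000000000000000000000007000600000000f8000c00026000000000003f000000000000000000000000000000000000000000000000000000000000000000000000000000000 0x800000000000000000000000000000000000000000000000000010000000000000000000000000000000000000000000000000000000000000000000000000000000000000000000000000000000000000000000000,
  .quad false 0 1 4 15 0x4000001800400000001000082000000000000000000000000000000000000000000000000000000000000000200000002800000000300010000001000007000002c00481020000100700006003f800000000038038000003c0000000073f00000703f8000000000 0x1000000000000000000000000000000000000000000000000000000000000000000000000000000040000800000000000000000000000000000000000000000000000000000000000000000000000000000000000000000000000000000000000000 0x400000000000001000380000800004010008700000000000000000000000000000000000000000000000000000000400a00005000030002000068000002060008c0000100030004010000000000000000000000000000000000000000000000000000000000000000000,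
  .quad false 0 1 9 14 0x3800000000800000022000000000000000000000000000000400240080000080000000000080000000000000000000000000000000000000000406000805000000080000608d0c2d01bc00000000684807a040106000000019d80c0e00800c000000000000 0x400208482200080002000000000000000000000001000000440200000000400000a00b000000000000000000000000000000004400848000000000001400850000000000000000000000000000000000000000000000000000000000000000000000 0x100000000000000000000000000000000000000000000000000000000000000000000000000000000000000000000000000000000000000000000000000000000000000000000000000000000000000000000000000000000000000000000000,
  .quad false 0 1 5 11 0x10100000000002600000700801000000000000000000000000000000000000000000000000e0001280c01800400000000380c0041fe10fc00000060180003f0381c00000000000 0x684010000000000000000000008004000000008000190000c400000000000000000680c003001e0000c00600000000000800008004000000000000000000000000010004080200000020000000000000000000000000000000000000000000000000000000000000000 0x100000000000000000010000000000000000000000000000000000000000000000000000000000000000000000000000000000000000000000000000000000000,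
  .quad false 0 1 2 5 0x14001f6000000000000000000000080000200000000000000200000000000000000000000000018000000000000000000000000000000000000000000000000000000000000000000000000000000000000000000000000000001ffe000000000000000007fffffff 0x100004000000000000000000000000000000000000000000240000110000000000000000000000000000000000000000000000000000000000000000000000000000000000000000000000000000000000000000000000000000 0x8000080000000000000000000000600009800000080000001ff8000000000000000000000003c200000eff80000000000000000000000000000000000000000000000000000000000000000000000000000000000000000000000000000000000000000000000000,
  .quad false 0 1 8 15 0x100000000010000000000600300000000600200000000000000000000010040000100000002000002000003810002204001000001001c600312e0438000000094370058200e9000000000260001c07c02000000000000 0x1000000000000000000000000000000000000000000000000000000000000000000 0x609090820002020000000200008000800600000000000000200000008000800001400008000008400018000400000000000000000000000000000000000000000000000000000000000000000000000000000000]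

set_option maxRecDepth 100000 in
theorem hasThreeDirections_edge : HasThreeDirections 0x3 :=
  hasThreeDirections_of_check (cols := columnsEdge) (gs := groupsEdge) (F := 859)
    (S₀ := 2 ^ 859 - 1) (by decide +kernel) (by decide +kernel)

/-- The columns of the path family for crossings at `{0, 3}`. -/
def columnsDistanceTwo : List ℕ := [0x7ffffffffffffffffffffffff,
  0,
  0x1fffffff0000000000000000000007801f000007c000000180000000007f800000000000000ffff800000fffff800000,
  0,
  0x3c01e000c00ff9e0fffcffdf6180f1f47bf8194687c8c80c00c20a0c330079869d3e3844e05b33f6defa003e72c061f637bb,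
  0,
  0x3c80f9e2c8038843fca0f8086c8ff51407f51d6e99c3cfdf9ec99f7d321838defd38dbece6330184de2220063fcc68103d10,
  0,
  0x4f900aa60140108410044840b61335292c852c3ab86d7fffaf59febe4c28da4ab14b4b9debb7d5674e2efddff75dbfbbff7f,
  0,
  0x47118eb7afef57a824ddcd7ff60013797fb82f00a0ede002291d4c1a0ca477efb16f7a18fabd90676e78111062597fa3636a,
  0,
  0x4d7f62ee537d38a4136c1fc283b374a5af889913af5fd93d03c2ba847123da07810600850150270300b844aa0056818216bb,
  0,
  0x457fe0e20a210e2b24e99d2aceaf561587388101a9d381131b8c1d5130b736856124d2a81635af81203177a2285e48037ffa,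
  0,
  0x1fffffffffffffffffffff8000000000000000000000000,
  0xffe000000000ff800000007800c00000380000007e00000000007fff07ffffc00000000000000000007ff000,
  0,
  0,
  0xc00e1f9f00f0061f0f7f07e7827ffefb9f8a2299001700f0010071cfcdc3867f66c7ff9b00ac3c3f208403c18cff8207cbcf,
  0xc076078107307e3f331f3fe1827f0208841ea6bf7ff7f1307f05fcc0c4c582396affc7830124fc5b279c1c408c03847fccfc,
  0,
  0,
  0x906a71485a152801410333b809244006c13ad7e77fbf9735f7eeb3c5b3ffafbdcebcb4e737786a98bbfbce281ca3e8dc1cfd,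
  0x102c3158f8b4ea6202e810b2fdfdcef7dffa51c10212ba69d0e6bf01135204354e9435ff55482298b1c146abddf6c15ef397,
  0,
  0,
  0x928ad91e08d707c14d1763fd3f04f17a59bb26ee10ad06f4a548720f8008a8088609381c22a85834ca6a8b5c14a92a9df94d,
  0x12b48110adb64262329c78f1345d83785c97242e12e0e268fc458c3bd65cf8398a19791c4128d050c7481c5ed5000518e114,
  0,
  0,
  0x7fffffffffffffffffe0000000000000000000000000000000000000000000000,
  0xffffffffffff000000000000ffffffffff87ff0000003fffffff81ffffffffff800007fffff800000007ffffffffff800000,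
  0xffffe001ffffffe00003ffffff80000ff83fe7c07ff83800fffe060000ffff8000ff0003ffc7fff03ffffffff001fffff07f,
  0x20000000000000fc003f00000ff3f800600180380003003e00000f00078000003800001800f000000001f00000000387,
  0,
  0,
  0,
  0,
  0x20058411a4aac77aaef8840740c88ad01247fbddc7d2e8ca58b74d7bffd775f77ff7ff7adccfbffff5d533f7ebfe5767e382,
  0xa043c401060b0519ed13a70d4beefbdef3788204458005967fbf4040a085218000208662bef808000017bb742aab7ee50ce8,
  0x28840001f5fa80569a22fec700dbac8fbec500185f5248c8def38620405bd85200d3c903cdc20500158420c7810497008017,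
  0xa8c27fef575bbdd5d936220d0b822d82a045feffdd3f5d97063bf2e4ef098bdafffb8fe7afd24dffdfbea845bfafbefd9c85,
  0,
  0,
  0,
  0,
  0xfffffffffffffffffffffffffffffffffff80000000000000000000000000000000000000000000000000000000000000000,
  0xffffffffffffffffffffffff000000000007ffffffffc000000001fffffffffffffff8000007fffffff80000000000000000,
  0xfffffffe0000fffffffc0000fffffff00047f8ff80003fff000079ffff0000007f0007fc0007ffffc007fffffffe007fff80,
  0xffffc0000000001fff03ffc0007ff00c0007803e7fc007fcffc001fff0fff8000000c0000027ff000007fffe000000000c78,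
  0xfff03fe1ff00f81ff083f838fc7f0f0fe474442078203703fe3d85f00efc07f878f8c7e3ff37c0c83f07fc01ff01fc780c74,
  0x388187e38c087dfcce3c03e1c000c03006140f9f83f06c380387733083a044077c1f8381e87cfadf961e381013c1a09fb47,
  0x371067c370c71bcf3dc001011700be06040d837e62cf72f6037e8b2ff2441219b0024741958c24bc159dc38433215e806a0,
  0xff091e1df0ccf19ccf43c7d6f170f8ef7bea5bd0660c3eece1f2638e09e2456614c62453f8cf322e38c7c3b942f1f3e6026b]

/-- The sets of ports of the path family for crossings at `{0, 3}`. -/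
def groupsDistanceTwo : List PortGroup := [.quad true 0 1 2 3 0xcb404ce79000a1048278000019007c27f00db800000000000000000000000000000000000000000000fff 0x134b0230820064ef36807800146bf8010061247e00000000000000f8000038000000000000000000000000 0xf90104001100815800002a040004809e00000000000000000000000000000000000000000000000000,
  .quad true 0 3 13 14 0x330100001000000000004000000000000200000008000000008c088000fe00400040000420403c840000880000760000 0x3c0008800000c80000000000a000000000002940000010000000004007000600400000016003001a02000001228140000000 0xc0000400c00020000000000000000000000654800000200000000100004001003cbe0782800010a4000200005440a0000000,
  .quad true 0 3 4 7 0xc0004a120000a0000000000000000000000000000000000000001300004001800000080000020000590280001c0009f000 0x12f80342c0f04000000000012000000000180000000000000000000e0038000020100300180c1008020e03e010019800000 0x210400001f00340000000000d800000000000000000000000000020103c3800010000041e400c0141001d40002206000000]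

set_option maxRecDepth 100000 in
theorem hasThreeDirections_distanceTwo : HasThreeDirections 0x9 :=
  hasThreeDirections_of_check (cols := columnsDistanceTwo) (gs := groupsDistanceTwo) (F := 400)
    (S₀ := 2 ^ 400 - 1) (by decide +kernel) (by decide +kernel)

/-- The columns of the path family for crossings at `{0, 7}`. -/
def columnsDistanceThree : List ℕ := [0x3fffffffffffffffffffffffffffffff,
  0,
  0x7f3fefc01f83f0ff87f0007ff000ffff8fffffec09e09ff0001801e001fefffe1f80787e00383ffc001dfcffee03c3fe0ffff003e007e000fff,
  0,
  0x18f0fe24feffcf77fb9f1f981f3df01deffe40660fa6fe1f03c000c6036020091e6bbbfbe0c0fc30dffeefffffe3ddcfe7073f3fffff9e7ffffd,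
  0,
  0x3b060c030e68066003b1c800330031c0000500007a6080000c147c06118a00000000200100100001000080000801c06006500003fb0002009c0,
  0,
  0x1822003182000000af961092586040a37b49a8e0f0203ecfdefc97b892097fff7fef61b35d6def7fbafeac0cc1f4e7febac43eedfd0eea648ce,
  0,
  0x6fcfd8cb32fdf28d2c15f77a7eed807d40bbf400eb8059129807b06f7800dc349af92a0d488b6c20ca0c560c200298eb4f7041c40dc8edfec,
  0,
  0x8f2222e0a08da130bcd6fa8acddf46e78b3dce68b236a2e0ac259c68b21e6b304aeb0834442865040024a50df6144cae30f5f0ac2158606227c,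
  0,
  0x2a3660cbae82bad22dc2cce6e2f1e2425fd35db1332f2e279afb57c066919eb7cf8da8f6de7d2fde765e385573dff4aa9e75d4dffe35d58eb363,
  0,
  0x7ffffffffffffffffc0000000000000000000000000000000,
  0x3ffffffff07fffffffffffffc07fe00003ffff800ffffffffffffe0001ff87f801fff80003fffc00000000000000000fffffffffffffc,
  0,
  0,
  0x2f7f17ff0719f79bc7e7e3ffe0ce7fe6f0718780d04900601c1ebf280487c2700186e5a77fffb3ff28813ff03f7ce3f1dbfbffc7ce7fef8e37fe,
  0x100030d0879890c002000e04000e002838980305961fb040080001c004c0601f054850c3001c0281f5601c4200000001800d9c00c7192003f,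
  0,
  0,
  0x32118b6c424878b634040c22ca59b165480b7d73f9fffcbb6a507e86ffdfed9768b51bedde3f275b65775f3fffe5b5defd7ffd7b62bf7379f777,
  0x2620020003481e00556f0667fe40db27d87f6410009c04002ab63204208b6bf2afb80160cb6ba30d17f3d102120df08070428cf3b6273601b311,
  0,
  0,
  0x33119f65567965b6f6b7011b430e3105e77c03025dce94f97d5cae2a05c6815d7bf003293094303329a52fa02c048155c92021674efa6a2855c6,
  0x37adfff51d6f4ded5c3b37597766dbbd8205eb9f44dcf5d925a4a2613dea694ea373d779a9f0f9a59bbff7a3c4afdbc57ffeaff195ee30b3d99d,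
  0,
  0,
  0x1fffffffffffffffffffffffffffffff8000000000000000000000000000000000000000000000000,
  0x3ffffffc0000000007fffffffffffffff801ffffc0000000ffffffffffffffffe00780001fffffffc0000000001fffffffffff00000000000000,
  0x3803ff03fe003ff03f800007fffff0000f0e3fff3f1ff603fffe001fffe01007fe199818003c0c00007e200fff1fc03fff0000ffc0007ffff001,
  0x380c0f1c02000000018000780003f0001900001f40001604003e002000e011f8ee078878e3cc7c0fc78021f0031fc3c03f00ff0000038001f000,
  0,
  0,
  0,
  0,
  0xc6c5490a5978749c10292d410204a908041e7fdf6fdff5797bfb7fd76ff7a689f4bedf6ebe9f9ac9ed8b5ff33fafba116d3be95bd6f9ddfbfb9,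
  0x1851dc00e4902100a7969896db3920d1efca016030000013d759849e56541c0d584108841ebd7dfaec5c040d2012bd3f8411301d680859580423,
  0xdeb779231049769db293285bdfe5fbeb82eb6cc861143420486011df9287262b41ad41f612bdfed98fbc00a9f384a3773cb0a8081002ff72899,
  0x19d90f1e73fcf12f83bd38b8891b35fc39aa904efff35bfe445fcdbed97cf5f87cf65e8d778f544bed814ff88f300f5621097b086b9beb716cfe,
  0,
  0,
  0,
  0,
  0x3ffffffffffffffffffffffffffffffffffe00000000000000000000000000000000000000000000000000000000000000000000000000000000,
  0x3ffffffffffffffff8000000000000000001ffffffffffff00000000000000000007ffffe000000000003fffffe0000000000000000000000000,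
  0x3ffc0003ffffc000c7fffff800000003f7f1c0003fe007fcffffffe000001ff81fe660601fc070003f803ff0001fffc0000000ffffff80000002,
  0x3ffff1e3fc07c0f0fe00ff8000fc0003e601ffe1bf61e7fbffc07fc1ff001e071007f07f1c307ff0387e3e3ffdffffffdfff00ffc1fc01fe0003,
  0x378fe9dbf9e638ec3c78fc67fff38ffb1f8e381920100180e0214011f8181d86e0155e5c9f3f4fcff77fd00fc09f3e3e3cfcc0f8318071f1c803,
  0x270e01dbf3f7b6fef060c06700820f02157c3619ffff9fe4f83f7f39e09f93f0ff9c6f7ef30f020f37e1b9fe3bdc223018e0c0e63ff3efedffc2,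
  0x14cc883cc9ff480d005cff781c018cf90081e87fe8f0f99ce321f8f79a7f6d8800677fc08fc2c000c700d7ffc0e33fc8249eff3831cf9051ce3c,
  0x4429020c0110610f244c3071c8c0c03e47c266088008000fb00381f8207020110082102000282300060800e38402039c082002600400e4c0600]

/-- The sets of ports of the path family for crossings at `{0, 7}`. -/
def groupsDistanceThree : List PortGroup := [.pair 0 7 0x3ff3fe03fff83f0007ff0007ff0000000001fffe3f9e0000ffff801e000000000007ff801fff800000003fcffe1ffc3fe00000fffe007e000000,
  .quad true 0 2 7 9 0x801600000400000000c200041001000000000006110000000204014802000000000000000000000000000000001801b000000004001000ffc 0x800003800f0000825000000300000000010000e80000005f80887d80000000000000000000000000000000024004ff0000009380cdf000 0x4001c000400f00000718800befcec00000000c0000000000000216302400000000000000000000000003001e000000000ff00012c00320000,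
  .quad false 0 1 6 7 0x480000000000000008100000000003040000000000001089e0000001000000001801c0000000000000000000000000000003 0x200000000000000001000000000004e00000000000000f761f80007c00004dc007fe00000000000000000000000000000000 0x9000000000000003f6ee00000000001b000000000000000000780002e000323fe00000000000000000000000000000000000]

set_option maxRecDepth 100000 in
theorem hasThreeDirections_distanceThree : HasThreeDirections 0x81 :=
  hasThreeDirections_of_check (cols := columnsDistanceThree) (gs := groupsDistanceThree) (F := 462)
    (S₀ := 2 ^ 462 - 1) (by decide +kernel) (by decide +kernel)

/-- The columns of the path family for crossings at `{0, 15}`. -/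
def columnsAntipodes : List ℕ := [0xfffffffffffffffffffffff,
  0,
  0x7ffe0ff0ff0fbfc0e3fe0fbfe03ff87fe1f0007fff8000000fff000ff8000001ffe001ffc00000700ffffff807fffff00fffff,
  0,
  0x18010638779900f7fe930f097631c08a204717b07919ee3f1f2f378f3f8c90c3e3227ce17cfffdffe73573b9b60b928c6b1858f,
  0,
  0x5e5516fe6c0bf3f18c73040bf131f88fb05710067adb9c200c3c7608764fa3cc7bef4c277fce7886043b6500086e1c006239d03,
  0,
  0x4254114bbd0989b8b44154409b4c4835f3ffd8d2824cbc0825005cbbf2df253ce96dbf7f3fdeff9f0d0ac142db86bcf7e946e77,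
  0,
  0x14a14b9371887cee8fff78de0efd803e6d0eb3e779625935bffc2af2d40428cd6ca634a80a91b70000f2f6d201b0fe89cc36f,
  0,
  0x3bffd2bb1589689830df66d136f7ca946207d1f9bdccbe0e4f4f5185199cb173a776114b14508c090f4fd34bb606b69d084249c,
  0,
  0x38149282d0636659e8ce2617f4b6b8dc3e65002924c312404c1c4f6c5054a3680445c726834a98a01e4bf6467e6434189ee9109,
  0,
  0xffffffffffffffffffffffffffffffffffffffffffff00000000000000000000000,
  0x1fff000ff803fe001ff801ffff8001ff00000007fffffffff000007ffffffffe000003ffffff0000000000000000ffffffe,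
  0,
  0,
  0x3eea8018be06f08130c20b200c60014c6a8e83fb5e5f3c460cfcbf7cbf0df221c3dbf1f8f33863938c6823e47f1e30f8cdfa0c,
  0x25c2bbcf9df06f0bfa0412f7fec207745fff2009802671dee3d3c9f7d9b00030045c831e8371be7b1bcf9e468094643095e7afd,
  0,
  0,
  0x2c83429400a4300600562097ee9013eb4d02634d1df205e7db75f35d3d81aadfb6d743efd5757e68db4f1d4f242e4f1116211b1,
  0x2940b442e676ff7f38a09f25f7bfdfefbf010405800301caef03440d20fbc7379351cbd7ffcfed605000192479c3095efb798,
  0,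
  0,
  0x4ec72f5dabadb92697573dbacbdc51abc5ea6a161171e5e53125f21b22c18e8ef82d2e250d377638f906013e47abcb07ef1db27,
  0x4441214c00000020013190080140050000003f96c3386119a3a30002002000846108000000000000611000108099c0204100200,
  0,
  0,
  0x1ffffffffffffffffff0000000000000000000000000000000000000000000000000000000000000000000,
  0x7fffe000000ffffc01ffe00001fffffffe00fffffff8000000000000007ffffffffffffffc000000000000007fffffff0000000,
  0x7800ff07f0ff1c0ff7c7ff7cfffc3ff81fe10ff8000000ffff00007f0000003fe00003e000007ff8ff003fffff807fffff003ff,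
  0x783f6100f377047c71c8e1040e0c0079ee20fff807f80301ff000fff07807fcfe001ffe0fc0f83f8ff00c0ffff8181ff1f00000,
  0,
  0,
  0,
  0,
  0x11082c20425246414ba88b2f7423a45ebefd34286abb5b12fe9aafe6cf225fc1409afc90eaab81f736b1eeb589d1006a37bfc4a,
  0x3d82ae00001fff47ca860b2040bbf7ea1c402629783340f61010a000007fdefbdefeeeb4e821307292a53ea47fff7ffeb7bd9ef,
  0x5368fc276cda5f891721c06831612e1492919dfefa8c98beeeca00f7cf2a51377bba19db7e806fdf24b02fb989d07fef6012ede,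
  0x2200002d100100100041e00a094221c0128000100480a400400091078850021a2008007c05225a80a400a8000001840010884,
  0,
  0,
  0,
  0,
  0x7ffffffffffffffffe0000000000000000000000000000000000000000000000000000000000000000000000000000000000000,
  0x7ffffffffff0000001fffffffe0000000000ffffffffffffffffffffff8000000000000000000000ffffffff800000000000000,
  0x7fff1ff8ff0fe7f3f9f81f8701ffc07fe1fef0000007ff0000000f80007fffc00001fc0003ff8000ffffc0007fff8000ffffc00,
  0x7fc09e00fc88078381f71e07f1f0007e11c0fffff807fcfe00000ffff87f80300001ffff03f07c00ffff3f007ffe7e00e000001,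
  0x6430d1c6fc7697ffec20d04489083f6119108fc7c60600f980f00c78f47f603c1fc1c3fef3cc7bc6c0f83cc0787c7df0d0e03f1,
  0x423c5df7ea6690000568fdfe890c380181b8c84606c79fe1fcfcfe78e6436f0c18810000038e4384fcfaedff49600943fefff72,
  0x25bb41f8171480f668b8dbc50e0bc763691ef7c1cf3e6f1b93f3bd80bdbf7cd187d2f0d8f0fd8147c3fdd8c1b01f80f011e64f0,
  0x3884c31028c988606000800000000020188404008000c021000b000a8030c11809230d900b045050000090101020a432006472]

/-- The sets of ports of the path family for crossings at `{0, 15}`. -/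
def groupsAntipodes : List PortGroup := [.quad true 0 7 8 15 0x23e00101098000000c824505822400020000001810020420000000000000609410202218600c088810c 0x2080000000000001b5d81000a4a400000081310000208800a500000064c020080000000000000080602290542112804050280 0xa0408005a520000000204b00040510048000000000000130000000000000000000008004081008000000,
  .quad true 0 4 11 15 0x10520a270006300000400000000000000000604800c20100e400200000000890600e0000000000000c004104090208400122820 0xe8830d80000c8000000000000000000000010000a18040218005000000124498080000000000000100b8443008004233404050 0x6105450000090000000000000000000000000000002018000310800000020304005000000000000003000800800400100201402,
  .quad true 0 1 13 15 0xbd200260400000002000000e27c90000000000000000003eb80000000000d480cd5100ff00000000000000000000001 0x42c00104860000020a000020580200000000000000000900078000000000093d0008a90000000000000000000000000 0x10049b38000005d40000518034000000000000000006c1400000000001224232a6560000000000000000000000000]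

set_option maxRecDepth 100000 in
theorem hasThreeDirections_antipodes : HasThreeDirections 0x8001 :=
  hasThreeDirections_of_check (cols := columnsAntipodes) (gs := groupsAntipodes) (F := 411)
    (S₀ := 2 ^ 411 - 1) (by decide +kernel) (by decide +kernel)

/-- The columns of the path family for crossings at `{0, 1, 2}`. -/
def columnsCherry : List ℕ := [0xfffffffffffff,
  0,
  0x7fe00c000000000003ffc00000000078000000000000000000001ff,
  0,
  0x1dd8df83bdfc23fc180f137c08c01011c1c9807dfbfe903f731f0fbff3e19,
  0,
  0x67d08c67bccce8535fbf0303cde193d9f7d7e647f398bffe721603b98013a,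
  0,
  0xa810a02c27426447ebb607b2ccefffdefaa2e6ceb08bfefbe77f7fdabfbea,
  0,
  0x1989aff2c216c55fc800016fb6dc57c0c8023eb2cefef283f005b2ed22beac,
  0,
  0xac49829fe7de22a4289677f69eca9077cac830dc3017d249a1281502f0941,
  0,
  0x1e6cb8e0400ccd8b0049076c30501906d8657230467152b4cb8fab7f3e8d24,
  0,
  0x7ffffffffff0000000000000,
  0x3fffc00000000000003fffffff80000000fff0000000000000,
  0,
  0,
  0x1fe2f63fdcfdffd8ce0706083b33fa0260e001fbe7c7f6fc99deff0407c7ef,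
  0x2efe19c02021c3c27f12d8db75864e63e0679820c0701c08fe13047fd8e0,
  0,
  0,
  0x34514d3d01482b135cbffdfffd251e35fff3ff35f75f7ddf9a0d5fff4d77,
  0x40211ad2dfbdfbbc0008c044133e8177ffdd18100534574438fec02dde557,
  0,
  0,
  0x1b1475e19d54e5ddf16b039be9f771825fa38e2258682499510740d83462a,
  0x58b4f9febf20651ffb29810df97c65d6f0004ffe8dae15f672576a8d9f0fa,
  0,
  0,
  0x3fffffffffffffffffffff800000000000000000000000,
  0x1ffc000000000000003ffc00000000000001f0000000000000000,
  0x7ff80003007fc0000fffc00007c00007f8000000000000000ffffffe00,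
  0x1fc3c3f8063f1e383f800f0fc78078c0fc03807fc07fe7007f0ffff800fe07,
  0,
  0,
  0,
  0,
  0x154aa4b0008a9190ade7df86d333dae3da55dd93deffe09261edfaa254b69d,
  0x117ce450118ff9ff81441380920117ea9057ff9214a41a9bfdf81bff761ebd,
  0x6427ebffeebb2f4e4a34e9249228ae10205cd4dfb09adfe20604fb2ddf3db,
  0x277c258162d3aa437ff729bcfec38e8b7fbef4c312daf083c7a5110005a03,
  0,
  0,
  0,
  0,
  0x1fffffffffffffffc000000000000000000000000000000000000000000000,
  0x1ffffffffe0000003ffffffffffc00000000007fffffe00000000000000000,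
  0x1fff800001fc3f803ffff0000003f83ffff80000000000000ffff000000000,
  0x1ffc7c07f9c020403ffffff03803873f0004007fff8018ff8ff00fffff01f8,
  0x1e3f7bc7e7223de7307808c0044004fc8303667c38781fff6eef0ffff8f9f6,
  0x1e3333e604001d843c7fecef247a78b083fb78603f7f86e000cfec0780e706,
  0x199f8101a73231223bfcf9c7c7ede4ffff9a879f98fe7d037eff90c06038d5,
  0x19903527bdd3f17ec804ede7202be7b3009e99839f861ce390d08cc7e727dd]

/-- The sets of ports of the path family for crossings at `{0, 1, 2}`. -/
def groupsCherry : List PortGroup := [.quad true 0 1 2 3 0x98bd80002c00000214006007e2180000000000000000000fff007fffe00 0x36302001bc0187c04490f90001c64003f878003fffff0000000000000000 0x40000410000001a2000c0001800000000000000000000000000000000,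
  .quad true 0 1 2 5 0xec00002d2000018280000000300000000000000000000000f000ff80001ff 0x1000400000003e2000000e00040000006002007fc00000fff0000000000000 0x10000052c000040178001003880003f9c0587800000000000000000000000]

set_option maxRecDepth 100000 in
theorem hasThreeDirections_cherry : HasThreeDirections 0x7 :=
  hasThreeDirections_of_check (cols := columnsCherry) (gs := groupsCherry) (F := 245)
    (S₀ := 2 ^ 245 - 1) (by decide +kernel) (by decide +kernel)

/-- The columns of the path family for crossings at `{0, 1, 7}`. -/
def columnsBent : List ℕ := [0xfffffffffff,
  0,
  0x1fffffdf8fc3ffffe3fc07c0007ffe007fc01003ffffffff,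
  0,
  0xffe272f3dffbdc0e1be4047987df86decf81df337c7c3fbf3f,
  0,
  0x12001c200b7e9812e83b848e1418c33fbf1020f03e1c00,
  0,
  0x2848904428fc1935cd38fb6fe5773a3df7dbafbfb5b7d6afe9,
  0,
  0xa261b2efd5dfc8014fa0ba0d6135577e15414ab00002528bae,
  0,
  0x78ced8506bad549efb6414628041aae546998023001505a521,
  0,
  0xf2e59a0875256edafa16baba38add561573d3aefead37fdda6,
  0,
  0x3ffffffffffffff00000000000,
  0x7fc000000003ffc000000000003ff00000000000,
  0,
  0,
  0x1bdffd3cfb8cc0f06409c0863be1fbe730fe60ef8f8fcfc3c3,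
  0x4040c0000240020e0000018600822100000409c00c18004,
  0,
  0,
  0x44860f9b070137dfb2f715f09eaaffeb6fbff545fadd2975f7,
  0x5a149197fb7c2ca005f4cd28a0081c168aed4e64a49ffd45f,
  0,
  0,
  0xfc237bf9fd8997504b9c1fd87a2120a21826505bc8c0a03c3,
  0xad2147fd1cf28b6d0df86841af761fdaf9eadf961c68d29e4c,
  0,
  0,
  0x3fffffffffffc0000000000000000000000000,
  0x3f800000001ffc0000000001ffffc0000000000000,
  0xffe00fffe7f7fc01fffc3ff8403f80003f8003effc00007fff,
  0xf821c1f00000000007001000200081c00000008f00030000e0,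
  0,
  0,
  0,
  0,
  0x93316020d002eeea7fcfee9f7bddc5d698645afa4f6affda1e,
  0xd21626a2974be4003287b7bd508844029f757b59fffe297bb6,
  0x19184d74eaa6c020fd486c02405fa894bafe83fa0520847e59,
  0x581ef5f68a083536b7e3d53fd4caa8be8217a559b5b7ad20f1,
  0,
  0,
  0,
  0,
  0xffffffffffffc0000000000000000000000000000000000000,
  0xffffffffc0003fffffe000003ffffffe000000000000000000,
  0xfffff00038783ffe001fc3ffbfc00001c0003c0fffffff8000,
  0xffde0e0020603ffdf81c23e03fff7e01fff83b0ffffc007f00,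
  0xe43d8fcf2477230180123b007c3e7d39ff7fbfdcf3f3f07cfc,
  0x7f9b90fe0143bf3c41bcb9e7fbff13d200624ece383fe40db,
  0xe43fe0c3005b378f03e71745ff506fffcc41dc10537ff1a03c,
  0x7da2803e3dfd081400d07c4431162052cc04020430c00631b]

/-- The sets of ports of the path family for crossings at `{0, 1, 7}`. -/
def groupsBent : List PortGroup := [.quad true 0 1 3 7 0x60300d0400180000140c000401800008800000fc00ff801f 0x78002002000b00001190003f7007c0000000000000 0x78000028390040000e0c0180a6e0000870004600000000000,
  .quad true 0 1 5 7 0x380cc4f0002002012000000000001a000000081f03ff007fe0 0x80010000000b000c9b000365c0000400000030800000000000 0x40120b000044c1f044003082200061c0007803000000000000]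

set_option maxRecDepth 100000 in
theorem hasThreeDirections_bent : HasThreeDirections 0x83 :=
  hasThreeDirections_of_check (cols := columnsBent) (gs := groupsBent) (F := 200)
    (S₀ := 2 ^ 200 - 1) (by decide +kernel) (by decide +kernel)

/-- The columns of the path family for crossings at `{0, 1, 14}`. -/
def columnsCrossing : List ℕ := [0xfffffff,
  0,
  0x3fff9ffe01f1fffff83ffff0007ffc01ffe0000fff00000ff00fffff,
  0,
  0xfff7e306fe6e247c3846203067871fde77e03e721f3f6ff7fff23fbd,
  0,
  0xb9f05b0080c925f8022738084677fa01e5103e6f1ff408078c0a3c18,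
  0,
  0x341108a88b36b0a92c6effe9fffff6faae81ffeefee4debc31defd6e8,
  0,
  0x141d3805eb3700bdbf0005790b4cd6f9affe8086dbf01ab5ab0811669,
  0,
  0x2063cabae972a6abe7c6faa7143131daa734166b66a0c61e1506243a4,
  0,
  0x49000498901000001004002005508402402a0010002c27200,
  0,
  0x3fffffffffffffffffff0000000,
  0x1fff000000000000ffffffc000000000000fffffff0000000,
  0,
  0,
  0xf06f83dfb07b0d8004038c240801801e3bbffcf9de1dfb078f03dcfc7,
  0xf0e0d8479f7b3fb8ff8b8464ff8f9fcefd861c18c20e8f1b970dfc1fe,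
  0,
  0,
  0xba2c05344c04f7ef7ddb3ffb4b30b87ddfe363b67bf2f5bde77a69f7,
  0x492687fff4d9454211d75a9694b33d40107c66712d1ff1efffb31ff97,
  0,
  0,
  0x1fbf005106e64944040da769aefbc284088a20a000153a010a5380cc1,
  0x5db41c6586007140198f4640868a146cfcce6ff4a95690a9339919498,
  0,
  0,
  0xffffffffffffffffffc00000000000000000000000000,
  0x7ffe0000000007fffff000000000001fffffff00000000000000,
  0xfc00fe07ffe1e03ffffc01fffff80fc3e000001f00000fff00ff0007f,
  0xfc1f3e0fe0e0e1c03ffc1e1f01f8003fe0ffffff1ff071ff00ff1ff83,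
  0,
  0,
  0,
  0,
  0xc04c37043009ffd7dbb34c164b4cfd7d737fc9d5995bf1e7efa95bf1f,
  0x82c877577fef0a14c239a57f6b4ccb854103999fd3fb2f53ce6de297f,
  0xe040ffaeb009b00348a2488640002d427201495dbc40c5ee75804801e,
  0xa2db780a00eebbc06ea8be0f61ffeb864083190816e0655a5444ee982,
  0,
  0,
  0,
  0,
  0xffffffffffff000000000000000000000000000000000000000000000,
  0xfffff8000000ffffff8000000000003ffffe000000000000000000000,
  0xffff07f81ffeffc0007ffe00fffff03c0001ffe0000ff00000fffff80,
  0xffe0c7f01f00fe3fc07fe1e0fe00003fff01ffffe00f8e0000ffe007c,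
  0xff90fdefdf9d1038387811d8f1860e23dcc1ff1effee0df8f0fcff07a,
  0xff1fa188109dddff3c701998f9f7ee331af9e0001c0d79e4e8f2dfe43,
  0x10022023401010010010198024120003800000800010120,
  0x760e3f877974c274055e9fb7a10e0510328e0012c01be64ef3240265]

/-- The sets of ports of the path family for crossings at `{0, 1, 14}`. -/
def groupsCrossing : List PortGroup := [.quad true 0 1 14 15 0x380104040851801d806210940d000180181000a3521c008388c390d7f 0xc00e8092b02002022700012080611e09a205125c81814904000000000 0x3010008002000000000000000120020000000000200000000000,
  .quad true 0 1 6 14 0x5f028404000704018046203400800000580240008000000773c6f280 0x200100004800d8040918c000004a020404a000000620478000000000 0x40280306000000080048329240440000c9002400b000000000000]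

set_option maxRecDepth 100000 in
theorem hasThreeDirections_crossing : HasThreeDirections 0x4003 :=
  hasThreeDirections_of_check (cols := columnsCrossing) (gs := groupsCrossing) (F := 228)
    (S₀ := 2 ^ 228 - 1) (by decide +kernel) (by decide +kernel)

/-- The columns of the path family for crossings at `{0, 7, 11}`. -/
def columnsFork : List ℕ := [0x1ffffffffff,
  0,
  0x1ff07fe07f3ff03e0ffff80078000fffffffc03f,
  0,
  0x19dbbef79e0238ee11073bfffe1937be6f01f7d7,
  0,
  0x13c03e875e2810a4152769646088378049008204,
  0,
  0x16040a03e7ad517fef7ef3b7afaa7e846bd7ffad,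
  0,
  0x6102bc20505e07e842e9a8d3c000e046805c10c,
  0,
  0x1cef0631e69a785e6b52b093ba30569223431083,
  0,
  0x26ef279f44d8eed4f4228ccd30f4d7d3f96f9bce,
  0,
  0x1fffffffffe0000000000,
  0xfffffff000ffffffe07fffffffe0000003fff,
  0,
  0,
  0x2efdc738e3b0c3102e08de91bffecbf397fe787b,
  0x202ec1682000cf53221004029860c859b04e29bb,
  0,
  0,
  0x86a11e808dbbe9d5bf3ec7bd8f7f7ffb6ff94d7,
  0x803541df85204807bd0000003d7c072973a1e53,
  0,
  0,
  0xa589bea8ba193bd1f2e4a318c8a23a40694f455,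
  0x3b12d84fb867d5e333157b268fcbe87cff1eef11,
  0,
  0,
  0xfffffffffe00000000000000000000,
  0x3ff0001ffffff001fffff80007fffe001fffc000,
  0x203f81ff81cfffdff0fe007f8007f00fe0ffffcf,
  0x810001000c60000800002000607000600201000,
  0,
  0,
  0,
  0,
  0x2191e4141076efe2b48d1fcc775d897bdd286b7a,
  0x21f8a1fe1f00aa0194af0c48547dbf091cede1fe,
  0x31b5c435f32e510220dd7176e30ff80bc1fa6a2b,
  0x1c480200200130000006102c0283001000000a0,
  0,
  0,
  0,
  0,
  0x3fffffffff000000000000000000000000000000,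
  0x3fffffe000fffffe0001fffff80001ffe0000000,
  0x3fcffe1ffef00fe1ff00078007f801f01f003ff0,
  0x3028000000a80801000104700000018800c02000,
  0x372679cf7d4d0401c0f1e56e41e7fc4df8ff8fac,
  0x6057f8041fd07bccce8c7fd618601e7c0b01e6c,
  0x1d0278403c572c6bcbd1b78a5f710c7c3e0105b0,
  0x40100008111200848c890990110002006914440]

/-- The sets of ports of the path family for crossings at `{0, 7, 11}`. -/
def groupsFork : List PortGroup := [.quad true 0 7 11 15 0x80804201a2008028406006062010b000040103f 0x107bd06502001809c902101c02048600a02000 0x10200000008c0025023004000004000800000000,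
  .quad true 0 3 7 11 0x4400060001c1005000f8020000000004004fc0 0x26838000001004c00000010d800030011b1e0000 0x1000009804032002000008001f8c070e0018000]

set_option maxRecDepth 100000 in
theorem hasThreeDirections_fork : HasThreeDirections 0x881 :=
  hasThreeDirections_of_check (cols := columnsFork) (gs := groupsFork) (F := 158)
    (S₀ := 2 ^ 158 - 1) (by decide +kernel) (by decide +kernel)

/-! ### From path systems of codes to tours of a graph -/

section Transfer

variable {V : Type*} {G : SimpleGraph V} {s : Set V} {R : V → V → Prop} {d : ℕ}

theorem IsPathSystem.isChain_map {ends : List (ℕ × ℕ)} {ps : List (List ℕ)}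
    (h : IsPathSystem d ends ps) {f : ℕ → V}
    (hf : ∀ v < 2 ^ d, ∀ j < d, G.Adj (f v) (f (flipBit v j))) {p : List ℕ} (hp : p ∈ ps) :
    (p.map f).IsChain G.Adj := by
  rw [List.isChain_map]
  have hlt : ∀ v ∈ p, v < 2 ^ d := fun v hv => (h.mem v).1 (List.mem_flatten.2 ⟨p, hp, hv⟩)
  refine (List.IsChain.imp_of_mem_imp ?_ (h.chain p hp))
  rintro v w hv - ⟨j, hj, rfl⟩
  exact hf v (hlt v hv) j hj

theorem exists_isSpanningPath_of_linkable {f : ℕ → V} {E : ℕ → ℕ → Prop} {a b : ℕ}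
    (hinj : ∀ v < 2 ^ d, ∀ w < 2 ^ d, f v = f w → v = w)
    (hf : ∀ v < 2 ^ d, ∀ j < d, G.Adj (f v) (f (flipBit v j)))
    (hs : ∀ x, x ∈ s ↔ ∃ v < 2 ^ d, f v = x)
    (hR : ∀ x ∈ s, ∀ y ∈ s, R x y → ∃ v < 2 ^ d, ∃ j < d, E v j ∧ f v = x ∧ f (flipBit v j) = y)
    (h : Linkable d [(a, b)] E) : ∃ l, IsSpanningPath G s R l (f a) (f b) := by
  obtain ⟨ps, hps, hE⟩ := h
  obtain ⟨p, ps', hp, hps', rfl⟩ := List.forall₂_cons_left_iff.1 hps.ends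
  rw [List.forall₂_nil_left_iff] at hps'
  subst hps'
  have hn := hps.nodup
  have hm := hps.mem
  simp only [List.flatten_cons, List.flatten_nil, List.append_nil] at hn hm
  refine ⟨p.map f, by simp [hp.1], by simp [hp.2], hps.isChain_map hf (by simp), ?_, fun x => ?_,
    fun x hx y hy hxy => ?_⟩
  · exact hn.map_on fun v hv w hw => hinj v ((hm v).1 hv) w ((hm w).1 hw)
  · rw [hs, List.mem_map]
    simp only [hm]
  · obtain ⟨v, hv, j, hj, hvj, rfl, rfl⟩ := hR x hx y hy hxy
    obtain ⟨q, hq, h⟩ := hE v hv j hj hvj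
    rw [List.mem_singleton.1 hq] at h
    exact h.map f

theorem CyclicallyConsecutive.of_infix {l l' : List V} {x y : V} (h : Consecutive l x y)
    (hl : l <:+: l') : CyclicallyConsecutive l' x y :=
  .inl (h.mono hl)

/-- If `f` and `f'` describe the two halves of a cube, then closable sets of edges lie on a common
tour through both halves. -/
theorem exists_isSpanningTour_of_closable {f f' : ℕ → V} {U : ℕ → Prop} {E E' : ℕ → ℕ → Prop}
    (hinj : ∀ v < 2 ^ d, ∀ w < 2 ^ d, f v = f w → v = w)
    (hinj' : ∀ v < 2 ^ d, ∀ w < 2 ^ d, f' v = f' w → v = w)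
    (hdisj : ∀ v < 2 ^ d, ∀ w < 2 ^ d, f v ≠ f' w)
    (hf : ∀ v < 2 ^ d, ∀ j < d, G.Adj (f v) (f (flipBit v j)))
    (hf' : ∀ v < 2 ^ d, ∀ j < d, G.Adj (f' v) (f' (flipBit v j)))
    (hcross : ∀ v < 2 ^ d, G.Adj (f v) (f' v))
    (hs : ∀ x, x ∈ s ↔ (∃ v < 2 ^ d, f v = x) ∨ ∃ v < 2 ^ d, f' v = x)
    (hR : ∀ x ∈ s, ∀ y ∈ s, R x y →
      (∃ v < 2 ^ d, ∃ j < d, E v j ∧ f v = x ∧ f (flipBit v j) = y) ∨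
      (∃ v < 2 ^ d, ∃ j < d, E' v j ∧ f' v = x ∧ f' (flipBit v j) = y) ∨
      ∃ v < 2 ^ d, U v ∧ ((f v = x ∧ f' v = y) ∨ (f' v = x ∧ f v = y)))
    (h : Closable d U E E') : ∃ l, IsSpanningTour G s R l := by
  rcases h with ⟨a, b, hU, ⟨ps, hps, hE⟩, h'⟩ | ⟨a, b, c, e, hU, ⟨ps, hps, hE⟩, ⟨qs, hqs, hE'⟩⟩
  · obtain ⟨qs, hqs, hE'⟩ := h'.reverse
    obtain ⟨p, ps', hp, hps', rfl⟩ := List.forall₂_cons_left_iff.1 hps.ends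
    obtain ⟨q, qs', hq, hqs', rfl⟩ := List.forall₂_cons_left_iff.1 hqs.ends
    rw [List.forall₂_nil_left_iff] at hps' hqs'
    subst hps' hqs'
    have hn := hps.nodup
    have hm := hps.mem
    have hn' := hqs.nodup
    have hm' := hqs.mem
    simp only [List.flatten_cons, List.flatten_nil, List.append_nil] at hn hm hn' hm'
    have ha : a < 2 ^ d := (hm a).1 (List.mem_of_head? hp.1)
    have hb : b < 2 ^ d := (hm b).1 (List.mem_of_getLast? hp.2)
    have hp₁ : (p.map f).head? = some (f a) := by simp [hp.1]
    have hp₂ : (p.map f).getLast? = some (f b) := by simp [hp.2]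
    have hq₁ : (q.map f').head? = some (f' b) := by simp [hq.1]
    have hq₂ : (q.map f').getLast? = some (f' a) := by simp [hq.2]
    refine ⟨p.map f ++ q.map f', ?_, ?_, ?_, fun x => ?_, fun x hx y hy hxy => ?_⟩
    · refine List.isChain_append.2 ⟨hps.isChain_map hf (by simp), hqs.isChain_map hf' (by simp), ?_⟩
      rw [hp₂, hq₁]
      rintro _ ⟨⟩ _ ⟨⟩
      exact hcross b hb
    · rw [List.getLast?_append, List.head?_append, hp₁, hq₂]
      rintro _ ⟨⟩ _ ⟨⟩
      exact (hcross a ha).symm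
    · refine List.nodup_append.2
        ⟨hn.map_on fun v hv w hw => hinj v ((hm v).1 hv) w ((hm w).1 hw),
          hn'.map_on fun v hv w hw => hinj' v ((hm' v).1 hv) w ((hm' w).1 hw), ?_⟩
      intro x hx y hy
      obtain ⟨v, hv, rfl⟩ := List.mem_map.1 hx
      obtain ⟨w, hw, rfl⟩ := List.mem_map.1 hy
      exact hdisj v ((hm v).1 hv) w ((hm' w).1 hw)
    · rw [hs, List.mem_append, List.mem_map, List.mem_map]
      simp only [hm, hm']
    · have across : ∀ v < 2 ^ d, U v → CyclicallyConsecutive (p.map f ++ q.map f') (f v) (f' v) := by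
        intro v hv hu
        rcases hU v hv hu with rfl | rfl
        · exact .inr (.inl ⟨by rw [List.head?_append, hp₁]; rfl,
            by rw [List.getLast?_append, hq₂]; rfl⟩)
        · exact .inl (consecutive_append_boundary hp₂ hq₁)
      rcases hR x hx y hy hxy with ⟨v, hv, j, hj, hvj, rfl, rfl⟩ | ⟨v, hv, j, hj, hvj, rfl, rfl⟩ |
        ⟨v, hv, hu, ⟨rfl, rfl⟩ | ⟨rfl, rfl⟩⟩
      · obtain ⟨t, ht, h⟩ := hE v hv j hj hvj
        rw [List.mem_singleton.1 ht] at h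
        exact .of_infix (h.map f) List.infix_append_left
      · obtain ⟨t, ht, h⟩ := hE' v hv j hj hvj
        rw [List.mem_singleton.1 ht] at h
        exact .of_infix (h.map f') List.infix_append_right
      · exact across v hv hu
      · exact (across v hv hu).symm
  · obtain ⟨p₁, ps', hp₁, hps', rfl⟩ := List.forall₂_cons_left_iff.1 hps.ends
    obtain ⟨p₂, ps'', hp₂, hps'', rfl⟩ := List.forall₂_cons_left_iff.1 hps'
    obtain ⟨q₁, qs', hq₁, hqs', rfl⟩ := List.forall₂_cons_left_iff.1 hqs.ends
    obtain ⟨q₂, qs'', hq₂, hqs'', rfl⟩ := List.forall₂_cons_left_iff.1 hqs'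
    rw [List.forall₂_nil_left_iff] at hps'' hqs''
    subst hps'' hqs''
    have hn := hps.nodup
    have hm := hps.mem
    have hn' := hqs.nodup
    have hm' := hqs.mem
    simp only [List.flatten_cons, List.flatten_nil, List.append_nil, List.mem_append]
      at hn hm hn' hm'
    have ha : a < 2 ^ d := (hm a).1 (.inl (List.mem_of_head? hp₁.1))
    have hb : b < 2 ^ d := (hm b).1 (.inl (List.mem_of_getLast? hp₁.2))
    have hc : c < 2 ^ d := (hm c).1 (.inr (List.mem_of_head? hp₂.1))
    have he : e < 2 ^ d := (hm e).1 (.inr (List.mem_of_getLast? hp₂.2))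
    have h₁ : (p₁.map f).head? = some (f a) := by simp [hp₁.1]
    have h₁' : (p₁.map f).getLast? = some (f b) := by simp [hp₁.2]
    have h₂ : (q₁.map f').head? = some (f' b) := by simp [hq₁.1]
    have h₂' : (q₁.map f').getLast? = some (f' c) := by simp [hq₁.2]
    have h₃ : (p₂.map f).head? = some (f c) := by simp [hp₂.1]
    have h₃' : (p₂.map f).getLast? = some (f e) := by simp [hp₂.2]
    have h₄ : (q₂.map f').head? = some (f' e) := by simp [hq₂.1]
    have h₄' : (q₂.map f').getLast? = some (f' a) := by simp [hq₂.2]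
    have hperm : List.Perm (p₁.map f ++ (q₁.map f' ++ (p₂.map f ++ q₂.map f')))
        ((p₁ ++ p₂).map f ++ (q₁ ++ q₂).map f') := by
      rw [List.map_append, List.map_append, List.append_assoc]
      exact (List.perm_append_comm_assoc _ _ _).append_left _
    refine ⟨p₁.map f ++ (q₁.map f' ++ (p₂.map f ++ q₂.map f')), ?_, ?_, ?_, fun x => ?_,
      fun x hx y hy hxy => ?_⟩
    · refine List.isChain_append.2 ⟨hps.isChain_map hf (by simp),
        List.isChain_append.2 ⟨hqs.isChain_map hf' (by simp),
          List.isChain_append.2 ⟨hps.isChain_map hf (by simp), hqs.isChain_map hf' (by simp), ?_⟩,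
          ?_⟩, ?_⟩
      · rw [h₃', h₄]
        rintro _ ⟨⟩ _ ⟨⟩
        exact hcross e he
      · rw [List.head?_append, h₂', h₃]
        rintro _ ⟨⟩ _ ⟨⟩
        exact (hcross c hc).symm
      · rw [List.head?_append, h₁', h₂]
        rintro _ ⟨⟩ _ ⟨⟩
        exact hcross b hb
    · rw [List.getLast?_append, List.getLast?_append, List.getLast?_append, List.head?_append, h₁,
        h₄']
      rintro _ ⟨⟩ _ ⟨⟩
      exact (hcross a ha).symm
    · refine hperm.nodup_iff.2 (List.nodup_append.2
        ⟨hn.map_on fun v hv w hw =>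
          hinj v ((hm v).1 (List.mem_append.1 hv)) w ((hm w).1 (List.mem_append.1 hw)),
          hn'.map_on fun v hv w hw =>
          hinj' v ((hm' v).1 (List.mem_append.1 hv)) w ((hm' w).1 (List.mem_append.1 hw)), ?_⟩)
      intro x hx y hy
      obtain ⟨v, hv, rfl⟩ := List.mem_map.1 hx
      obtain ⟨w, hw, rfl⟩ := List.mem_map.1 hy
      exact hdisj v ((hm v).1 (List.mem_append.1 hv)) w ((hm' w).1 (List.mem_append.1 hw))
    · rw [hs, hperm.mem_iff, List.mem_append, List.mem_map, List.mem_map]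
      simp only [List.mem_append, hm, hm']
    · have i₁ : p₁.map f <:+: p₁.map f ++ (q₁.map f' ++ (p₂.map f ++ q₂.map f')) :=
        List.infix_append_left
      have i₂ : q₁.map f' <:+: p₁.map f ++ (q₁.map f' ++ (p₂.map f ++ q₂.map f')) :=
        List.infix_append_left.trans List.infix_append_right
      have i₃ : p₂.map f <:+: p₁.map f ++ (q₁.map f' ++ (p₂.map f ++ q₂.map f')) :=
        (List.infix_append_left.trans List.infix_append_right).trans List.infix_append_right
      have i₄ : q₂.map f' <:+: p₁.map f ++ (q₁.map f' ++ (p₂.map f ++ q₂.map f')) :=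
        (List.infix_append_right.trans List.infix_append_right).trans List.infix_append_right
      have across : ∀ v < 2 ^ d, U v → CyclicallyConsecutive
          (p₁.map f ++ (q₁.map f' ++ (p₂.map f ++ q₂.map f'))) (f v) (f' v) := by
        intro v hv hu
        rcases hU v hv hu with rfl | rfl | rfl | rfl
        · refine .inr (.inl ⟨?_, ?_⟩)
          · rw [List.head?_append, h₁]
            rfl
          · rw [List.getLast?_append, List.getLast?_append, List.getLast?_append, h₄']
            rfl
        · refine .inl (consecutive_append_boundary h₁' ?_)
          rw [List.head?_append, h₂]
          rfl
        · refine .of_infix (consecutive_append_boundary h₂' ?_).symm List.infix_append_right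
          rw [List.head?_append, h₃]
          rfl
        · exact .of_infix (consecutive_append_boundary h₃' h₄)
            (List.infix_append_right.trans List.infix_append_right)
      rcases hR x hx y hy hxy with ⟨v, hv, j, hj, hvj, rfl, rfl⟩ | ⟨v, hv, j, hj, hvj, rfl, rfl⟩ |
        ⟨v, hv, hu, ⟨rfl, rfl⟩ | ⟨rfl, rfl⟩⟩
      · obtain ⟨t, ht, h⟩ := hE v hv j hj hvj
        rw [List.mem_pair] at ht
        rcases ht with rfl | rfl
        · exact .of_infix (h.map f) i₁
        · exact .of_infix (h.map f) i₃
      · obtain ⟨t, ht, h⟩ := hE' v hv j hj hvj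
        rw [List.mem_pair] at ht
        rcases ht with rfl | rfl
        · exact .of_infix (h.map f') i₂
        · exact .of_infix (h.map f') i₄
      · exact across v hv hu
      · exact (across v hv hu).symm

end Transfer

/-! ### Subcubes of the hypercube and their coordinates -/

section Subcubes

variable {n : ℕ} {D : Finset (Fin n)} {R : Finset (Fin n) → Finset (Fin n) → Prop}

/-- The subcube of all vertices which differ from `b` in directions from `D` only. -/
def subcube (b D : Finset (Fin n)) : Set (Finset (Fin n)) := {v | symmDiff v b ⊆ D}

/-- `R` is the adjacency relation of a matching with directions in `D` that is maximal among these
matchings. -/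
structure IsMaximalMatching (D : Finset (Fin n)) (R : Finset (Fin n) → Finset (Fin n) → Prop) :
    Prop where
  symm : ∀ x y, R x y → R y x
  unique : ∀ x y z, R x y → R x z → y = z
  direction : ∀ x y, R x y → ∃ i ∈ D, y = symmDiff x {i}
  maximal : ∀ x, ∀ i ∈ D, (∃ y, R x y) ∨ ∃ y, R (symmDiff x {i}) y

/-- There is a Hamilton path of the subcube at `u` with directions `D` that contains the edges of
`R` and whose ends are `u` and its neighbour in direction `i`. Hence the path can be closed. -/
def HasClosablePath (D : Finset (Fin n)) (R : Finset (Fin n) → Finset (Fin n) → Prop)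
    (u : Finset (Fin n)) (i : Fin n) : Prop :=
  ∃ l, IsSpanningPath (hypercube n) (subcube u D) R l u (symmDiff u {i})

theorem adj_symmDiff_singleton (u : Finset (Fin n)) (i : Fin n) :
    (hypercube n).Adj u (symmDiff u {i}) := by
  change (symmDiff u (symmDiff u {i})).card = 1
  rw [symmDiff_symmDiff_cancel_left, Finset.card_singleton]

theorem symmDiff_singleton_cancel (u : Finset (Fin n)) (i : Fin n) :
    symmDiff (symmDiff u {i}) {i} = u :=
  symmDiff_symmDiff_cancel_right _ _

theorem mem_symmDiff_singleton {u : Finset (Fin n)} {i x : Fin n} :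
    x ∈ symmDiff u {i} ↔ (x ∈ u ↔ x ≠ i) := by
  rw [Finset.mem_symmDiff, Finset.mem_singleton]
  tauto

theorem symmDiff_singleton_injective {u : Finset (Fin n)} {i j : Fin n}
    (h : symmDiff u {i} = symmDiff u {j}) : i = j := by
  have := symmDiff_right_injective u h
  exact Finset.singleton_injective this

theorem mem_subcube {b v : Finset (Fin n)} :
    v ∈ subcube b D ↔ ∀ x, x ∉ D → (x ∈ v ↔ x ∈ b) := by
  change symmDiff v b ⊆ D ↔ _
  constructor
  · intro h x hx
    by_contra hc
    refine hx (h (Finset.mem_symmDiff.2 ?_))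
    tauto
  · intro h x hx
    by_contra hc
    have := h x hc
    rw [Finset.mem_symmDiff] at hx
    tauto

theorem self_mem_subcube (b : Finset (Fin n)) : b ∈ subcube b D :=
  mem_subcube.2 fun _ _ => Iff.rfl

theorem subcube_eq_of_mem {b v : Finset (Fin n)} (h : v ∈ subcube b D) :
    subcube v D = subcube b D := by
  ext w
  rw [mem_subcube] at h
  rw [mem_subcube, mem_subcube]
  exact forall₂_congr fun x hx => by rw [h x hx]

theorem symmDiff_singleton_mem_subcube {b v : Finset (Fin n)} {i : Fin n} (hi : i ∈ D)
    (h : v ∈ subcube b D) : symmDiff v {i} ∈ subcube b D := by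
  rw [mem_subcube] at h ⊢
  intro x hx
  rw [mem_symmDiff_singleton, ← h x hx]
  have : x ≠ i := fun h => hx (h ▸ hi)
  tauto

theorem mem_subcube_insert {b v : Finset (Fin n)} {i : Fin n} :
    v ∈ subcube b (insert i D) ↔ v ∈ subcube b D ∨ v ∈ subcube (symmDiff b {i}) D := by
  simp only [mem_subcube, Finset.mem_insert, not_or, mem_symmDiff_singleton]
  constructor
  · intro h
    by_cases hi : i ∈ v ↔ i ∈ b
    · refine .inl fun x hx => ?_
      rcases eq_or_ne x i with rfl | hne
      · exact hi
      · exact h x ⟨hne, hx⟩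
    · refine .inr fun x hx => ?_
      rcases eq_or_ne x i with rfl | hne
      · tauto
      · have := h x ⟨hne, hx⟩
        tauto
  · rintro (h | h) x ⟨hne, hx⟩
    · exact h x hx
    · have := h x hx
      tauto

theorem disjoint_subcube {b v : Finset (Fin n)} {i : Fin n} (hi : i ∉ D) (h : v ∈ subcube b D)
    (h' : v ∈ subcube (symmDiff b {i}) D) : False := by
  rw [mem_subcube] at h h'
  have h₁ := h i hi
  have h₂ := h' i hi
  rw [mem_symmDiff_singleton] at h₂
  tauto

/-- The vertex with code `k`, where the digit `j` of the code stands for the direction `σ j`, and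
the code `0` for the vertex `b`. -/
def decode (d : ℕ) (b : Finset (Fin n)) (σ : ℕ → Fin n) (k : ℕ) : Finset (Fin n) :=
  symmDiff b (((Finset.range d).filter fun j => k.testBit j = true).image σ)

variable {d : ℕ} {b : Finset (Fin n)} {σ : ℕ → Fin n}

theorem decode_zero : decode d b σ 0 = b := by
  have : (Finset.range d).filter (fun j => (0 : ℕ).testBit j = true) = ∅ := by simp
  rw [decode, this, Finset.image_empty]
  exact symmDiff_bot b

theorem decode_symmDiff (c : Finset (Fin n)) (k : ℕ) :
    decode d (symmDiff b c) σ k = symmDiff (decode d b σ k) c := by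
  rw [decode, decode, symmDiff_assoc, symmDiff_assoc, symmDiff_comm c]

theorem decode_flipBit (hσ : ∀ i < d, ∀ j < d, σ i = σ j → i = j) {j : ℕ} (hj : j < d) (k : ℕ) :
    decode d b σ (flipBit k j) = symmDiff (decode d b σ k) {σ j} := by
  rw [decode, decode, symmDiff_assoc]
  congr 1
  ext x
  rw [mem_symmDiff_singleton]
  simp only [Finset.mem_image, Finset.mem_filter, Finset.mem_range, testBit_flipBit]
  by_cases hx : x = σ j
  · subst hx
    have : ∀ q : ℕ → Prop, (∃ i, (i < d ∧ q i) ∧ σ i = σ j) ↔ q j := fun q =>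
      ⟨fun ⟨i, ⟨hi, h⟩, hij⟩ => hσ i hi j hj hij ▸ h, fun h => ⟨j, ⟨hj, h⟩, rfl⟩⟩
    rw [this, this]
    cases k.testBit j <;> simp
  · simp only [ne_eq, hx, not_false_eq_true, iff_true]
    refine exists_congr fun i => and_congr_left fun hi => ?_
    have : j ≠ i := by
      rintro rfl
      exact hx hi.symm
    simp [this]

theorem decode_inj (hσ : ∀ i < d, ∀ j < d, σ i = σ j → i = j) {v w : ℕ} (hv : v < 2 ^ d)
    (hw : w < 2 ^ d) (h : decode d b σ v = decode d b σ w) : v = w := by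
  have h := symmDiff_right_injective b h
  refine Nat.eq_of_testBit_eq fun j => ?_
  by_cases hj : j < d
  · have := congrArg (σ j ∈ ·) h
    simp only [Finset.mem_image, Finset.mem_filter, Finset.mem_range] at this
    have key : ∀ q : ℕ → Prop, (∃ i, (i < d ∧ q i) ∧ σ i = σ j) ↔ q j := fun q =>
      ⟨fun ⟨i, ⟨hi, h⟩, hij⟩ => hσ i hi j hj hij ▸ h, fun h => ⟨j, ⟨hj, h⟩, rfl⟩⟩
    rw [key, key] at this
    exact Bool.eq_iff_iff.2 (iff_of_eq this)
  · have : 2 ^ d ≤ 2 ^ j := Nat.pow_le_pow_right (by norm_num) (not_lt.1 hj)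
    rw [Nat.testBit_lt_two_pow (hv.trans_le this), Nat.testBit_lt_two_pow (hw.trans_le this)]

theorem exists_testBit_iff (d : ℕ) (q : ℕ → Prop) :
    ∃ k < 2 ^ d, ∀ j < d, (k.testBit j = true ↔ q j) := by
  classical
  refine ⟨Nat.ofBits fun j : Fin d => decide (q j), Nat.ofBits_lt_two_pow _, fun j hj => ?_⟩
  rw [Nat.testBit_ofBits_lt _ _ hj, decide_eq_true_eq]

theorem mem_subcube_iff_decode {v : Finset (Fin n)} :
    v ∈ subcube b ((Finset.range d).image σ) ↔ ∃ k < 2 ^ d, decode d b σ k = v := by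
  constructor
  · intro h
    obtain ⟨k, hk, hkj⟩ := exists_testBit_iff d fun j => σ j ∈ symmDiff v b
    refine ⟨k, hk, ?_⟩
    have : ((Finset.range d).filter fun j => k.testBit j = true).image σ = symmDiff v b := by
      ext x
      simp only [Finset.mem_image, Finset.mem_filter, Finset.mem_range]
      constructor
      · rintro ⟨j, ⟨hj, h⟩, rfl⟩
        exact (hkj j hj).1 h
      · intro hx
        obtain ⟨j, hj, rfl⟩ := Finset.mem_image.1 (h hx)
        rw [Finset.mem_range] at hj
        exact ⟨j, ⟨hj, (hkj j hj).2 hx⟩, rfl⟩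
    rw [decode, this, symmDiff_comm v, symmDiff_symmDiff_cancel_left]
  · rintro ⟨k, -, rfl⟩
    change symmDiff (symmDiff b _) b ⊆ _
    rw [symmDiff_comm b, symmDiff_symmDiff_cancel_right]
    exact Finset.image_subset_image (Finset.filter_subset _ _)

theorem adj_decode_flipBit (hσ : ∀ i < d, ∀ j < d, σ i = σ j → i = j) {j : ℕ} (hj : j < d)
    (k : ℕ) : (hypercube n).Adj (decode d b σ k) (decode d b σ (flipBit k j)) := by
  rw [decode_flipBit hσ hj]
  exact adj_symmDiff_singleton _ _

/-! ### Matchings in coordinates -/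

/-- The edges of `R` inside the subcube with base `b` and directions `σ 0, …, σ (d - 1)`. -/
def codeEdges (d : ℕ) (b : Finset (Fin n)) (σ : ℕ → Fin n)
    (R : Finset (Fin n) → Finset (Fin n) → Prop) (v j : ℕ) : Prop :=
  R (decode d b σ v) (decode d b σ (flipBit v j))

/-- If `W` consists of the vertices of a subcube at which `R` has an edge leaving the subcube, then
`R` restricts to a maximal matching of the subcube avoiding `W`. -/
theorem IsMaximalMatching.isCodeMatching (hR : IsMaximalMatching D R)
    (hσ : ∀ i < d, ∀ j < d, σ i = σ j → i = j) (hσD : ∀ j < d, σ j ∈ D) {W : ℕ}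
    (hW : ∀ v < 2 ^ d, W.testBit v = true ↔
      ∃ i ∉ (Finset.range d).image σ, R (decode d b σ v) (symmDiff (decode d b σ v) {i})) :
    IsCodeMatching d W (codeEdges d b σ R) where
  flip v _ j _ h := by
    rw [codeEdges, flipBit_flipBit]
    exact hR.symm _ _ h
  unique v _ j hj k hk h h' := by
    have := hR.unique _ _ _ h h'
    rw [decode_flipBit hσ hj, decode_flipBit hσ hk] at this
    exact hσ j hj k hk (symmDiff_singleton_injective this)
  avoids v hv j hj h := by
    rw [← Bool.not_eq_true, hW v hv]
    rintro ⟨i, hi, h'⟩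
    have := hR.unique _ _ _ h h'
    rw [decode_flipBit hσ hj] at this
    rw [← symmDiff_singleton_injective this] at hi
    exact hi (Finset.mem_image_of_mem _ (Finset.mem_range.2 hj))
  maximal v hv j hj h h' := by
    have key : ∀ x < 2 ^ d, W.testBit x = false → (∃ y, R (decode d b σ x) y) →
        ∃ k < d, codeEdges d b σ R x k := by
      rintro x hx hWx ⟨y, hy⟩
      obtain ⟨i, -, rfl⟩ := hR.direction _ _ hy
      by_cases hi : i ∈ (Finset.range d).image σ
      · obtain ⟨k, hk, rfl⟩ := Finset.mem_image.1 hi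
        rw [Finset.mem_range] at hk
        refine ⟨k, hk, ?_⟩
        rwa [codeEdges, decode_flipBit hσ hk]
      · rw [(hW x hx).2 ⟨i, hi, hy⟩] at hWx
        exact absurd hWx.symm Bool.false_ne_true
    have hflip := flipBit_lt hv hj
    rcases hR.maximal (decode d b σ v) (σ j) (hσD j hj) with hy | hy
    · exact .inl (key v hv h hy)
    · rw [← decode_flipBit hσ hj] at hy
      exact .inr (key _ hflip h' hy)

/-- In a cube all of whose directions may occur in the matching, a Hamilton path of codes gives a
Hamilton path. -/
theorem IsMaximalMatching.hasClosablePath_of_linkable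
    (hR : IsMaximalMatching ((Finset.range d).image σ) R)
    (hσ : ∀ i < d, ∀ j < d, σ i = σ j → i = j) {j : ℕ} (hj : j < d)
    (h : Linkable d [(0, flipBit 0 j)] (codeEdges d b σ R)) :
    HasClosablePath ((Finset.range d).image σ) R b (σ j) := by
  obtain ⟨l, hl⟩ := exists_isSpanningPath_of_linkable (G := hypercube n) (R := R)
    (s := subcube b ((Finset.range d).image σ)) (f := decode d b σ)
    (fun v hv w hw => decode_inj hσ hv hw) (fun v _ j hj => adj_decode_flipBit hσ hj v)
    (fun x => mem_subcube_iff_decode) (fun x hx y _ hxy => by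
      obtain ⟨v, hv, rfl⟩ := mem_subcube_iff_decode.1 hx
      obtain ⟨i, hi, rfl⟩ := hR.direction _ _ hxy
      obtain ⟨k, hk, rfl⟩ := Finset.mem_image.1 hi
      rw [Finset.mem_range] at hk
      refine ⟨v, hv, k, hk, ?_, rfl, decode_flipBit hσ hk v⟩
      rwa [codeEdges, decode_flipBit hσ hk]) h
  rw [decode_flipBit hσ hj, decode_zero] at hl
  exact ⟨l, hl⟩

/-- A cube is split along a direction `i`, and the edges of `R` in direction `i` are at the vertices
in `U`. If the edges of `R` and the edge from `x` to `y` are closable, then a Hamilton path from `x`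
to `y` contains all edges of `R`. -/
theorem IsMaximalMatching.exists_isSpanningPath_of_closable {i : Fin n}
    (hR : IsMaximalMatching (insert i ((Finset.range d).image σ)) R)
    (hσ : ∀ i < d, ∀ j < d, σ i = σ j → i = j) (hi : i ∉ (Finset.range d).image σ)
    {U : ℕ → Prop} {E E' : ℕ → ℕ → Prop} {x y : Finset (Fin n)}
    (hE : ∀ v < 2 ^ d, ∀ j < d, codeEdges d b σ R v j → E v j)
    (hE' : ∀ v < 2 ^ d, ∀ j < d, codeEdges d (symmDiff b {i}) σ R v j → E' v j)
    (hU : ∀ v < 2 ^ d, R (decode d b σ v) (symmDiff (decode d b σ v) {i}) → U v)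
    (hx : x ∈ subcube b ((Finset.range d).image σ)) (hxy : ¬ R x y)
    (hnew : (∃ v < 2 ^ d, ∃ j < d, x = decode d b σ v ∧ y = decode d b σ (flipBit v j) ∧ E v j ∧
        E (flipBit v j) j) ∨
      ∃ v < 2 ^ d, x = decode d b σ v ∧ y = symmDiff x {i} ∧ U v)
    (h : Closable d U E E') :
    ∃ l, IsSpanningPath (hypercube n) (subcube x (insert i ((Finset.range d).image σ))) R l x y := by
  set T := (Finset.range d).image σ with hT
  have hb : subcube x (insert i T) = subcube b (insert i T) :=
    subcube_eq_of_mem (mem_subcube_insert.2 (.inl hx))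
  rw [hb]
  have hmem : ∀ z, z ∈ subcube b (insert i T) ↔ (∃ v < 2 ^ d, decode d b σ v = z) ∨
      ∃ v < 2 ^ d, decode d (symmDiff b {i}) σ v = z := by
    intro z
    rw [mem_subcube_insert, hT, mem_subcube_iff_decode, mem_subcube_iff_decode]
  have hcov : ∀ z ∈ subcube b (insert i T), ∀ w ∈ subcube b (insert i T),
      (R z w ∨ (z = x ∧ w = y) ∨ (z = y ∧ w = x)) →
      (∃ v < 2 ^ d, ∃ j < d, E v j ∧ decode d b σ v = z ∧ decode d b σ (flipBit v j) = w) ∨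
      (∃ v < 2 ^ d, ∃ j < d, E' v j ∧ decode d (symmDiff b {i}) σ v = z ∧
        decode d (symmDiff b {i}) σ (flipBit v j) = w) ∨
      ∃ v < 2 ^ d, U v ∧ ((decode d b σ v = z ∧ decode d (symmDiff b {i}) σ v = w) ∨
        (decode d (symmDiff b {i}) σ v = z ∧ decode d b σ v = w)) := by
    intro z hz w _ hzw
    rcases hzw with hzw | ⟨rfl, rfl⟩ | ⟨rfl, rfl⟩
    · obtain ⟨k, hk, rfl⟩ := hR.direction _ _ hzw
      rw [Finset.mem_insert] at hk
      rcases (hmem z).1 hz with ⟨v, hv, rfl⟩ | ⟨v, hv, rfl⟩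
      · rcases hk with rfl | hk
        · exact .inr (.inr ⟨v, hv, hU v hv hzw, .inl ⟨rfl, decode_symmDiff _ _⟩⟩)
        · obtain ⟨j, hj, rfl⟩ := Finset.mem_image.1 hk
          rw [Finset.mem_range] at hj
          refine .inl ⟨v, hv, j, hj, hE v hv j hj ?_, rfl, decode_flipBit hσ hj v⟩
          rwa [codeEdges, decode_flipBit hσ hj]
      · rcases hk with rfl | hk
        · have h' := hR.symm _ _ hzw
          rw [decode_symmDiff, symmDiff_singleton_cancel] at h'
          exact .inr (.inr ⟨v, hv, hU v hv h',
            .inr ⟨rfl, by rw [decode_symmDiff, symmDiff_singleton_cancel]⟩⟩)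
        · obtain ⟨j, hj, rfl⟩ := Finset.mem_image.1 hk
          rw [Finset.mem_range] at hj
          refine .inr (.inl ⟨v, hv, j, hj, hE' v hv j hj ?_, rfl, decode_flipBit hσ hj v⟩)
          rwa [codeEdges, decode_flipBit hσ hj]
    · rcases hnew with ⟨v, hv, j, hj, rfl, rfl, h, -⟩ | ⟨v, hv, rfl, rfl, h⟩
      · exact .inl ⟨v, hv, j, hj, h, rfl, rfl⟩
      · exact .inr (.inr ⟨v, hv, h, .inl ⟨rfl, decode_symmDiff _ _⟩⟩)
    · rcases hnew with ⟨v, hv, j, hj, rfl, rfl, -, h⟩ | ⟨v, hv, rfl, rfl, h⟩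
      · exact .inl ⟨_, flipBit_lt hv hj, j, hj, h, rfl, by rw [flipBit_flipBit]⟩
      · exact .inr (.inr ⟨v, hv, h, .inr ⟨decode_symmDiff _ _, rfl⟩⟩)
  obtain ⟨l, hl⟩ := exists_isSpanningTour_of_closable (G := hypercube n)
    (R := fun z w => R z w ∨ (z = x ∧ w = y) ∨ (z = y ∧ w = x))
    (s := subcube b (insert i T)) (f := decode d b σ) (f' := decode d (symmDiff b {i}) σ)
    (fun v hv w hw => decode_inj hσ hv hw) (fun v hv w hw => decode_inj hσ hv hw)
    (fun v hv w hw hvw => disjoint_subcube (b := b) (v := decode d b σ v) hi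
      (mem_subcube_iff_decode.2 ⟨v, hv, rfl⟩) (mem_subcube_iff_decode.2 ⟨w, hw, hvw.symm⟩))
    (fun v _ j hj => adj_decode_flipBit hσ hj v) (fun v _ j hj => adj_decode_flipBit hσ hj v)
    (fun v _ => by
      rw [decode_symmDiff]
      exact adj_symmDiff_singleton _ _) hmem hcov h
  have hmono : IsSpanningTour (hypercube n) (subcube b (insert i T)) R l :=
    ⟨hl.chain, hl.closes, hl.nodup, hl.mem, fun z hz w hw hzw => hl.covers z hz w hw (.inl hzw)⟩
  refine hmono.exists_path (hl.covers x ((hmem x).2 ?_) y ((hmem y).2 ?_) (.inr (.inl ⟨rfl, rfl⟩)))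
    hxy fun h => hxy (hR.symm _ _ h)
  · rcases hnew with ⟨v, hv, -, -, rfl, -⟩ | ⟨v, hv, rfl, -⟩
    · exact .inl ⟨v, hv, rfl⟩
    · exact .inl ⟨v, hv, rfl⟩
  · rcases hnew with ⟨v, hv, j, hj, -, rfl, -⟩ | ⟨v, hv, rfl, rfl, -⟩
    · exact .inl ⟨_, flipBit_lt hv hj, rfl⟩
    · exact .inr ⟨v, hv, decode_symmDiff _ _⟩

end Subcubes

/-! ### Closable paths of the 5-cube -/

section FiveDirections

variable {n : ℕ} {R : Finset (Fin n) → Finset (Fin n) → Prop} {σ : ℕ → Fin n} {i : Fin n}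
  {b u : Finset (Fin n)}

theorem IsMaximalMatching.isCodeMatching_halves {d : ℕ}
    (hR : IsMaximalMatching (insert i ((Finset.range d).image σ)) R)
    (hσ : ∀ i < d, ∀ j < d, σ i = σ j → i = j) (hi : i ∉ (Finset.range d).image σ) {W : ℕ}
    (hW : ∀ v < 2 ^ d, W.testBit v = true ↔ R (decode d b σ v) (symmDiff (decode d b σ v) {i})) :
    IsCodeMatching d W (codeEdges d b σ R) ∧
      IsCodeMatching d W (codeEdges d (symmDiff b {i}) σ R) := by
  have hout : ∀ x, (∃ k ∉ (Finset.range d).image σ, R x (symmDiff x {k})) ↔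
      R x (symmDiff x {i}) := by
    refine fun x => ⟨?_, fun h => ⟨i, hi, h⟩⟩
    rintro ⟨k, hk, h⟩
    obtain ⟨k', hk', h'⟩ := hR.direction _ _ h
    rw [← symmDiff_singleton_injective h', Finset.mem_insert] at hk'
    rwa [hk'.resolve_right hk] at h
  have hσD : ∀ j < d, σ j ∈ insert i ((Finset.range d).image σ) := fun j hj =>
    Finset.mem_insert_of_mem (Finset.mem_image_of_mem _ (Finset.mem_range.2 hj))
  refine ⟨hR.isCodeMatching hσ hσD fun v hv => ?_, hR.isCodeMatching hσ hσD fun v hv => ?_⟩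
  · rw [hout, hW v hv]
  · rw [hout, hW v hv, decode_symmDiff, symmDiff_singleton_cancel]
    exact ⟨hR.symm _ _, hR.symm _ _⟩

/-- A tour through the edge at the vertex with code `k` in direction `σ j` is cut open there. -/
theorem hasClosablePath_of_withEdge {k j : ℕ} {U : ℕ → Prop}
    (hR : IsMaximalMatching (insert i ((Finset.range 4).image σ)) R)
    (hσ : ∀ i < 4, ∀ j < 4, σ i = σ j → i = j) (hi : i ∉ (Finset.range 4).image σ)
    (hU : ∀ v < 16, R (decode 4 b σ v) (symmDiff (decode 4 b σ v) {i}) → U v) (hk : k < 16)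
    (hj : j < 4) (hkj : ¬ codeEdges 4 b σ R k j)
    (h : Closable 4 U (withEdge (codeEdges 4 b σ R) k j) (codeEdges 4 (symmDiff b {i}) σ R)) :
    HasClosablePath (insert i ((Finset.range 4).image σ)) R (decode 4 b σ k) (σ j) := by
  have := hR.exists_isSpanningPath_of_closable hσ hi (fun _ _ _ _ => .inl) (fun _ _ _ _ h => h) hU
    (mem_subcube_iff_decode.2 ⟨k, hk, rfl⟩) hkj
    (.inl ⟨k, hk, j, hj, rfl, rfl, .inr ⟨rfl, .inl rfl⟩, .inr ⟨rfl, .inr rfl⟩⟩) h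
  rwa [decode_flipBit hσ hj] at this

/-- A tour which crosses between the halves at the vertex with code `k` is cut open there. -/
theorem hasClosablePath_across {k : ℕ} {U : ℕ → Prop}
    (hR : IsMaximalMatching (insert i ((Finset.range 4).image σ)) R)
    (hσ : ∀ i < 4, ∀ j < 4, σ i = σ j → i = j) (hi : i ∉ (Finset.range 4).image σ)
    (hU : ∀ v < 16, R (decode 4 b σ v) (symmDiff (decode 4 b σ v) {i}) → U v) (hk : k < 16)
    (hUk : U k) (hkR : ¬ R (decode 4 b σ k) (symmDiff (decode 4 b σ k) {i}))
    (h : Closable 4 U (codeEdges 4 b σ R) (codeEdges 4 (symmDiff b {i}) σ R)) :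
    HasClosablePath (insert i ((Finset.range 4).image σ)) R (decode 4 b σ k) i :=
  hR.exists_isSpanningPath_of_closable hσ hi (fun _ _ _ _ h => h) (fun _ _ _ _ h => h) hU
    (mem_subcube_iff_decode.2 ⟨k, hk, rfl⟩) hkR (.inr ⟨k, hk, rfl, rfl, hUk⟩) h

theorem exists_hasClosablePath_of_hasThreeDirections {W : ℕ} (h : HasThreeDirections W)
    (hR : IsMaximalMatching (insert i ((Finset.range 4).image σ)) R)
    (hσ : ∀ i < 4, ∀ j < 4, σ i = σ j → i = j) (hi : i ∉ (Finset.range 4).image σ)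
    (hW : ∀ v < 16, W.testBit v = true ↔ R (decode 4 b σ v) (symmDiff (decode 4 b σ v) {i}))
    (hu : u ∈ subcube b ((Finset.range 4).image σ)) :
    ∃ J ⊆ insert i ((Finset.range 4).image σ), 3 ≤ J.card ∧
      ∀ j ∈ J, HasClosablePath (insert i ((Finset.range 4).image σ)) R u j := by
  obtain ⟨hA, hB⟩ := hR.isCodeMatching_halves hσ hi hW
  obtain ⟨k, hk, rfl⟩ := mem_subcube_iff_decode.1 hu
  obtain ⟨J, hJ, hgood⟩ := h _ _ hA hB k hk
  have hσ4 : ∀ j < 4, σ j ∈ (Finset.range 4).image σ := fun j hj =>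
    Finset.mem_image_of_mem _ (Finset.mem_range.2 hj)
  refine ⟨J.image fun j => if j = 4 then i else σ j, ?_, ?_, ?_⟩
  · intro x hx
    obtain ⟨j, hj, rfl⟩ := Finset.mem_image.1 hx
    rcases hgood j hj with ⟨hj4, -⟩ | ⟨rfl, -⟩
    · rw [if_neg hj4.ne]
      exact Finset.mem_insert_of_mem (hσ4 j hj4)
    · simp
  · rwa [Finset.card_image_of_injOn]
    intro j hj k hk hjk
    dsimp only at hjk
    rcases hgood j hj with ⟨hj4, -⟩ | ⟨rfl, -⟩ <;> rcases hgood k hk with ⟨hk4, -⟩ | ⟨rfl, -⟩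
    · rw [if_neg hj4.ne, if_neg hk4.ne] at hjk
      exact hσ j hj4 k hk4 hjk
    · rw [if_neg hj4.ne, if_pos rfl] at hjk
      exact absurd (hjk ▸ hσ4 j hj4) hi
    · rw [if_neg hk4.ne, if_pos rfl] at hjk
      exact absurd (hjk ▸ hσ4 k hk4) hi
    · rfl
  · intro x hx
    obtain ⟨j, hj, rfl⟩ := Finset.mem_image.1 hx
    rcases hgood j hj with ⟨hj4, hkj, hc⟩ | ⟨rfl, hkW, hc⟩
    · rw [if_neg hj4.ne]
      exact hasClosablePath_of_withEdge hR hσ hi (fun v hv => (hW v hv).2) hk hj4 hkj hc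
    · rw [if_pos rfl]
      refine hasClosablePath_across hR hσ hi (fun v hv h => .inl ((hW v hv).2 h)) hk (.inr rfl) ?_ hc
      rw [← hW k hk, hkW]
      exact Bool.false_ne_true

/-- If no edges cross, the third direction is `i` itself: `u` is joined to its copy in the other
half. -/
theorem exists_hasClosablePath_of_free
    (hR : IsMaximalMatching (insert i ((Finset.range 4).image σ)) R)
    (hσ : ∀ i < 4, ∀ j < 4, σ i = σ j → i = j) (hi : i ∉ (Finset.range 4).image σ)
    (hW : ∀ v ∈ subcube u ((Finset.range 4).image σ), ¬ R v (symmDiff v {i})) :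
    ∃ J ⊆ insert i ((Finset.range 4).image σ), 3 ≤ J.card ∧
      ∀ j ∈ J, HasClosablePath (insert i ((Finset.range 4).image σ)) R u j := by
  set T := (Finset.range 4).image σ with hT
  have hfree : ∀ c ∈ subcube u T, ∀ v < 16, (0 : ℕ).testBit v = true ↔
      R (decode 4 c σ v) (symmDiff (decode 4 c σ v) {i}) := by
    intro c hc v hv
    rw [Nat.zero_testBit]
    refine iff_of_false Bool.false_ne_true (hW _ ?_)
    rw [← subcube_eq_of_mem hc]
    exact mem_subcube_iff_decode.2 ⟨v, hv, rfl⟩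
  have hcross : HasClosablePath (insert i T) R u i := by
    have hu := hfree u (self_mem_subcube u)
    obtain ⟨hA, hB⟩ := hR.isCodeMatching_halves hσ hi hu
    have := hasClosablePath_across hR hσ hi (U := fun v => v = 0) (b := u) (k := 0)
      (fun v hv h => by simpa using (hu v hv).2 h) (by norm_num) rfl
      (fun h => by simpa using (hu 0 (by norm_num)).2 h) (hasFreeDirections.across _ _ hA hB)
    rwa [decode_zero] at this
  -- With the vertex antipodal to `u` as base, the code of `u` is `15`.
  have hc : symmDiff u T ∈ subcube u T := by
    rw [subcube, Set.mem_ofPred_eq, symmDiff_comm u, symmDiff_symmDiff_cancel_right]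
  have h15 : decode 4 (symmDiff u T) σ 15 = u := by
    have : (Finset.range 4).filter (fun j => (15 : ℕ).testBit j = true) = Finset.range 4 := by
      decide
    rw [decode, this, symmDiff_symmDiff_cancel_right]
  have hu := hfree _ hc
  obtain ⟨hA, hB⟩ := hR.isCodeMatching_halves hσ hi hu
  obtain ⟨J, hJ, hgood⟩ := hasFreeDirections.within _ _ hA hB
  have hσ4 : ∀ j ∈ J, σ j ∈ T := fun j hj =>
    Finset.mem_image_of_mem _ (Finset.mem_range.2 (hgood j hj).1)
  refine ⟨insert i (J.image σ), ?_, ?_, ?_⟩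
  · refine Finset.insert_subset_insert _ fun x hx => ?_
    obtain ⟨j, hj, rfl⟩ := Finset.mem_image.1 hx
    exact hσ4 j hj
  · rw [Finset.card_insert_of_notMem, Finset.card_image_of_injOn]
    · omega
    · exact fun j hj k hk => hσ j (hgood j hj).1 k (hgood k hk).1
    · intro h
      obtain ⟨j, hj, rfl⟩ := Finset.mem_image.1 h
      exact hi (hσ4 j hj)
  · intro x hx
    rcases Finset.mem_insert.1 hx with rfl | hx
    · exact hcross
    · obtain ⟨j, hj, rfl⟩ := Finset.mem_image.1 hx
      obtain ⟨hj4, hkj, hcl⟩ := hgood j hj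
      have := hasClosablePath_of_withEdge hR hσ hi (fun v hv h => by simpa using (hu v hv).2 h)
        (by norm_num) hj4 hkj hcl
      rwa [h15] at this

end FiveDirections

/-! ### Larger cubes -/

section Growth

variable {n : ℕ} {D : Finset (Fin n)} {R : Finset (Fin n) → Finset (Fin n) → Prop}

/-- Two Hamilton paths of adjacent subcubes whose ends are joined by edges in the same direction `i`
combine to a Hamilton path whose ends are joined by an edge in the new direction `j`. -/
theorem HasClosablePath.insert {u : Finset (Fin n)} {i j : Fin n} (hj : j ∉ D)
    (hR : ∀ x, ¬ R x (symmDiff x {j})) (hdir : ∀ x y, R x y → ∃ k, y = symmDiff x {k})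
    (h : HasClosablePath D R u i) (h' : HasClosablePath D R (symmDiff u {j}) i) :
    HasClosablePath (insert j D) R u j := by
  obtain ⟨l, hl⟩ := h
  obtain ⟨l', hl'⟩ := h'
  have hr := hl'.reverse
  have hmem : ∀ x y, x ∈ subcube u D → y ∈ subcube (symmDiff u {j}) D → ¬ R x y ∧ ¬ R y x := by
    have key : ∀ {x k}, symmDiff x {k} ∈ subcube (symmDiff u {j}) D → x ∈ subcube u D → k = j := by
      intro x k h h'
      rw [mem_subcube] at h h'
      have h₁ := h j hj
      have h₂ := h' j hj
      rw [mem_symmDiff_singleton, mem_symmDiff_singleton] at h₁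
      by_contra hne
      have : j ≠ k := fun h => hne h.symm
      tauto
    intro x y hx hy
    constructor
    · intro hxy
      obtain ⟨k, rfl⟩ := hdir _ _ hxy
      obtain rfl := key hy hx
      exact hR _ hxy
    · intro hyx
      obtain ⟨k, rfl⟩ := hdir _ _ hyx
      obtain rfl := key (k := k) (by rwa [symmDiff_singleton_cancel]) hx
      exact hR _ hyx
  refine ⟨l ++ l'.reverse, by simp [List.head?_append, hl.head], by
    simp [List.getLast?_append, hl'.head], ?_, ?_, fun x => ?_, fun x hx y hy hxy => ?_⟩
  · refine List.isChain_append.2 ⟨hl.chain, hr.chain, ?_⟩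
    rw [hl.last, hr.head]
    rintro _ ⟨⟩ _ ⟨⟩
    rw [symmDiff_right_comm]
    exact adj_symmDiff_singleton _ _
  · refine List.nodup_append.2 ⟨hl.nodup, hr.nodup, fun x hx y hy hxy => ?_⟩
    subst hxy
    exact disjoint_subcube hj ((hl.mem x).1 hx) ((hr.mem x).1 hy)
  · rw [List.mem_append, hl.mem, hr.mem, mem_subcube_insert]
  · rcases mem_subcube_insert.1 hx with hx | hx <;> rcases mem_subcube_insert.1 hy with hy | hy
    · exact (hl.covers x hx y hy hxy).mono List.infix_append_left
    · exact absurd hxy (hmem x y hx hy).1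
    · exact absurd hxy (hmem y x hy hx).2
    · exact (hr.covers x hx y hy hxy).mono List.infix_append_right

/-- If all edges of `R` have directions in `D` and at each vertex more than half of the directions in
`D` admit a closable path, then in each larger cube all the further directions do. -/
theorem hasClosablePath_union (hdir : ∀ x y, R x y → ∃ k ∈ D, y = symmDiff x {k})
    (hD : ∀ u, ∃ J ⊆ D, D.card < 2 * J.card ∧ ∀ j ∈ J, HasClosablePath D R u j)
    (T : Finset (Fin n)) (hT : Disjoint D T) (u : Finset (Fin n)) {j : Fin n} (hj : j ∈ T) :
    HasClosablePath (D ∪ T) R u j := by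
  induction T using Finset.strongInduction generalizing u j with
  | H T ih =>
    have hjD : j ∉ D := fun h => Finset.disjoint_left.1 hT h hj
    have hRj : ∀ x, ¬ R x (symmDiff x {j}) := by
      intro x h
      obtain ⟨k, hk, h⟩ := hdir _ _ h
      exact hjD (symmDiff_singleton_injective h ▸ hk)
    have hdir' : ∀ x y, R x y → ∃ k, y = symmDiff x {k} := fun x y h =>
      (hdir x y h).imp fun _ h => h.2
    have hsplit : D ∪ T = insert j (D ∪ T.erase j) := by
      rw [← Finset.union_insert, Finset.insert_erase hj]
    have hnew : j ∉ D ∪ T.erase j := by simp [hjD]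
    rw [hsplit]
    suffices h : ∃ i, ∀ w, w = u ∨ w = symmDiff u {j} → HasClosablePath (D ∪ T.erase j) R w i by
      obtain ⟨i, hi⟩ := h
      exact (hi u (.inl rfl)).insert hnew hRj hdir' (hi _ (.inr rfl))
    rcases (T.erase j).eq_empty_or_nonempty with he | ⟨i, hi⟩
    · rw [he, Finset.union_empty]
      obtain ⟨J, hJD, hJ, h⟩ := hD u
      obtain ⟨J', hJD', hJ', h'⟩ := hD (symmDiff u {j})
      have : ¬ Disjoint J J' := by
        intro hd
        have := Finset.card_le_card (Finset.union_subset hJD hJD')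
        rw [Finset.card_union_of_disjoint hd] at this
        omega
      obtain ⟨i, hi, hi'⟩ := Finset.not_disjoint_iff.1 this
      refine ⟨i, ?_⟩
      rintro w (rfl | rfl)
      · exact h i hi
      · exact h' i hi'
    · exact ⟨i, fun w _ => ih _ (Finset.erase_ssubset hj)
        (hT.mono_right (Finset.erase_subset _ _)) w hi⟩

end Growth

/-! ### Choosing the direction of the split -/

section Selection

variable {n : ℕ} {D : Finset (Fin n)} {R : Finset (Fin n) → Finset (Fin n) → Prop}

/-- The parity of a vertex; adjacent vertices have different parities. -/
def isEven (v : Finset (Fin n)) : Bool := decide (Even v.card)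

theorem isEven_symmDiff_singleton (v : Finset (Fin n)) (i : Fin n) :
    isEven (symmDiff v {i}) = !isEven v := by
  have h : Even (symmDiff v {i}).card ↔ ¬ Even v.card := by
    by_cases hi : i ∈ v
    · have : symmDiff v {i} = v.erase i := by
        ext x
        rw [mem_symmDiff_singleton, Finset.mem_erase]
        by_cases hx : x = i
        · subst hx
          simp [hi]
        · simp [hx]
      have hc := Finset.card_erase_add_one hi
      rw [this, ← hc, Nat.even_add_one, not_not]
    · have : symmDiff v {i} = insert i v := by
        ext x
        rw [mem_symmDiff_singleton, Finset.mem_insert]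
        by_cases hx : x = i
        · subst hx
          simp [hi]
        · simp [hx]
      rw [this, Finset.card_insert_of_notMem hi, Nat.even_add_one]
  rw [isEven, isEven, Bool.eq_iff_iff, Bool.not_eq_true', decide_eq_true_eq, decide_eq_false_iff_not,
    h]

theorem isEven_symmDiff (u s : Finset (Fin n)) :
    isEven (symmDiff u s) = (isEven u == isEven s) := by
  induction s using Finset.induction_on with
  | empty =>
    rw [← Finset.bot_eq_empty, symmDiff_bot]
    simp [isEven]
  | insert i s hi ih =>
    have : insert i s = symmDiff s {i} := by
      ext x
      rw [mem_symmDiff_singleton, Finset.mem_insert]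
      by_cases hx : x = i
      · subst hx
        simp [hi]
      · simp [hx]
    rw [this, ← symmDiff_assoc, isEven_symmDiff_singleton, isEven_symmDiff_singleton, ih]
    cases isEven u <;> cases isEven s <;> rfl

/-- The vertices of `subcube u D` as a finite set. -/
def subcubeFinset (u D : Finset (Fin n)) : Finset (Finset (Fin n)) :=
  D.powerset.image (symmDiff u)

theorem mem_subcubeFinset {u v : Finset (Fin n)} : v ∈ subcubeFinset u D ↔ v ∈ subcube u D := by
  rw [subcubeFinset, Finset.mem_image]
  change _ ↔ symmDiff v u ⊆ D
  constructor
  · rintro ⟨s, hs, rfl⟩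
    rw [symmDiff_comm u, symmDiff_symmDiff_cancel_right]
    exact Finset.mem_powerset.1 hs
  · intro h
    exact ⟨_, Finset.mem_powerset.2 h, by rw [symmDiff_comm v, symmDiff_symmDiff_cancel_left]⟩

theorem card_subcubeFinset (u D : Finset (Fin n)) : (subcubeFinset u D).card = 2 ^ D.card := by
  rw [subcubeFinset, Finset.card_image_of_injective _ (symmDiff_right_injective u),
    Finset.card_powerset]

/-- A subcube of positive dimension has as many even as odd vertices. -/
theorem two_mul_card_parity_class (u : Finset (Fin n)) {j : Fin n} (hj : j ∈ D) (ρ : Bool) :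
    2 * ((subcubeFinset u D).filter fun v => isEven v = ρ).card = 2 ^ D.card := by
  have hswap : ((subcubeFinset u D).filter fun v => isEven v = ρ).card =
      ((subcubeFinset u D).filter fun v => ¬ isEven v = ρ).card := by
    have hmaps : ∀ v ∈ subcubeFinset u D, symmDiff v {j} ∈ subcubeFinset u D := fun v hv =>
      mem_subcubeFinset.2 (symmDiff_singleton_mem_subcube hj (mem_subcubeFinset.1 hv))
    refine Finset.card_nbij' (symmDiff · {j}) (symmDiff · {j}) ?_ ?_ ?_ ?_
    · intro v hv
      simp only [Finset.coe_filter, Set.mem_ofPred_eq, isEven_symmDiff_singleton] at hv ⊢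
      refine ⟨hmaps v hv.1, ?_⟩
      rw [hv.2]
      cases ρ <;> simp
    · intro v hv
      simp only [Finset.coe_filter, Set.mem_ofPred_eq, isEven_symmDiff_singleton] at hv ⊢
      refine ⟨hmaps v hv.1, ?_⟩
      have := hv.2
      revert this
      cases isEven v <;> cases ρ <;> simp
    · exact fun v _ => symmDiff_singleton_cancel v j
    · exact fun v _ => symmDiff_singleton_cancel v j
  have := Finset.card_filter_add_card_filter_not (s := subcubeFinset u D)
    (fun v => isEven v = ρ)
  rw [← hswap, card_subcubeFinset] at this
  omega

open Classical in
/-- The ends in the half of `u` of the edges of `R` in direction `i` inside `subcube u D`. -/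
noncomputable def crossings (D : Finset (Fin n)) (R : Finset (Fin n) → Finset (Fin n) → Prop)
    (u : Finset (Fin n)) (i : Fin n) : Finset (Finset (Fin n)) :=
  (subcubeFinset u (D.erase i)).filter fun v => R v (symmDiff v {i})

theorem mem_crossings {u v : Finset (Fin n)} {i : Fin n} :
    v ∈ crossings D R u i ↔ v ∈ subcube u (D.erase i) ∧ R v (symmDiff v {i}) := by
  simp only [crossings, Finset.mem_filter, mem_subcubeFinset]

theorem subcube_erase_subset {u v : Finset (Fin n)} {i : Fin n} (h : v ∈ subcube u (D.erase i)) :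
    v ∈ subcube u D :=
  Finset.Subset.trans h (Finset.erase_subset _ _)

open Classical in
/-- Each edge has exactly one end in a given parity class. -/
theorem IsMaximalMatching.sum_card_crossings_le (hR : IsMaximalMatching D R)
    (u : Finset (Fin n)) (ρ : Bool) :
    ∑ i ∈ D, (crossings D R u i).card ≤
      ((subcubeFinset u D).filter fun v => isEven v = ρ ∧ ∃ y, R v y).card := by
  rw [← Finset.card_sigma]
  have hend : ∀ p ∈ D.sigma (crossings D R u), ∃ x, (x = p.2 ∨ x = symmDiff p.2 {p.1}) ∧
      isEven x = ρ ∧ (if isEven p.2 = ρ then p.2 else symmDiff p.2 {p.1}) = x ∧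
      R x (symmDiff x {p.1}) := by
    rintro ⟨i, v⟩ hp
    obtain ⟨-, hv⟩ := Finset.mem_sigma.1 hp
    have hv := (mem_crossings.1 hv).2
    by_cases hρ : isEven v = ρ
    · exact ⟨v, .inl rfl, hρ, if_pos hρ, hv⟩
    · refine ⟨_, .inr rfl, ?_, if_neg hρ, ?_⟩
      · dsimp only
        rw [isEven_symmDiff_singleton]
        revert hρ
        cases isEven v <;> cases ρ <;> simp
      · dsimp only
        rw [symmDiff_singleton_cancel]
        exact hR.symm _ _ hv
  refine Finset.card_le_card_of_injOn
    (fun p => if isEven p.2 = ρ then p.2 else symmDiff p.2 {p.1}) ?_ ?_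
  · intro p hp
    obtain ⟨x, hx, hρ, hpx, hxR⟩ := hend p hp
    obtain ⟨hD, hv⟩ := Finset.mem_sigma.1 hp
    have hv := subcube_erase_subset (mem_crossings.1 hv).1
    dsimp only
    rw [hpx, Finset.coe_filter, Set.mem_ofPred_eq]
    refine ⟨mem_subcubeFinset.2 ?_, hρ, _, hxR⟩
    rcases hx with rfl | rfl
    · exact hv
    · exact symmDiff_singleton_mem_subcube hD hv
  · intro p hp q hq hpq
    obtain ⟨x, hx, -, hpx, hxR⟩ := hend p hp
    obtain ⟨y, hy, -, hqy, hyR⟩ := hend q hq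
    dsimp only at hpq
    rw [hpx, hqy] at hpq
    subst hpq
    obtain ⟨i, v⟩ := p
    obtain ⟨j, w⟩ := q
    dsimp only at hx hy hxR hyR
    obtain rfl := symmDiff_singleton_injective (hR.unique _ _ _ hxR hyR)
    have hv := mem_subcube.1 (mem_crossings.1 (Finset.mem_sigma.1 hp).2).1 i (by simp)
    have hw := mem_subcube.1 (mem_crossings.1 (Finset.mem_sigma.1 hq).2).1 i (by simp)
    dsimp only at hv hw
    have hvw : v = w := by
      rcases hx with rfl | rfl <;> rcases hy with h | h
      · exact h
      · rw [h, mem_symmDiff_singleton] at hv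
        simp only [ne_eq, not_true_eq_false, iff_false] at hv
        tauto
      · rw [← h, mem_symmDiff_singleton] at hw
        simp only [ne_eq, not_true_eq_false, iff_false] at hw
        tauto
      · exact symmDiff_left_injective _ h
    rw [hvw]

open Classical in
/-- If the edges in direction `i` all have their ends in this half in the parity class `ρ`, then the
edges inside this half cannot cover as many vertices of the other class. -/
theorem IsMaximalMatching.card_covered_le (hR : IsMaximalMatching D R) {u : Finset (Fin n)}
    {i j : Fin n} (hi : i ∈ D) (hj : j ∈ D.erase i) {ρ : Bool}
    (hρ : ∀ v ∈ crossings D R u i, isEven v = ρ) :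
    ((subcubeFinset u D).filter fun v => isEven v = !ρ ∧ ∃ y, R v y).card +
      (crossings D R u i).card ≤ 2 ^ (D.erase i).card := by
  set T := D.erase i with hT
  have hsplit : (subcubeFinset u D).filter (fun v => isEven v = !ρ ∧ ∃ y, R v y) ⊆
      ((subcubeFinset u T).filter fun v => isEven v = !ρ ∧ ∃ y, R v y) ∪
        (subcubeFinset (symmDiff u {i}) T).filter fun v => isEven v = !ρ := by
    intro v hv
    rw [Finset.mem_filter, mem_subcubeFinset, ← Finset.insert_erase hi, mem_subcube_insert] at hv
    rw [Finset.mem_union, Finset.mem_filter, Finset.mem_filter, mem_subcubeFinset,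
      mem_subcubeFinset]
    tauto
  have hlow : ((subcubeFinset u T).filter fun v => isEven v = !ρ ∧ ∃ y, R v y).card ≤
      (((subcubeFinset u T).filter fun v => isEven v = ρ) \ crossings D R u i).card := by
    refine Finset.card_le_card_of_forall_subsingleton R (fun v hv => ?_) fun y _ v hv w hw => ?_
    · rw [Finset.mem_filter, mem_subcubeFinset] at hv
      obtain ⟨hv, hvρ, y, hvy⟩ := hv
      refine ⟨y, ?_, hvy⟩
      obtain ⟨k, hk, rfl⟩ := hR.direction _ _ hvy
      have hki : k ≠ i := by
        rintro rfl
        rw [hρ v (mem_crossings.2 ⟨hv, hvy⟩)] at hvρ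
        cases ρ <;> simp at hvρ
      have hkT : k ∈ T := Finset.mem_erase.2 ⟨hki, hk⟩
      rw [Finset.mem_sdiff, Finset.mem_filter, mem_subcubeFinset, isEven_symmDiff_singleton, hvρ,
        Bool.not_not]
      refine ⟨⟨symmDiff_singleton_mem_subcube hkT hv, rfl⟩, fun hc => hki ?_⟩
      have h := hR.unique _ _ _ (mem_crossings.1 hc).2 (hR.symm _ _ hvy)
      rw [symmDiff_right_comm] at h
      have h' : symmDiff v {i} = symmDiff v {k} := by
        conv_rhs => rw [← h, symmDiff_singleton_cancel]
      exact (symmDiff_singleton_injective h').symm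
    · exact hR.unique y v w (hR.symm _ _ hv.2) (hR.symm _ _ hw.2)
  have hsub : crossings D R u i ⊆ (subcubeFinset u T).filter fun v => isEven v = ρ := fun v hv =>
    Finset.mem_filter.2 ⟨mem_subcubeFinset.2 (mem_crossings.1 hv).1, hρ v hv⟩
  rw [Finset.card_sdiff_of_subset hsub] at hlow
  have h₁ := (Finset.card_le_card hsplit).trans (Finset.card_union_le _ _)
  have h₂ := two_mul_card_parity_class u hj ρ
  have h₃ := two_mul_card_parity_class (symmDiff u {i}) hj (!ρ)
  have h₄ := Finset.card_le_card hsub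
  omega

/-- Among five directions there is one in which few edges of the matching cross. -/
theorem IsMaximalMatching.exists_few_crossings (hR : IsMaximalMatching D R) (hD : D.card = 5)
    (u : Finset (Fin n)) :
    ∃ i ∈ D, (crossings D R u i).card ≤ 2 ∨ ((crossings D R u i).card = 3 ∧
      ∃ v ∈ crossings D R u i, ∃ w ∈ crossings D R u i, isEven v ≠ isEven w) := by
  classical
  by_contra! hc
  have h₃ : ∀ i ∈ D, 3 ≤ (crossings D R u i).card := fun i hi => (hc i hi).1
  have hsum : ∀ m, (∀ i ∈ D, m ≤ (crossings D R u i).card) →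
      5 * m ≤ ∑ i ∈ D, (crossings D R u i).card := by
    intro m hm
    have := Finset.card_nsmul_le_sum D _ m hm
    rwa [hD, smul_eq_mul] at this
  -- There would be at least 15 edges. With three crossings of the same parity at most 8 + 5 vertices
  -- of the other parity are covered; with more crossings in all directions there would be 20 edges,
  -- but a parity class has only 16 vertices.
  by_cases h : ∃ i ∈ D, (crossings D R u i).card = 3
  · obtain ⟨i, hi, h⟩ := h
    obtain ⟨v₀, hv₀⟩ := Finset.card_pos.1 (h.symm ▸ three_pos)
    have hT : (D.erase i).card = 4 := by
      rw [Finset.card_erase_of_mem hi, hD]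
    obtain ⟨j, hj⟩ := Finset.card_pos.1 (hT.symm ▸ four_pos)
    have h₁ := hR.card_covered_le hi hj (u := u) (ρ := isEven v₀) fun v hv =>
      (hc i hi).2 h v hv v₀ hv₀
    have h₂ := hR.sum_card_crossings_le u (!isEven v₀)
    have h₅ := hsum 3 h₃
    rw [hT] at h₁
    omega
  · push Not at h
    have h₄ := hsum 4 fun i hi => by
      have := h₃ i hi
      have := h i hi
      omega
    obtain ⟨j, hj⟩ := Finset.card_pos.1 (show 0 < D.card by omega)
    have h₁ := hR.sum_card_crossings_le u true
    have h₂ : ((subcubeFinset u D).filter fun v => isEven v = true ∧ ∃ y, R v y).card ≤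
        ((subcubeFinset u D).filter fun v => isEven v = true).card :=
      Finset.card_le_card fun v hv => by
        rw [Finset.mem_filter] at hv ⊢
        exact ⟨hv.1, hv.2.1⟩
    have h₅ := two_mul_card_parity_class u hj true
    rw [hD] at h₅
    omega

end Selection

/-! ### Coordinates adapted to the crossing edges -/

section Coordinates

variable {n : ℕ} {D : Finset (Fin n)} {R : Finset (Fin n) → Finset (Fin n) → Prop}

theorem exists_enumeration (hD : D.Nonempty) :
    ∃ σ : ℕ → Fin n, (∀ i < D.card, ∀ j < D.card, σ i = σ j → i = j) ∧
      (Finset.range D.card).image σ = D := by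
  obtain ⟨x, -⟩ := hD
  refine ⟨fun k => if h : k < D.card then D.equivFin.symm ⟨k, h⟩ else x,
    fun i hi j hj hij => ?_, ?_⟩
  · simpa [hi, hj] using hij
  · ext y
    simp only [Finset.mem_image, Finset.mem_range]
    constructor
    · rintro ⟨k, hk, rfl⟩
      simp [hk]
    · intro hy
      exact ⟨D.equivFin ⟨y, hy⟩, (D.equivFin ⟨y, hy⟩).2, by simp⟩

/-- Twelve orders of four directions; they suffice to achieve a normal form of the crossings. -/
def arrangements : List (List ℕ) :=
  [[0, 1, 2, 3], [1, 2, 3, 0], [2, 0, 3, 1], [3, 0, 1, 2], [1, 3, 0, 2], [2, 3, 1, 0],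
    [0, 1, 3, 2], [0, 2, 3, 1], [1, 0, 2, 3], [2, 0, 1, 3], [3, 0, 2, 1], [3, 1, 2, 0]]

/-- The code in the old order of the directions of the vertex with code `v` in the order `τ`. -/
def rearrange (τ : List ℕ) (v : ℕ) : ℕ :=
  ((List.range 4).map fun j => cond (v.testBit j) (2 ^ τ.getD j 0) 0).sum

/-- The sets of crossings in normal form, as sets of binary digits. -/
def normalForms : List ℕ := [0x1, 0x3, 0x9, 0x81, 0x8001, 0x7, 0x83, 0x4003, 0x881]

theorem hasThreeDirections_of_mem_normalForms {W : ℕ} (hW : W ∈ normalForms) :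
    HasThreeDirections W := by
  simp only [normalForms, List.mem_cons, List.not_mem_nil, or_false] at hW
  rcases hW with rfl | rfl | rfl | rfl | rfl | rfl | rfl | rfl | rfl
  · exact hasThreeDirections_point
  · exact hasThreeDirections_edge
  · exact hasThreeDirections_distanceTwo
  · exact hasThreeDirections_distanceThree
  · exact hasThreeDirections_antipodes
  · exact hasThreeDirections_cherry
  · exact hasThreeDirections_bent
  · exact hasThreeDirections_crossing
  · exact hasThreeDirections_fork

/-- A set consisting of the vertices with codes `0`, `s` and `t`, where `s` and `t` are equal or both
odd, has a normal form in a suitable order of the directions. -/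
theorem exists_normal_form {s t : ℕ} (hs : s < 16) (ht : t < 16)
    (h : s = t ∨ (¬ Even ((Finset.range 4).filter fun j => s.testBit j = true).card ∧
      ¬ Even ((Finset.range 4).filter fun j => t.testBit j = true).card)) :
    ∃ τ ∈ arrangements, ∃ W ∈ normalForms, ∀ v < 16,
      (W.testBit v = true ↔ rearrange τ v = 0 ∨ rearrange τ v = s ∨ rearrange τ v = t) := by
  have key : ∀ s < 16, ∀ t < 16, s = t ∨
      (((Finset.range 4).filter fun j => s.testBit j = true).card % 2 = 1 ∧
        ((Finset.range 4).filter fun j => t.testBit j = true).card % 2 = 1) →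
      (arrangements.any fun τ => normalForms.any fun W => (List.range 16).all fun v =>
        decide (W.testBit v = true ↔
          rearrange τ v = 0 ∨ rearrange τ v = s ∨ rearrange τ v = t)) = true := by
    decide +kernel
  rw [Nat.not_even_iff, Nat.not_even_iff] at h
  simpa only [List.any_eq_true, List.all_eq_true, List.mem_range, decide_eq_true_eq] using
    key s hs t ht h

theorem image_getD_of_mem_arrangements : ∀ τ ∈ arrangements,
    (Finset.range 4).image (τ.getD · 0) = Finset.range 4 ∧
    (∀ i < 4, ∀ j < 4, τ.getD i 0 = τ.getD j 0 → i = j) ∧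
    ∀ v < 16, rearrange τ v < 16 ∧
      ((Finset.range 4).filter fun j => v.testBit j = true).image (τ.getD · 0) =
        (Finset.range 4).filter fun j => (rearrange τ v).testBit j = true := by
  decide +kernel

theorem decode_rearrange {τ : List ℕ} (hτ : τ ∈ arrangements) (b : Finset (Fin n)) (σ : ℕ → Fin n)
    {v : ℕ} (hv : v < 16) :
    decode 4 b (fun j => σ (τ.getD j 0)) v = decode 4 b σ (rearrange τ v) := by
  rw [decode, decode, ← ((image_getD_of_mem_arrangements τ hτ).2.2 v hv).2, Finset.image_image]
  rfl

theorem not_even_card_of_isEven_ne {b : Finset (Fin n)} {σ : ℕ → Fin n}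
    (hσ : ∀ i < 4, ∀ j < 4, σ i = σ j → i = j) {s : ℕ}
    (h : isEven (decode 4 b σ s) ≠ isEven b) :
    ¬ Even ((Finset.range 4).filter fun j => s.testBit j = true).card := by
  intro hs
  refine h ?_
  rw [decode, isEven_symmDiff]
  have : isEven (((Finset.range 4).filter fun j => s.testBit j = true).image σ) = true := by
    rw [isEven, decide_eq_true_eq, Finset.card_image_of_injOn]
    · exact hs
    · intro i hi j hj hij
      simp only [Finset.coe_filter, Finset.mem_range, Set.mem_ofPred_eq] at hi hj
      exact hσ i hi.1 j hj.1 hij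
  rw [this]
  cases isEven b <;> rfl

/-- A set of at most three vertices that are not all of the same parity if they are three contains a
vertex such that all other ones have the opposite parity, or there is only one other. -/
theorem exists_base {W : Finset (Finset (Fin n))} (hne : W.Nonempty)
    (hW : W.card ≤ 2 ∨ (W.card = 3 ∧ ∃ v ∈ W, ∃ w ∈ W, isEven v ≠ isEven w)) :
    ∃ b v w, (v = w ∨ (isEven v ≠ isEven b ∧ isEven w ≠ isEven b)) ∧
      ∀ x, x ∈ W ↔ x = b ∨ x = v ∨ x = w := by
  have hpos := hne.card_pos
  rcases hW with hW | ⟨hW, v, hv, w, hw, hvw⟩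
  · rcases (show W.card = 1 ∨ W.card = 2 by omega) with h | h
    · obtain ⟨b, rfl⟩ := Finset.card_eq_one.1 h
      exact ⟨b, b, b, .inl rfl, by simp⟩
    · obtain ⟨b, v, -, rfl⟩ := Finset.card_eq_two.1 h
      exact ⟨b, v, v, .inl rfl, by simp⟩
  · obtain ⟨x, y, z, -, -, -, rfl⟩ := Finset.card_eq_three.1 hW
    simp only [Finset.mem_insert, Finset.mem_singleton] at hv hw ⊢
    by_cases hxy : isEven x = isEven y
    · have hxz : isEven x ≠ isEven z := by
        intro hxz
        have hall : ∀ a, a = x ∨ a = y ∨ a = z → isEven a = isEven x := by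
          rintro a (h | h | h)
          · rw [h]
          · rw [h, hxy]
          · rw [h, hxz]
        exact hvw ((hall v hv).trans (hall w hw).symm)
      exact ⟨z, x, y, .inr ⟨hxz, hxy ▸ hxz⟩, fun a => or_rotate.symm⟩
    · by_cases hxz : isEven x = isEven z
      · exact ⟨y, x, z, .inr ⟨hxy, hxz ▸ hxy⟩, fun a => or_left_comm⟩
      · exact ⟨x, y, z, .inr ⟨Ne.symm hxy, Ne.symm hxz⟩, fun a => Iff.rfl⟩

/-- The five-dimensional case: at each vertex three directions admit a closable path. -/
theorem IsMaximalMatching.exists_hasClosablePath (hR : IsMaximalMatching D R) (hD : D.card = 5)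
    (u : Finset (Fin n)) : ∃ J ⊆ D, 3 ≤ J.card ∧ ∀ j ∈ J, HasClosablePath D R u j := by
  obtain ⟨i, hi, hW⟩ := hR.exists_few_crossings hD u
  have hT : (D.erase i).card = 4 := by
    rw [Finset.card_erase_of_mem hi, hD]
  obtain ⟨σ, hσ, hσT⟩ := exists_enumeration (Finset.card_pos.1 (show 0 < (D.erase i).card by omega))
  rw [hT] at hσ hσT
  have hDi : insert i ((Finset.range 4).image σ) = D := by rw [hσT, Finset.insert_erase hi]
  have hiT : i ∉ (Finset.range 4).image σ := by
    rw [hσT]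
    exact Finset.notMem_erase i D
  rcases (crossings D R u i).eq_empty_or_nonempty with he | hne
  · have := exists_hasClosablePath_of_free (u := u) (hDi.symm ▸ hR) hσ hiT fun v hv h => by
      have : v ∈ crossings D R u i := mem_crossings.2 ⟨hσT ▸ hv, h⟩
      rw [he] at this
      exact Finset.notMem_empty v this
    rwa [hDi] at this
  · obtain ⟨b, v, w, hvw, hmem⟩ := exists_base hne hW
    have hb : b ∈ subcube u (D.erase i) := (mem_crossings.1 ((hmem b).2 (.inl rfl))).1
    have hcode : ∀ x ∈ crossings D R u i, ∃ k < 16, decode 4 b σ k = x := by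
      intro x hx
      refine (mem_subcube_iff_decode (d := 4) (b := b) (σ := σ)).1 ?_
      rw [hσT, subcube_eq_of_mem hb]
      exact (mem_crossings.1 hx).1
    obtain ⟨s, hs, rfl⟩ := hcode v ((hmem v).2 (.inr (.inl rfl)))
    obtain ⟨t, ht, rfl⟩ := hcode w ((hmem w).2 (.inr (.inr rfl)))
    obtain ⟨τ, hτ, W, hWn, hWτ⟩ := exists_normal_form hs ht
      (hvw.imp (decode_inj hσ hs ht) fun h =>
        ⟨not_even_card_of_isEven_ne hσ h.1, not_even_card_of_isEven_ne hσ h.2⟩)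
    obtain ⟨hτ₁, hτ₂, hτ₃⟩ := image_getD_of_mem_arrangements τ hτ
    have himage : (Finset.range 4).image (fun j => σ (τ.getD j 0)) = (Finset.range 4).image σ := by
      conv_rhs => rw [← hτ₁, Finset.image_image]
      rfl
    have hlt : ∀ j < 4, τ.getD j 0 < 4 := fun j hj => by
      have := Finset.mem_image_of_mem (τ.getD · 0) (Finset.mem_range.2 hj)
      rwa [hτ₁, Finset.mem_range] at this
    have hstep : ∀ i < 4, ∀ j < 4, σ (τ.getD i 0) = σ (τ.getD j 0) → i = j := fun i hi j hj h =>
      hτ₂ i hi j hj (hσ _ (hlt i hi) _ (hlt j hj) h)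
    have := exists_hasClosablePath_of_hasThreeDirections (b := b) (u := u) (i := i)
      (σ := fun j => σ (τ.getD j 0)) (R := R) (hasThreeDirections_of_mem_normalForms hWn)
      (by rwa [himage, hDi]) hstep (by rwa [himage]) (fun x hx => ?_) ?_
    · rwa [himage, hDi] at this
    · have hrx : rearrange τ x < 16 := (hτ₃ x hx).1
      have hx' : decode 4 b (fun j => σ (τ.getD j 0)) x ∈ subcube u (D.erase i) := by
        rw [← subcube_eq_of_mem hb, ← hσT, ← himage]
        exact mem_subcube_iff_decode.2 ⟨x, hx, rfl⟩
      rw [hWτ x hx]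
      have key : ∀ k < 16, rearrange τ x = k ↔ decode 4 b σ (rearrange τ x) = decode 4 b σ k :=
        fun k hk => ⟨fun h => h ▸ rfl, decode_inj hσ hrx hk⟩
      rw [key 0 (by norm_num), key s hs, key t ht, decode_zero, ← hmem, ← decode_rearrange hτ b σ hx,
        mem_crossings]
      exact and_iff_right hx'
    · rw [himage, hσT, subcube_eq_of_mem hb]
      exact self_mem_subcube u

end Coordinates

/-! ### Hamilton cycles -/

section Final

variable {n : ℕ} {D : Finset (Fin n)} {R : Finset (Fin n) → Finset (Fin n) → Prop}

/-- A matching with directions in `D` extends to a maximal one. -/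
theorem exists_isMaximalMatching {M : Finset (Fin n) → Finset (Fin n) → Prop}
    (hsymm : ∀ x y, M x y → M y x) (hunique : ∀ x y z, M x y → M x z → y = z)
    (hdir : ∀ x y, M x y → ∃ i ∈ D, y = symmDiff x {i}) :
    ∃ R, (∀ x y, M x y → R x y) ∧ IsMaximalMatching D R := by
  let P : (Finset (Fin n) → Finset (Fin n) → Prop) → Prop := fun R =>
    (∀ x y, R x y → R y x) ∧ (∀ x y z, R x y → R x z → y = z) ∧
      ∀ x y, R x y → ∃ i ∈ D, y = symmDiff x {i}
  obtain ⟨R, hMR, hR⟩ := Finite.exists_le_maximal (p := P) ⟨hsymm, hunique, hdir⟩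
  obtain ⟨h₁, h₂, h₃⟩ := hR.prop
  refine ⟨R, fun x y h => hMR x y h, h₁, h₂, h₃, fun x i hi => ?_⟩
  by_contra! hc
  obtain ⟨hx, hy⟩ := hc
  have hnew : P fun z w => R z w ∨ (z = x ∧ w = symmDiff x {i}) ∨ (z = symmDiff x {i} ∧ w = x) := by
    have hne : symmDiff x {i} ≠ x := fun h => (adj_symmDiff_singleton x i).ne h.symm
    refine ⟨fun z w h => ?_, fun z w w' h h' => ?_, fun z w h => ?_⟩
    · rcases h with h | h | h
      · exact .inl (h₁ z w h)
      · exact .inr (.inr ⟨h.2, h.1⟩)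
      · exact .inr (.inl ⟨h.2, h.1⟩)
    · rcases h with h | ⟨rfl, rfl⟩ | ⟨rfl, rfl⟩
      · rcases h' with h' | ⟨rfl, rfl⟩ | ⟨rfl, rfl⟩
        · exact h₂ z w w' h h'
        · exact absurd h (hx w)
        · exact absurd h (hy w)
      · rcases h' with h' | ⟨-, rfl⟩ | ⟨h', -⟩
        · exact absurd h' (hx w')
        · rfl
        · exact absurd h'.symm hne
      · rcases h' with h' | ⟨h', -⟩ | ⟨-, rfl⟩
        · exact absurd h' (hy w')
        · exact absurd h' hne
        · rfl
    · rcases h with h | ⟨rfl, rfl⟩ | ⟨rfl, rfl⟩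
      · exact h₃ z w h
      · exact ⟨i, hi, rfl⟩
      · exact ⟨i, hi, (symmDiff_singleton_cancel _ _).symm⟩
  exact hx _ (hR.le_of_ge hnew (fun z w h => .inl h) x (symmDiff x {i}) (.inr (.inl ⟨rfl, rfl⟩)))

theorem mem_edges_of_infix {V : Type*} {G : SimpleGraph V} {u w x y : V} (p : G.Walk u w)
    (h : [x, y] <:+: p.support) : s(x, y) ∈ p.edges := by
  induction p with
  | nil =>
    have := h.length_le
    simp at this
  | @cons u v w huv p ih =>
    rw [SimpleGraph.Walk.support_cons, List.infix_cons_iff] at h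
    rw [SimpleGraph.Walk.edges_cons, List.mem_cons]
    rcases h with h | h
    · left
      rw [← SimpleGraph.Walk.cons_tail_support p, List.cons_prefix_cons, List.cons_prefix_cons] at h
      rw [h.1, h.2.1]
    · exact .inr (ih h)

/-- A list which is a Hamilton path with adjacent ends closes up to a Hamilton cycle. -/
theorem exists_isHamiltonianCycle {V : Type*} [DecidableEq V] [Fintype V] {G : SimpleGraph V}
    {R : V → V → Prop} {l : List V} {u w : V} (h : IsSpanningPath G Set.univ R l u w)
    (hwu : G.Adj w u) (hV : 3 ≤ Fintype.card V) :
    ∃ (a : V) (C : G.Walk a a), C.IsHamiltonianCycle ∧ ∀ x y, R x y → s(x, y) ∈ C.edges := by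
  obtain ⟨p, hp⟩ : ∃ p : G.Walk u w, p.support = l := by
    have hne : l ≠ [] := by
      rintro rfl
      simpa using h.head
    have hu : l.head hne = u := by
      have := h.head
      rwa [List.head?_eq_some_head hne, Option.some.injEq] at this
    have hw : l.getLast hne = w := by
      have := h.last
      rwa [List.getLast?_eq_some_getLast hne, Option.some.injEq] at this
    subst hu hw
    exact ⟨.ofSupport l hne h.chain, SimpleGraph.Walk.support_ofSupport hne h.chain⟩
  have hpath : p.IsPath := .mk' (hp ▸ h.nodup)
  have hham : p.IsHamiltonian := hpath.isHamiltonian_of_mem fun v => by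
    rw [hp, h.mem]
    exact Set.mem_univ v
  have hlen := hham.length_eq
  refine ⟨w, .cons hwu p, ?_, fun x y hxy => ?_⟩
  · rw [SimpleGraph.Walk.isHamiltonianCycle_iff_isCycle_and_length_eq]
    have hcard : (SimpleGraph.Walk.cons hwu p).length = Fintype.card V := by
      rw [SimpleGraph.Walk.length_cons]
      omega
    refine ⟨SimpleGraph.Walk.isCycle_iff_isPath_tail_and_le_length.2 ⟨?_, hcard ▸ hV⟩, hcard⟩
    simpa using hpath
  · rw [SimpleGraph.Walk.edges_cons]
    refine List.mem_cons_of_mem _ ?_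
    rcases h.covers x (Set.mem_univ x) y (Set.mem_univ y) hxy with hc | hc
    · exact mem_edges_of_infix p (hp.symm ▸ hc)
    · rw [Sym2.eq_swap]
      exact mem_edges_of_infix p (hp.symm ▸ hc)

theorem subcube_univ (u : Finset (Fin n)) : subcube u Finset.univ = Set.univ :=
  Set.eq_univ_of_forall fun _ => Finset.subset_univ _

/-- The whole cube has a closable path. The second case of `hD` covers the dimensions below five,
where the 4-cube is settled by the family for matchings without crossings. -/
theorem IsMaximalMatching.exists_hasClosablePath_univ (hR : IsMaximalMatching D R) (hn : 2 ≤ n)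
    (hD : D.card = 5 ∨ (D = Finset.univ ∧ n < 5)) :
    ∃ u i, HasClosablePath Finset.univ R u i := by
  rcases hD with hD | ⟨rfl, hn5⟩
  · by_cases h : D = Finset.univ
    · obtain ⟨J, -, hJ, hgood⟩ := hR.exists_hasClosablePath hD ∅
      obtain ⟨j, hj⟩ := Finset.card_pos.1 (show 0 < J.card by omega)
      exact ⟨∅, j, h ▸ hgood j hj⟩
    · obtain ⟨j, hj⟩ := not_forall.1 (mt Finset.eq_univ_iff_forall.2 h)
      have := hasClosablePath_union hR.direction (fun u => by
        obtain ⟨J, hJD, hJ, hgood⟩ := hR.exists_hasClosablePath hD u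
        exact ⟨J, hJD, by omega, hgood⟩) Dᶜ disjoint_compl_right ∅ (Finset.mem_compl.2 hj)
      rw [Finset.union_compl] at this
      exact ⟨∅, j, this⟩
  · have hcard : (Finset.univ : Finset (Fin n)).card = n := by simp
    obtain ⟨σ, hσ, hσD⟩ := exists_enumeration (Finset.card_pos.1
      (show 0 < (Finset.univ : Finset (Fin n)).card by omega))
    rw [hcard] at hσ hσD
    have hA : IsCodeMatching n 0 (codeEdges n ∅ σ R) :=
      hR.isCodeMatching hσ (fun _ _ => Finset.mem_univ _) fun v _ => by
        simp [hσD]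
    have : ∃ j < n, Linkable n [(0, flipBit 0 j)] (codeEdges n ∅ σ R) := by
      obtain rfl | rfl | rfl : n = 2 ∨ n = 3 ∨ n = 4 := by omega
      · exact exists_linkable_two _ hA
      · exact exists_linkable_three _ hA
      · exact hasFreeDirections.cycle _ hA
    obtain ⟨j, hj, h⟩ := this
    rw [← hσD] at hR ⊢
    exact ⟨∅, σ j, hR.hasClosablePath_of_linkable hσ hj h⟩

end Final

end HypercubeMatching

open HypercubeMatching in
theorem theorem1p4 (n : ℕ) (hn : 2 ≤ n) (M : (hypercube n).Subgraph) (hM : M.IsMatching)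
    (hdir : (spannedDirections M).ncard ≤ 5) :
    ∃ (a : Finset (Fin n)) (C : (hypercube n).Walk a a),
      C.IsHamiltonianCycle ∧ ∀ e ∈ M.edgeSet, e ∈ C.edges := by
  classical
  obtain ⟨D, hMD, hD⟩ : ∃ D : Finset (Fin n), spannedDirections M ⊆ D ∧
      (D.card = 5 ∨ (D = Finset.univ ∧ n < 5)) := by
    by_cases hn5 : n < 5
    · exact ⟨Finset.univ, by simp, .inr ⟨rfl, hn5⟩⟩
    · rw [Set.ncard_eq_toFinset_card'] at hdir
      obtain ⟨D, hD, -, hcard⟩ := Finset.exists_subsuperset_card_eq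
        (Finset.subset_univ (spannedDirections M).toFinset) hdir (by simpa using hn5)
      exact ⟨D, by simpa using hD, .inl hcard⟩
  obtain ⟨R, hMR, hR⟩ := exists_isMaximalMatching (M := M.Adj) (D := D) (fun x y h => h.symm)
    (fun x y z h h' => hM.eq_of_adj_left h h') fun x y h => by
      obtain ⟨i, hi⟩ := Finset.card_eq_one.1 h.adj_sub
      exact ⟨i, hMD ⟨x, y, h, hi⟩, by rw [← hi, symmDiff_symmDiff_cancel_left]⟩
  obtain ⟨u, i, l, hl⟩ := hR.exists_hasClosablePath_univ hn hD
  rw [subcube_univ] at hl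
  obtain ⟨a, C, hC, hRC⟩ := exists_isHamiltonianCycle hl (adj_symmDiff_singleton u i).symm (by
    rw [Fintype.card_finset, Fintype.card_fin]
    exact le_trans (by norm_num) (Nat.pow_le_pow_right two_pos hn))
  refine ⟨a, C, ?_, ?_⟩
  · convert hC
  · intro e
    induction e with
    | _ x y => exact fun h => hRC x y (hMR x y h)
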